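/- **Setting.** Let $\mathcal X=\mathbb R^2\times L^2((0,1);\mathbb R^2)$ with $\|(Z,\zeta)\|_{\mathcal X}^2=\|Z\|_2^2+\|\zeta\|_{L^2}^2$, and likewise $\|(Z,\zeta,W)\|_{\mathcal X\times\mathbb R^2}^2=\|Z\|_2^2+\|\zeta\|_{L^2}^2+\|W\|_2^2$. For $\epsilon>0$ consider the semilinear single-track vehicle model $$\dot X=A_1X+G_1\bigl[\mathscr K_1z+\Sigma(\alpha(X,U))\mathscr K_2z\bigr]+G_1h_1(\alpha(X,U))+b,$$ $$\epsilon\,\partial_tz+\Lambda\,\partial_\xi z=\Sigma(\alpha(X,U))\bigl[z+\mathscr K_3z\bigr]+\mathscr K_4z+h_2(\alpha(X,U)),\qquad z(0,t)=0,$$ with $X(t),U(t)\in\mathbb R^2$, $z(\cdot,t)\in L^2((0,1);\mathbb R^2)$, $\alpha(X,U)=A_2X+G_2U$. Here $A_1,A_2,G_1,G_2\in\mathbb R^{2\times2}$ and $b\in\mathbb R^2$ are constant, $\Lambda$ is symmetric positive definite, $\Sigma:\mathbb R^2\to\mathbb R^{2\times2}$ and $h_1,h_2:\mathbb R^2\to\mathbb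 R^2$ are continuous, $\mathscr K_i\zeta=\int_0^1K_i(\xi)\zeta(\xi)\,d\xi$ for $i=1,2,3$, and $\mathscr K_4\zeta=\int_0^1K_4(\xi)\zeta(\xi)\,d\xi+K_5\zeta(1)$, with $K_1,\dots,K_4\in C^0([0,1];\mathbb R^{2\times2})$ and $K_5\in\mathbb R^{2\times2}$. The measured output is the yaw rate $Y=CX$, $C=[0\;\;1]$. All data other than $\epsilon$ are fixed (independent of $\epsilon$). **Assumptions.** 1. (Strict dissipativity.) Let $\mathscr A\zeta=-\Lambda\,\partial_\xi\zeta+\mathscr K_4\zeta$ with domain $\mathscr D(\mathscr A)=\{\zeta\in H^1((0,1);\mathbb R^2):\zeta(0)=0\}$. There are a continuous diagonal positive definite $\mathscr Q:[0,1]\to\mathbb R^{2\times2}$ and $\omega>0$ such that $\langle\mathscr A\zeta,\mathscr Q\zeta\rangle_{L^2}\le-\omega\|\zeta\|_{L^2}^2$ for all $\zeta\in\mathscr D(\mathscr A)$. 2. (Dissipativity and Lipschitz continuity of $\Sigma$.) With the same $\mathscr Q$, $\int_0^1\zeta^{\mathrm T}(\xi)\mathscr Q(\xi)\Sigma(y)[\zeta(\xi)+\mathscr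 K_3\zeta]\,d\xi\le0$ for all $y\in\mathbb R^2$, $\zeta\in L^2((0,1);\mathbb R^2)$, and $\Sigma$ is globally Lipschitz continuous. 3. (Smooth steady states.) For $y\in\mathbb R^2$ let $\varphi(\cdot,y)\in C^1([0,1];\mathbb R^2)$ be the solution (which under 1 and 2 exists and is unique) of $\Lambda\,\partial_\xi\varphi=\Sigma(y)[\varphi+\mathscr K_3\varphi]+\mathscr K_4\varphi+h_2(y)$ on $(0,1)$, $\varphi(0,y)=0$, and let $\Phi(y)=\mathscr K_1\varphi(\cdot,y)+\Sigma(y)\mathscr K_2\varphi(\cdot,y)+h_1(y)$. Then $\varphi\in C^1([0,1]\times\mathbb R^2;\mathbb R^2)$, $\partial\varphi/\partial y$ is bounded on $[0,1]\times\mathbb R^2$, and $\Phi\in C^1(\mathbb R^2;\mathbb R^2)$. Let $(X^\star,U^\star)\in\mathbb R^4$ be an equilibrium: $A_1X^\star+G_1\Phi(\alpha^\star)+b=0$ with $\alpha^\star=A_2X^\star+G_2U^\star$ (and $z^\star=\varphi(\cdot,\alpha^\star)$). Let $\tilde C=\frac{d\Phi}{dy}(\alpha^\star)$ (Jacobian matrix),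 $\tilde A_1=A_1+G_1\tilde CA_2$, $\tilde G_1=G_1\tilde CG_2$. 4. (Stabilizability.) The pair $(\tilde A_1,\tilde G_1)$ is stabilizable. 5. (Detectability.) The pair $(\tilde A_1,C)$ is detectable. **Controller and observer.** Let $F\in\mathbb R^{2\times2}$ and $L\in\mathbb R^{2\times1}$ be such that $$\tilde A^*=\begin{bmatrix}\tilde A_1+\tilde G_1F&-G_1\tilde CG_2F\\0&\tilde A_1+LC\end{bmatrix}$$ is Hurwitz. Use the observer and the control law $$\dot{\hat X}=A_1\hat X+G_1\Phi(\alpha(\hat X,U))+b-L(Y-C\hat X),\qquad U=U^\star+F(\hat X-X^\star),$$ and set $\tilde X=X-\hat X$ and $\zeta(\cdot,t)=z(\cdot,t)-\varphi(\cdot,\alpha(X(t),U(t)))$. A mild solution of the coupled system is a continuous $(X,z,\tilde X)$ that satisfies the two ordinary differential equations (in integrated form) and the variation-of-constants formula for $z$ with respect to the $C_0$-semigroup on $L^2((0,1);\mathbb R^2)$ generated by $\frac1\epsilon\mathscr A$. **Theorem.** Under Assumptions 1–5 there exist $\bar\epsilon^*,\bar r_\epsilon,\bar\beta,\bar\sigma>0$,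 independent of $\epsilon$ and of the initial data, such that for all $\epsilon\in(0,\bar\epsilon^*)$ and all initial data $(X_0,z_0,\tilde X_0)\in\mathcal X\times\mathbb R^2$ with $\|(X_0-X^\star,\zeta_0,\tilde X_0)\|_{\mathcal X\times\mathbb R^2}<\bar r_\epsilon$, where $\zeta_0=\zeta(\cdot,0)$, the coupled plant–PDE–observer system has a unique global mild solution $(X,z,\tilde X)\in C^0(\mathbb R_{\ge0};\mathcal X\times\mathbb R^2)$, and for all $t\ge0$ $$\|(X(t)-X^\star,\zeta(\cdot,t),\tilde X(t))\|_{\mathcal X\times\mathbb R^2}\le\bar\beta e^{-\bar\sigma t}\|(X_0-X^\star,\zeta_0,\tilde X_0)\|_{\mathcal X\times\mathbb R^2}.$$ -/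

import Mathlib

open Set Filter Topology MeasureTheory
open scoped ContDiff RealInnerProductSpace

/-! ### Spaces and matrices -/

/-- The Euclidean plane. -/
abbrev E2 : Type := EuclideanSpace ℝ (Fin 2)

/-- Lebesgue measure on the open unit interval. -/
noncomputable abbrev unitVol : Measure ℝ := volume.restrict (Ioo (0 : ℝ) 1)

/-- The Hilbert space `L²((0,1); ℝ²)`. -/
abbrev L2 : Type := Lp E2 2 unitVol

/-- A real matrix as a continuous linear map between Euclidean spaces. -/
noncomputable def mv {m n : ℕ} (M : Matrix (Fin m) (Fin n) ℝ) :
    EuclideanSpace ℝ (Fin n) →L[ℝ] EuclideanSpace ℝ (Fin m) :=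
  LinearMap.toContinuousLinearMap (Matrix.toEuclideanLin M)

/-- The class in `L²((0,1); ℝ²)` of a square-integrable function on `(0,1)`. -/
noncomputable def toL2 (f : ℝ → E2) : L2 :=
  open Classical in if h : MemLp f 2 unitVol then h.toLp f else 0

/-- The norm of `ℝ² × L²((0,1); ℝ²) × ℝ²`:
`‖(Z, ζ, W)‖² = ‖Z‖₂² + ‖ζ‖_{L²}² + ‖W‖₂²`. -/
noncomputable def stateNorm (Z : E2) (ζ : L2) (W : E2) : ℝ :=
  Real.sqrt (‖Z‖ ^ 2 + ‖ζ‖ ^ 2 + ‖W‖ ^ 2)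

/-- A real square matrix is Hurwitz if all its complex eigenvalues have negative real part. -/
def IsHurwitz {n : Type*} [Fintype n] [DecidableEq n] (M : Matrix n n ℝ) : Prop :=
  ∀ μ ∈ spectrum ℂ (M.map (fun x : ℝ => (x : ℂ))), μ.re < 0

/-- `(A, B)` is stabilizable: `A + B K` is Hurwitz for some gain `K`. -/
def IsStabilizable {n m : ℕ} (A : Matrix (Fin n) (Fin n) ℝ) (B : Matrix (Fin n) (Fin m) ℝ) :
    Prop :=
  ∃ K : Matrix (Fin m) (Fin n) ℝ, IsHurwitz (A + B * K)

/-- `(A, C)` is detectable: `A + L C` is Hurwitz for some gain `L`. -/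
def IsDetectable {n p : ℕ} (A : Matrix (Fin n) (Fin n) ℝ) (C : Matrix (Fin p) (Fin n) ℝ) :
    Prop :=
  ∃ L : Matrix (Fin n) (Fin p) ℝ, IsHurwitz (A + L * C)

/-- The Jacobian matrix of a map of the plane. -/
noncomputable def jacobian (f : E2 → E2) (y : E2) : Matrix (Fin 2) (Fin 2) ℝ :=
  Matrix.of fun i j => (fderiv ℝ f y (EuclideanSpace.single j 1)) i

/-! ### `H¹((0,1); ℝ²)` and strongly continuous semigroups -/

/-- `g ∈ L²` is the weak derivative of `ζ ∈ L²` on `(0,1)`. -/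
def HasWeakDeriv (ζ g : L2) : Prop :=
  ∀ ψ : ℝ → ℝ, ContDiff ℝ ∞ ψ → HasCompactSupport ψ → tsupport ψ ⊆ Ioo (0 : ℝ) 1 →
    ∫ ξ, deriv ψ ξ • ζ ξ ∂unitVol = -∫ ξ, ψ ξ • g ξ ∂unitVol

/-- `f` is the continuous representative on `[0,1]` of `ζ ∈ L²`; its values at `0` and `1`
are the boundary values of `ζ`. -/
def IsContRep (ζ : L2) (f : ℝ → E2) : Prop :=
  ContinuousOn f (Icc 0 1) ∧ ⇑ζ =ᵐ[unitVol] f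

/-- `T` (considered at times `t ≥ 0`) is a `C₀`-semigroup on `L²((0,1); ℝ²)`. -/
structure IsC0Semigroup (T : ℝ → L2 →L[ℝ] L2) : Prop where
  zero : T 0 = ContinuousLinearMap.id ℝ L2
  add : ∀ s t : ℝ, 0 ≤ s → 0 ≤ t → T (s + t) = (T s).comp (T t)
  strongCont : ∀ x : L2, Tendsto (fun t => T t x) (𝓝[>] 0) (𝓝 x)

/-- The unbounded operator with graph `G` is the infinitesimal generator of `T`. -/
def IsGenerator (T : ℝ → L2 →L[ℝ] L2) (G : L2 → L2 → Prop) : Prop :=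
  ∀ x y : L2, G x y ↔ Tendsto (fun t : ℝ => t⁻¹ • (T t x - x)) (𝓝[>] 0) (𝓝 y)

/-! ### The semilinear single-track model -/

/-- The data of the ODE–PDE system
`X' = A₁ X + G₁ [𝒦₁ z + Σ(α) 𝒦₂ z] + G₁ h₁(α) + b`,
`ε ∂ₜz + Λ ∂_ξ z = Σ(α) [z + 𝒦₃ z] + 𝒦₄ z + h₂(α)`, `z(0,t) = 0`,
where `α = A₂ X + G₂ U`, `𝒦ᵢ ζ = ∫ Kᵢ ζ` for `i = 1, 2, 3`, and `𝒦₄ ζ = ∫ K₄ ζ + K₅ ζ(1)`. -/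
structure SingleTrackModel where
  A₁ : Matrix (Fin 2) (Fin 2) ℝ
  A₂ : Matrix (Fin 2) (Fin 2) ℝ
  G₁ : Matrix (Fin 2) (Fin 2) ℝ
  G₂ : Matrix (Fin 2) (Fin 2) ℝ
  b : E2
  /-- transport velocities -/
  Lam : Matrix (Fin 2) (Fin 2) ℝ
  /-- nonlinear source matrix -/
  Sig : E2 → Matrix (Fin 2) (Fin 2) ℝ
  h₁ : E2 → E2
  h₂ : E2 → E2
  K₁ : ℝ → Matrix (Fin 2) (Fin 2) ℝ
  K₂ : ℝ → Matrix (Fin 2) (Fin 2) ℝ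
  K₃ : ℝ → Matrix (Fin 2) (Fin 2) ℝ
  K₄ : ℝ → Matrix (Fin 2) (Fin 2) ℝ
  K₅ : Matrix (Fin 2) (Fin 2) ℝ
  Lam_posDef : Lam.PosDef
  Sig_cont : Continuous Sig
  h₁_cont : Continuous h₁
  h₂_cont : Continuous h₂
  K₁_cont : ContinuousOn K₁ (Icc 0 1)
  K₂_cont : ContinuousOn K₂ (Icc 0 1)
  K₃_cont : ContinuousOn K₃ (Icc 0 1)
  K₄_cont : ContinuousOn K₄ (Icc 0 1)

/-- `∫₀¹ K(ξ) f(ξ) dξ`. -/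
noncomputable def kernelInt (K : ℝ → Matrix (Fin 2) (Fin 2) ℝ) (f : ℝ → E2) : E2 :=
  ∫ ξ, mv (K ξ) (f ξ) ∂unitVol

/-- The output matrix: only the yaw rate (second state) is measured. -/
def yawRateOutput : Matrix (Fin 1) (Fin 2) ℝ := !![0, 1]

namespace SingleTrackModel

variable (P : SingleTrackModel)

/-- Apparent slip angles `α(X,U) = A₂ X + G₂ U`. -/
noncomputable def slip (X U : E2) : E2 := mv P.A₂ X + mv P.G₂ U

/-- Graph of `𝒜 ζ = -Λ ∂_ξ ζ + 𝒦₄ ζ` with domain `{ζ ∈ H¹((0,1); ℝ²) | ζ(0) = 0}`. -/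
def transportOp (ζ η : L2) : Prop :=
  ∃ (g : L2) (f : ℝ → E2), HasWeakDeriv ζ g ∧ IsContRep ζ f ∧ f 0 = 0 ∧
    ∀ᵐ ξ ∂unitVol, η ξ = -mv P.Lam (g ξ) + (kernelInt P.K₄ ζ + mv P.K₅ (f 1))

/-- Graph of `(1/ε) 𝒜`, with the domain of `𝒜`. -/
def fastOp (ε : ℝ) (ζ η : L2) : Prop :=
  ∃ η₀ : L2, P.transportOp ζ η₀ ∧ η = ε⁻¹ • η₀

/-- `f ∈ C¹([0,1]; ℝ²)` solves the stationary problem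
`Λ f' = Σ(y) [f + 𝒦₃ f] + 𝒦₄ f + h₂(y)` on `(0,1)`, `f(0) = 0`. -/
def IsSteadyProfile (y : E2) (f : ℝ → E2) : Prop :=
  ContDiffOn ℝ 1 f (Icc 0 1) ∧ f 0 = 0 ∧
    ∀ ξ ∈ Ioo (0 : ℝ) 1,
      mv P.Lam (deriv f ξ) =
        mv (P.Sig y) (f ξ + kernelInt P.K₃ f) + (kernelInt P.K₄ f + mv P.K₅ (f 1)) + P.h₂ y

/-- `φ(·, y)`: the solution of the stationary problem (only its values on `[0,1]` matter). -/
noncomputable def profile (y : E2) : ℝ → E2 :=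
  Classical.epsilon fun f => P.IsSteadyProfile y f

/-- The steady-state tire forces `Φ(y) = 𝒦₁ φ(·,y) + Σ(y) 𝒦₂ φ(·,y) + h₁(y)`. -/
noncomputable def steadyForce (y : E2) : E2 :=
  kernelInt P.K₁ (P.profile y) + mv (P.Sig y) (kernelInt P.K₂ (P.profile y)) + P.h₁ y

/-- `X⋆` is the equilibrium state for the constant input `U⋆`:
`A₁ X⋆ + G₁ Φ(α⋆) + b = 0` with `α⋆ = A₂ X⋆ + G₂ U⋆` (and then `z⋆ = φ(·, α⋆)`). -/
def IsEquilibrium (Xs Us : E2) : Prop :=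
  mv P.A₁ Xs + mv P.G₁ (P.steadyForce (P.slip Xs Us)) + P.b = 0

/-! ### Structural assumptions -/

/-- Strict dissipativity of `𝒜` with respect to a continuous, diagonal, positive definite
weight `Q` on `[0,1]` and a rate `ω₀ > 0`. -/
structure StrictlyDissipative (Q : ℝ → Matrix (Fin 2) (Fin 2) ℝ) (ω₀ : ℝ) : Prop where
  Q_cont : ContinuousOn Q (Icc 0 1)
  Q_diag : ∀ ξ ∈ Icc (0 : ℝ) 1, (Q ξ).IsDiag
  Q_posDef : ∀ ξ ∈ Icc (0 : ℝ) 1, (Q ξ).PosDef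
  rate_pos : 0 < ω₀
  dissip : ∀ ζ η : L2, P.transportOp ζ η →
    ∫ ξ, ⟪η ξ, mv (Q ξ) (ζ ξ)⟫ ∂unitVol ≤ -ω₀ * ‖ζ‖ ^ 2

/-- Dissipativity and global Lipschitz continuity of the source matrix `Σ`. -/
structure SourceDissipative (Q : ℝ → Matrix (Fin 2) (Fin 2) ℝ) : Prop where
  dissip : ∀ (y : E2) (ζ : L2),
    ∫ ξ, ⟪ζ ξ, mv (Q ξ) (mv (P.Sig y) (ζ ξ + kernelInt P.K₃ ζ))⟫ ∂unitVol ≤ 0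
  lipschitz : ∃ LSig : ℝ, 0 ≤ LSig ∧
    ∀ y₁ y₂ : E2, ‖mv (P.Sig y₁ - P.Sig y₂)‖ ≤ LSig * ‖y₁ - y₂‖

/-- `φ ∈ C¹([0,1] × ℝ²; ℝ²)` with `∂φ/∂y` uniformly bounded, and `Φ ∈ C¹(ℝ²; ℝ²)`. -/
structure SmoothSteadyState : Prop where
  profile_C1 : ContDiffOn ℝ 1 (fun p : ℝ × E2 => P.profile p.2 p.1) (Icc (0 : ℝ) 1 ×ˢ univ)
  force_C1 : ContDiff ℝ 1 P.steadyForce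
  profile_bound : ∃ M : ℝ, 0 ≤ M ∧
    ∀ ξ ∈ Icc (0 : ℝ) 1, ∀ y : E2, ‖fderiv ℝ (fun y' => P.profile y' ξ) y‖ ≤ M

/-! ### Linearization of the reduced system -/

/-- Generalized cornering stiffnesses `C̃(α⋆) = dΦ/dy (α⋆)`. -/
noncomputable def stiffness (αs : E2) : Matrix (Fin 2) (Fin 2) ℝ := jacobian P.steadyForce αs

/-- `Ã₁ = A₁ + G₁ C̃ A₂`. -/
noncomputable def Atilde (αs : E2) : Matrix (Fin 2) (Fin 2) ℝ :=
  P.A₁ + P.G₁ * P.stiffness αs * P.A₂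

/-- `G̃₁ = G₁ C̃ G₂`. -/
noncomputable def Gtilde (αs : E2) : Matrix (Fin 2) (Fin 2) ℝ :=
  P.G₁ * P.stiffness αs * P.G₂

/-- The closed-loop matrix
`Ã⋆ = [[Ã₁ + G̃₁ F, -G₁ C̃ G₂ F], [0, A₁ + G₁ C̃ A₂ + L C]]`. -/
noncomputable def closedLoopMatrix (αs : E2) (F : Matrix (Fin 2) (Fin 2) ℝ)
    (L : Matrix (Fin 2) (Fin 1) ℝ) : Matrix (Fin 2 ⊕ Fin 2) (Fin 2 ⊕ Fin 2) ℝ :=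
  Matrix.fromBlocks
    (P.Atilde αs + P.Gtilde αs * F) (-(P.G₁ * P.stiffness αs * P.G₂ * F))
    0 (P.A₁ + P.G₁ * P.stiffness αs * P.A₂ + L * yawRateOutput)

/-! ### The coupled plant–PDE–observer system -/

/-- Right-hand side of the vehicle ODE. -/
noncomputable def odeRHS (X U : E2) (z : L2) : E2 :=
  mv P.A₁ X
    + mv P.G₁ (kernelInt P.K₁ z + mv (P.Sig (P.slip X U)) (kernelInt P.K₂ z))
    + mv P.G₁ (P.h₁ (P.slip X U)) + P.b

/-- The semilinear source `Σ(α) [z + 𝒦₃ z] + h₂(α)` of the PDE, as an element of `L²`. -/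
noncomputable def pdeSource (X U : E2) (z : L2) : L2 :=
  (mv (P.Sig (P.slip X U))).compLp (z + Lp.const 2 unitVol (kernelInt P.K₃ z))
    + Lp.const 2 unitVol (P.h₂ (P.slip X U))

/-- Right-hand side `A₁ X̂ + G₁ Φ(α(X̂,U)) + b - L (Y - C X̂)` of the observer. -/
noncomputable def observerRHS (L : Matrix (Fin 2) (Fin 1) ℝ) (Xhat U : E2)
    (Y : EuclideanSpace ℝ (Fin 1)) : E2 :=
  mv P.A₁ Xhat + mv P.G₁ (P.steadyForce (P.slip Xhat U)) + P.b
    - mv L (Y - mv yawRateOutput Xhat)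

/-- The output-feedback law `U = U⋆ + F (X̂ - X⋆)`. -/
noncomputable def feedback (Xs Us : E2) (F : Matrix (Fin 2) (Fin 2) ℝ) (Xhat : E2) : E2 :=
  Us + mv F (Xhat - Xs)

/-- The deviation `ζ = z - φ(·, α(X,U))` from the quasi-steady profile, with
`U = U⋆ + F (X̂ - X⋆)` and `X̂ = X - X̃`. -/
noncomputable def deviation (Xs Us : E2) (F : Matrix (Fin 2) (Fin 2) ℝ)
    (X : E2) (z : L2) (Xt : E2) : L2 :=
  z - toL2 (P.profile (P.slip X (feedback Xs Us F (X - Xt))))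

/-- `(X, z, X̃) ∈ C⁰(ℝ≥0; ℝ² × L² × ℝ²)` is a global mild solution of the closed loop of the
model, the observer (with state `X̂ = X - X̃` and measurement `Y = C X`) and the output-feedback
law, with initial data `(X₀, z₀, X̃₀)`: the variation-of-constants formula holds with the
`C₀`-semigroup generated by `(1/ε) 𝒜` on `L²` (the two ODEs are in integrated form). -/
def IsMildSolution (ε : ℝ) (Xs Us : E2) (F : Matrix (Fin 2) (Fin 2) ℝ)
    (L : Matrix (Fin 2) (Fin 1) ℝ) (X₀ : E2) (z₀ : L2) (Xt₀ : E2)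
    (X : ℝ → E2) (z : ℝ → L2) (Xt : ℝ → E2) : Prop :=
  ContinuousOn X (Ici 0) ∧ ContinuousOn z (Ici 0) ∧ ContinuousOn Xt (Ici 0) ∧
  ∃ T : ℝ → L2 →L[ℝ] L2, IsC0Semigroup T ∧ IsGenerator T (P.fastOp ε) ∧
    let Xhat : ℝ → E2 := fun t => X t - Xt t
    let U : ℝ → E2 := fun t => feedback Xs Us F (Xhat t)
    ∀ t : ℝ, 0 ≤ t →
      X t = X₀ + ∫ s in (0 : ℝ)..t, P.odeRHS (X s) (U s) (z s) ∧
      z t = T t z₀ + ∫ s in (0 : ℝ)..t, T (t - s) (ε⁻¹ • P.pdeSource (X s) (U s) (z s)) ∧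
      Xhat t = (X₀ - Xt₀)
        + ∫ s in (0 : ℝ)..t, P.observerRHS L (Xhat s) (U s) (mv yawRateOutput (X s))

end SingleTrackModel

/-! The argument is a singular perturbation argument with the composite Lyapunov function V = p(x,x)
+ q(ζ,ζ). Here x = (X - X⋆, X - X̂) is the slow deviation, ζ = z - φ(·,α) is the fast one, p is a
quadratic Lyapunov form of the Hurwitz closed-loop matrix (`IsHurwitz.exists_lyapunov`), and q is
the L² inner product weighted by `Q`.

In the slow equations the tire force equals Φ(α) plus a term linear in ζ. Linearizing Φ at α⋆
produces exactly the closed-loop matrix, with an error η‖x‖ + C‖ζ‖ where η is as small as desired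
near the equilibrium (`exists_linearization`). In the fast equation the steady-state relation
removes h₂, and Σ(α) acts on ζ dissipatively, so its factor 1/ε does no harm. The operator (1/ε)𝒜
contributes -2(κ₀/ε) q(ζ,ζ), while the motion of the profile φ(·,α) costs only a multiple of ‖ζ‖‖α'‖
with a constant free of ε. For small ε the gain absorbs every coupling term
(`exists_lyapunovRate_le`). The estimate needs only x to be small, so sublevel sets of V of a size
independent of ε are invariant and V decays exponentially on them (`exp_decay_of_dini`,
`exists_decay`).

Mild solutions are not differentiable, so V is differentiated in the sense of upper right Dini
derivatives. This rests on z(t+h) = T(h) z(t) + h g(t) + o(h), on the q-decay of the semigroup T,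
and on the fact that the profile lies in the domain of 𝒜 (`energy_dini`).

Well-posedness has two ingredients. First, 𝒜 is dissipative for q and onto, hence generates a
semigroup by Yosida approximation (`exists_semigroup`), and the generator determines that semigroup
(`semigroup_unique`). Secondly, the nonlinearity is Lipschitz on bounded sets: h₁ and h₂ are only
assumed continuous, but the steady-state relations express them through φ, Φ and Σ. A radially
truncated problem is solved globally by contraction (`exists_mild`). The decay estimate confines its
solution to the ball where truncation is invisible. The same estimate applies to any other mild
solution, and Gronwall's inequality gives uniqueness (`mild_unique`). -/

/-! ### Maximal dissipative relations for an equivalent inner product -/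

section Dissipative

variable {H : Type*} [NormedAddCommGroup H] [InnerProductSpace ℝ H]

/-- `q` is an inner product on `H`, with `c ‖x‖² ≤ q x x`. -/
structure IsEquivInner (q : H →L[ℝ] H →L[ℝ] ℝ) (c : ℝ) : Prop where
  symm : ∀ x y, q x y = q y x
  pos : 0 < c
  coercive : ∀ x, c * ‖x‖ ^ 2 ≤ q x x

/-- The graph `G` is linear, single-valued, strictly dissipative for `q` with rate `κ`, and onto. -/
structure IsMDissipative (q : H →L[ℝ] H →L[ℝ] ℝ) (κ : ℝ) (G : H → H → Prop) : Prop where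
  add : ∀ {x y x' y'}, G x y → G x' y' → G (x + x') (y + y')
  smul : ∀ (a : ℝ) {x y}, G x y → G (a • x) (a • y)
  zero_right : ∀ {y}, G 0 y → y = 0
  rate_pos : 0 < κ
  dissip : ∀ {x y}, G x y → q y x ≤ -κ * q x x
  surj : ∀ v, ∃ x, G x v

variable {q : H →L[ℝ] H →L[ℝ] ℝ} {c κ : ℝ} {G : H → H → Prop}

lemma IsEquivInner.nonneg (hq : IsEquivInner q c) (x : H) : 0 ≤ q x x :=
  (mul_nonneg hq.pos.le (sq_nonneg _)).trans (hq.coercive x)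

lemma apply_le_norm (q : H →L[ℝ] H →L[ℝ] ℝ) (x y : H) : |q x y| ≤ ‖q‖ * ‖x‖ * ‖y‖ :=
  q.le_opNorm₂ x y

lemma IsEquivInner.norm_le (hq : IsEquivInner q c) {a : ℝ} (ha : 0 < a) {x v : H}
    (h : a * q x x ≤ -q v x) : ‖x‖ ≤ ‖q‖ / (c * a) * ‖v‖ := by
  have h1 := hq.coercive x
  have h2 := (abs_le.1 (apply_le_norm q v x)).1
  have hc := hq.pos
  rcases eq_or_lt_of_le (norm_nonneg x) with h0 | h0
  · rw [← h0]; positivity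
  have h3 : c * a * ‖x‖ * ‖x‖ ≤ ‖q‖ * ‖v‖ * ‖x‖ := by nlinarith
  have h4 := le_of_mul_le_mul_right h3 h0
  rw [div_mul_eq_mul_div, le_div_iff₀ (by positivity)]
  linarith

lemma IsEquivInner.norm_le_of_apply_le (hq : IsEquivInner q c) {x y : H} (h : q x x ≤ q y y) :
    ‖x‖ ≤ Real.sqrt (‖q‖ / c) * ‖y‖ := by
  have hc := hq.pos
  refine le_of_sq_le_sq ?_ (by positivity) |>.trans le_rfl
  rw [mul_pow, Real.sq_sqrt (by positivity), div_mul_eq_mul_div, le_div_iff₀ hc]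
  have h1 := hq.coercive x
  have h2 := (abs_le.1 (apply_le_norm q y y)).2
  nlinarith

lemma IsEquivInner.eq_zero (hq : IsEquivInner q c) {x : H} (h : q x x ≤ 0) : x = 0 := by
  have h1 := hq.coercive x
  have hc := hq.pos
  by_contra hx
  have : 0 < ‖x‖ := norm_pos_iff.2 hx
  have : 0 < c * ‖x‖ ^ 2 := by positivity
  linarith

namespace IsMDissipative

lemma neg (hG : IsMDissipative q κ G) {x y : H} (h : G x y) : G (-x) (-y) := by
  simpa using hG.smul (-1) h

lemma sub (hG : IsMDissipative q κ G) {x y x' y' : H} (h : G x y) (h' : G x' y') :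
    G (x - x') (y - y') := by
  simpa [sub_eq_add_neg] using hG.add h (hG.neg h')

/-- The constant does not depend on `C`. This uniformity lets `exists_perturbed` switch a
perturbation on in equal steps. -/
lemma norm_le (hG : IsMDissipative q κ G) (hq : IsEquivInner q c) {C : H →L[ℝ] H}
    (hC : ∀ x, q (C x) x ≤ 0) {x y : H} (h : G x y) :
    ‖x‖ ≤ ‖q‖ / (c * κ) * ‖y + C x‖ := by
  refine hq.norm_le hG.rate_pos ?_
  have := hG.dissip h
  have := hC x
  simp only [map_add, add_apply]
  linarith

/-- With `R` solving the problem for `C` alone, the solution is the fixed point of x ↦ R(v - Dx), a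
contraction of constant K‖D‖ ≤ 1/2. -/
lemma exists_of_small [CompleteSpace H] (hG : IsMDissipative q κ G) {C D : H →L[ℝ] H} {K : ℝ}
    (hK : ∀ x y, G x y → ‖x‖ ≤ K * ‖y + C x‖) (hK0 : 0 ≤ K)
    (hs : ∀ v, ∃ x y, G x y ∧ y + C x = v) (hD : K * ‖D‖ ≤ 1 / 2) (v : H) :
    ∃ x y, G x y ∧ y + (C x + D x) = v := by
  choose R S hR hS using hs
  have hlip : ∀ x x', ‖R (v - D x) - R (v - D x')‖ ≤ 1 / 2 * ‖x - x'‖ := by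
    intro x x'
    have h1 := hK _ _ (hG.sub (hR (v - D x)) (hR (v - D x')))
    have h2 : S (v - D x) - S (v - D x') + C (R (v - D x) - R (v - D x')) = -(D (x - x')) := by
      rw [map_sub, map_sub]
      have e1 := hS (v - D x)
      have e2 := hS (v - D x')
      have : S (v - D x) - S (v - D x') + (C (R (v - D x)) - C (R (v - D x'))) =
        (S (v - D x) + C (R (v - D x))) - (S (v - D x') + C (R (v - D x'))) := by abel
      rw [this, e1, e2]; abel
    rw [h2, norm_neg] at h1
    calc _ ≤ K * (‖D‖ * ‖x - x'‖) := h1.trans (by gcongr; exact D.le_opNorm _)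
      _ = (K * ‖D‖) * ‖x - x'‖ := by ring
      _ ≤ _ := by gcongr
  have hc : ContractingWith (1 / 2) (fun x => R (v - D x)) := by
    refine ⟨by rw [← NNReal.coe_lt_coe]; norm_num, LipschitzWith.of_dist_le_mul fun x x' => ?_⟩
    rw [dist_eq_norm, dist_eq_norm]
    simpa using hlip x x'
  have hf : R (v - D (hc.fixedPoint _)) = hc.fixedPoint _ := hc.fixedPoint_isFixedPt
  set x := hc.fixedPoint _
  refine ⟨x, S (v - D x), by simpa [hf] using hR (v - D x), ?_⟩
  have := hS (v - D x)
  rw [hf] at this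
  rw [← add_assoc, this]; abel

/-- A bounded dissipative perturbation of a maximal dissipative operator is onto. -/
theorem exists_perturbed [CompleteSpace H] (hG : IsMDissipative q κ G) (hq : IsEquivInner q c)
    {C : H →L[ℝ] H} (hC : ∀ x, q (C x) x ≤ 0) (v : H) : ∃ x y, G x y ∧ y + C x = v := by
  have hc := hq.pos
  have hκ := hG.rate_pos
  set K := ‖q‖ / (c * κ) with hKdef
  have hK0 : 0 ≤ K := by positivity
  -- Method of continuity: `C` is reached through (k/N)C, and this `N` makes each increment satisfy
  -- K‖C‖/N ≤ 1/2.
  obtain ⟨N, hN⟩ := exists_nat_ge (2 * (K * ‖C‖) + 1)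
  have hN0 : (0 : ℝ) < N := by
    have : 0 ≤ K * ‖C‖ := by positivity
    linarith
  have main : ∀ k : ℕ, ∀ v, ∃ x y, G x y ∧ y + (((k : ℝ) / N) • C) x = v := by
    intro k
    induction k with
    | zero =>
      intro v
      obtain ⟨x, hx⟩ := hG.surj v
      exact ⟨x, v, hx, by simp⟩
    | succ k ih =>
      intro v
      have h1 : ∀ x, q ((((k : ℝ) / N) • C) x) x ≤ 0 := by
        intro x
        have := hC x
        simp only [smul_apply, map_smul, smul_eq_mul]
        exact mul_nonpos_of_nonneg_of_nonpos (by positivity) this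
      obtain ⟨x, y, hxy, h⟩ := hG.exists_of_small (D := (1 / (N : ℝ)) • C)
        (fun x y h => hG.norm_le hq h1 h) hK0 ih
        (by
          rw [norm_smul, Real.norm_of_nonneg (by positivity)]
          rw [show ‖q‖ / (c * κ) * (1 / (N : ℝ) * ‖C‖) = (K * ‖C‖) / N by rw [hKdef]; ring,
            div_le_iff₀ hN0]
          linarith) v
      refine ⟨x, y, hxy, ?_⟩
      rw [← h, ← add_apply, ← add_smul]
      congr 3
      push_cast
      ring
  obtain ⟨x, y, hxy, h⟩ := main N v
  exact ⟨x, y, hxy, by simpa [div_self hN0.ne'] using h⟩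

/-- By Lax–Milgram it suffices that a vector u which is q-orthogonal to the domain vanishes. Solve y
- w = u with (w, y) in the graph. Then 0 = q(u,w) = q(y,w) - q(w,w) ≤ -(κ+1) q(w,w), so w = 0, hence
y = 0 and u = 0. -/
theorem dense_domain [CompleteSpace H] (hG : IsMDissipative q κ G) (hq : IsEquivInner q c) :
    Dense {x | ∃ y, G x y} := by
  let D : Submodule ℝ H :=
    { carrier := {x | ∃ y, G x y}
      add_mem' := fun ⟨y, hy⟩ ⟨y', hy'⟩ => ⟨_, hG.add hy hy'⟩
      zero_mem' := by
        obtain ⟨x, hx⟩ := hG.surj 0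
        exact ⟨0, by simpa using hG.smul 0 hx⟩
      smul_mem' := fun a x ⟨y, hy⟩ => ⟨_, hG.smul a hy⟩ }
  have hco : IsCoercive q := ⟨c, hq.pos, fun x => by
    have := hq.coercive x
    rwa [mul_assoc, ← sq]⟩
  have : D.topologicalClosure = ⊤ := by
    rw [Submodule.topologicalClosure_eq_top_iff, Submodule.eq_bot_iff]
    intro v hv
    rw [Submodule.mem_orthogonal'] at hv
    obtain ⟨u, rfl⟩ := hco.continuousLinearEquivOfBilin.surjective v
    have hu : ∀ w ∈ D, q u w = 0 := fun w hw => by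
      rw [← hco.continuousLinearEquivOfBilin_apply]; exact hv w hw
    obtain ⟨w, y, hwy, h⟩ := hG.exists_perturbed hq (C := -ContinuousLinearMap.id ℝ H)
      (fun x => by simpa using hq.nonneg x) u
    have h1 := hu w ⟨y, hwy⟩
    have h2 := hG.dissip hwy
    have h3 : w = 0 := by
      refine hq.eq_zero ?_
      rw [← h] at h1
      simp at h1
      nlinarith [hq.nonneg w, hG.rate_pos]
    subst h3
    rw [hG.zero_right hwy] at h
    rw [← h]; simp
  exact Submodule.dense_iff_topologicalClosure_eq_top.2 this

/-- `R l` is the resolvent (l - G)⁻¹, obtained from `exists_perturbed` with the dissipative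
perturbation -l. The point of the bound is that l • R l stays bounded uniformly in l. -/
theorem exists_resolvent [CompleteSpace H] (hG : IsMDissipative q κ G) (hq : IsEquivInner q c) :
    ∃ R : ℝ → H →L[ℝ] H, ∀ l : ℝ, 0 < l →
      (∀ v, G (R l v) (l • R l v - v)) ∧ ‖R l‖ ≤ ‖q‖ / (c * l) := by
  have hc := hq.pos
  have key : ∀ l : ℝ, ∃ R : H →L[ℝ] H, 0 < l →
      (∀ v, G (R v) (l • R v - v)) ∧ ‖R‖ ≤ ‖q‖ / (c * l) := by
    intro l
    by_cases hl : 0 < l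
    swap
    · exact ⟨0, fun h => absurd h hl⟩
    have h1 : ∀ v, ∃ x, G x (l • x - v) := by
      intro v
      obtain ⟨x, y, hxy, h⟩ := hG.exists_perturbed hq (C := -(l • ContinuousLinearMap.id ℝ H))
        (fun x => by simpa using mul_nonneg hl.le (hq.nonneg x)) (-v)
      refine ⟨x, ?_⟩
      convert hxy using 1
      rw [← neg_eq_iff_eq_neg] at h
      rw [← h]; simp
    choose R hR using h1
    have hb : ∀ x v, G x (l • x - v) → ‖x‖ ≤ ‖q‖ / (c * l) * ‖v‖ := by
      intro x v h
      rw [← norm_neg v]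
      refine hq.norm_le hl ?_
      have h2 := hG.dissip h
      simp at h2 ⊢
      nlinarith [hq.nonneg x, hG.rate_pos]
    have huniq : ∀ x v, G x (l • x - v) → x = R v := by
      intro x v h
      have h2 := hG.sub h (hR v)
      have h3 := hb (x - R v) 0 (by convert h2 using 1; module)
      simpa [sub_eq_zero] using h3
    let R' : H →ₗ[ℝ] H :=
      { toFun := R
        map_add' := fun v w => (huniq _ _ (by
          convert hG.add (hR v) (hR w) using 1; module)).symm
        map_smul' := fun a v => (huniq _ _ (by
          have h := hG.smul a (hR v)
          rw [smul_sub, smul_comm a l] at h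
          exact h)).symm }
    refine ⟨R'.mkContinuous _ fun v => hb _ _ (hR v), fun _ => ⟨fun v => hR v, ?_⟩⟩
    exact LinearMap.mkContinuous_norm_le _ (by positivity) _
  choose R hR using key
  exact ⟨R, hR⟩

lemma resolvent_unique (hG : IsMDissipative q κ G) (hq : IsEquivInner q c)
    {l : ℝ} (hl : 0 < l) {x x' v : H} (h : G x (l • x - v)) (h' : G x' (l • x' - v)) : x = x' := by
  have h2 := hG.dissip (hG.sub h h')
  refine sub_eq_zero.1 (hq.eq_zero ?_)
  rw [show l • x - v - (l • x' - v) = l • (x - x') by module, map_smul] at h2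
  simp only [smul_apply, smul_eq_mul] at h2
  nlinarith [hq.nonneg (x - x'), hG.rate_pos]

end IsMDissipative

end Dissipative

/-! ### Generation of semigroups by Yosida approximation -/

section Generation

variable {H : Type*} [NormedAddCommGroup H] [InnerProductSpace ℝ H] [CompleteSpace H]
variable {q : H →L[ℝ] H →L[ℝ] ℝ} {c κ : ℝ} {G : H → H → Prop}

/-- These are the Yosida approximations B = l(l R(l) - 1) with l = n + 1. They commute by the
resolvent identity, and B x = l R(l) y whenever (x, y) is in the graph. -/
lemma IsMDissipative.exists_yosida (hG : IsMDissipative q κ G) (hq : IsEquivInner q c) :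
    ∃ B : ℕ → H →L[ℝ] H, (∀ m n, Commute (B m) (B n)) ∧ (∀ n u, q (B n u) u ≤ 0) ∧
      ∀ x y, G x y → Tendsto (fun n => B n x) atTop (𝓝 y) := by
  have hc := hq.pos
  obtain ⟨R, hR⟩ := hG.exists_resolvent hq
  have hl : ∀ n : ℕ, (0 : ℝ) < n + 1 := fun n => by positivity
  have hdiff : ∀ l m : ℝ, 0 < l → 0 < m → ∀ v,
      R m v - R l v = (l - m) • R l (R m v) := by
    intro l m hl hm v
    rw [← map_smul]
    refine hG.resolvent_unique hq hl ?_ ((hR l hl).1 _)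
    convert hG.sub ((hR m hm).1 v) ((hR l hl).1 v) using 1
    module
  have hcomm : ∀ l m : ℝ, 0 < l → 0 < m → R l * R m = R m * R l := by
    intro l m hl hm
    rcases eq_or_ne l m with rfl | hne
    · rfl
    ext v
    have h1 := hdiff l m hl hm v
    have h2 := hdiff m l hm hl v
    have h3 : (l - m) • (R l (R m v) - R m (R l v)) = 0 := by
      rw [smul_sub, ← h1, show (l - m) • R m (R l v) = -((m - l) • R m (R l v)) by module, ← h2]
      abel
    simpa [sub_eq_zero, sub_ne_zero.2 hne] using h3
  refine ⟨fun n => ((n : ℝ) + 1) • (((n : ℝ) + 1) • R (n + 1) - 1), ?_, ?_, ?_⟩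
  · intro m n
    have h := hcomm (m + 1) (n + 1) (hl m) (hl n)
    have h' : Commute (R (m + 1)) (R (n + 1)) := h
    refine Commute.smul_left (Commute.smul_right ?_ _) _
    refine Commute.sub_left (Commute.sub_right ?_ (Commute.one_right _)) (Commute.one_left _)
    exact Commute.smul_left (Commute.smul_right h' _) _
  · intro n u
    set l : ℝ := n + 1
    -- For w = l R(l) u the pair (w, Bu) is in the graph and u = w - (1/l) Bu. Hence q(Bu,u) =
    -- q(Bu,w) - (1/l) q(Bu,Bu) ≤ 0.
    have hl' : 0 < l := hl n
    have h1 := hG.smul l ((hR l hl').1 u)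
    set w := l • R l u with hw
    have e1 : l • (l • R l - 1 : H →L[ℝ] H) u = l • (w - u) := by simp [hw]
    have h2 := hG.dissip h1
    rw [smul_apply, e1]
    clear_value w
    have e3 : u = w - (1 / l) • (l • (w - u)) := by
      rw [smul_smul, one_div, inv_mul_cancel₀ hl'.ne']; simp
    have h4 : q (l • (w - u)) u = q (l • (w - u)) w - 1 / l * q (l • (w - u)) (l • (w - u)) := by
      refine (congrArg (q (l • (w - u))) e3).trans ?_
      rw [(q (l • (w - u))).map_sub, (q (l • (w - u))).map_smul, smul_eq_mul]
    rw [h4]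
    have h5 := mul_nonneg (one_div_pos.2 hl').le (hq.nonneg (l • (w - u)))
    nlinarith [hq.nonneg w, hG.rate_pos]
  · have hbd : ∀ n : ℕ, ‖((n : ℝ) + 1) • R (n + 1)‖ ≤ ‖q‖ / c := by
      intro n
      rw [norm_smul, Real.norm_of_nonneg (hl n).le]
      calc ((n : ℝ) + 1) * ‖R (n + 1)‖ ≤ (n + 1) * (‖q‖ / (c * (n + 1))) := by
            gcongr; exact (hR _ (hl n)).2
        _ = _ := by field_simp
    have hR0 : ∀ x, Tendsto (fun n : ℕ => R (n + 1) x) atTop (𝓝 0) := by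
      intro x
      rw [tendsto_zero_iff_norm_tendsto_zero]
      have h2 : Tendsto (fun n : ℕ => (‖q‖ / c * ‖x‖) * (1 / ((n : ℝ) + 1))) atTop (𝓝 0) := by
        simpa using (tendsto_one_div_add_atTop_nhds_zero_nat (𝕜 := ℝ)).const_mul (‖q‖ / c * ‖x‖)
      refine squeeze_zero (fun _ => norm_nonneg _) (fun n => ?_) h2
      refine ((R (n + 1)).le_opNorm x).trans ?_
      calc ‖R (n + 1)‖ * ‖x‖ ≤ (‖q‖ / (c * (n + 1))) * ‖x‖ := by
            gcongr; exact (hR _ (hl n)).2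
        _ = _ := by field_simp
    have hres : ∀ x y, G x y → ∀ l : ℝ, 0 < l → l • R l x - x = R l y := by
      intro x y hxy l hl'
      refine hG.resolvent_unique hq hl' ?_ ((hR l hl').1 y)
      convert hG.sub (hG.smul l ((hR l hl').1 x)) hxy using 1
    -- On the domain l R(l) x - x = R(l) y tends to 0; density and the uniform bound `hbd` extend
    -- this to every vector.
    have hid : ∀ y, Tendsto (fun n : ℕ => ((n : ℝ) + 1) • R (n + 1) y) atTop (𝓝 y) := by
      intro y
      rw [Metric.tendsto_atTop]
      intro e he
      have hpos : 0 < ‖q‖ / c + 1 := by positivity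
      obtain ⟨y', ⟨w, hw⟩, hy'⟩ := (hG.dense_domain hq).exists_dist_lt y
        (show 0 < e / (2 * (‖q‖ / c + 1)) by positivity)
      obtain ⟨N, hN⟩ := (Metric.tendsto_atTop.1 (hR0 w)) (e / 2) (by positivity)
      refine ⟨N, fun n hn => ?_⟩
      have h1 := hN n hn
      rw [dist_zero_right, ← hres y' w hw _ (hl n)] at h1
      rw [dist_eq_norm] at hy' ⊢
      have e1 : ((n : ℝ) + 1) • R (n + 1) y - y =
        (((n : ℝ) + 1) • R (n + 1)) (y - y') + (((n : ℝ) + 1) • R (n + 1) y' - y') - (y - y') := by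
        simp only [smul_apply, map_sub]
        module
      rw [e1]
      have h2 : ‖(((n : ℝ) + 1) • R (n + 1)) (y - y')‖ ≤ ‖q‖ / c * ‖y - y'‖ :=
        (ContinuousLinearMap.le_opNorm _ _).trans (by gcongr; exact hbd n)
      have h3 : (‖q‖ / c + 1) * ‖y - y'‖ < e / 2 := by
        rw [lt_div_iff₀ (by positivity)] at hy'
        linarith
      refine (norm_sub_le _ _).trans_lt ?_
      have := norm_add_le ((((n : ℝ) + 1) • R (n + 1)) (y - y'))
        (((n : ℝ) + 1) • R (n + 1) y' - y')
      linarith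
    intro x y hxy
    refine (hid y).congr fun n => ?_
    rw [← hres x y hxy _ (hl n)]
    rfl

lemma expSemigroup_contractive (hq : IsEquivInner q c) {B : H →L[ℝ] H}
    (hB : ∀ u, q (B u) u ≤ 0) {t : ℝ} (ht : 0 ≤ t) (u : H) :
    q (NormedSpace.exp (t • B) u) (NormedSpace.exp (t • B) u) ≤ q u u := by
  have hd : ∀ s : ℝ, HasDerivAt (fun s : ℝ => NormedSpace.exp (s • B) u)
      (B (NormedSpace.exp (s • B) u)) s := fun s => by
    simpa using (hasDerivAt_exp_smul_const' B s).clm_apply (hasDerivAt_const s u)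
  have hd2 : ∀ s : ℝ, HasDerivAt
      (fun s : ℝ => q (NormedSpace.exp (s • B) u) (NormedSpace.exp (s • B) u))
      (q (B (NormedSpace.exp (s • B) u)) (NormedSpace.exp (s • B) u) +
        q (NormedSpace.exp (s • B) u) (B (NormedSpace.exp (s • B) u))) s := fun s => by
    exact (q.hasFDerivAt.comp_hasDerivAt s (hd s)).clm_apply (hd s)
  have hanti : Antitone fun s : ℝ =>
      q (NormedSpace.exp (s • B) u) (NormedSpace.exp (s • B) u) := by
    refine antitone_of_deriv_nonpos (fun s => (hd2 s).differentiableAt) fun s => ?_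
    rw [(hd2 s).deriv, hq.symm (NormedSpace.exp (s • B) u) (B _)]
    have := hB (NormedSpace.exp (s • B) u)
    linarith
  simpa using hanti ht

lemma expSemigroup_norm_le (hq : IsEquivInner q c) {B : H →L[ℝ] H}
    (hB : ∀ u, q (B u) u ≤ 0) {t : ℝ} (ht : 0 ≤ t) (u : H) :
    ‖NormedSpace.exp (t • B) u‖ ≤ Real.sqrt (‖q‖ / c) * ‖u‖ :=
  hq.norm_le_of_apply_le (expSemigroup_contractive hq hB ht u)

lemma expSemigroup_sub_self_norm_le (hq : IsEquivInner q c) {B : H →L[ℝ] H}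
    (hB : ∀ u, q (B u) u ≤ 0) {t : ℝ} (ht : 0 ≤ t) (u : H) :
    ‖NormedSpace.exp (t • B) u - u‖ ≤ Real.sqrt (‖q‖ / c) * ‖B u‖ * t := by
  have hd : ∀ s : ℝ, HasDerivAt (fun s : ℝ => NormedSpace.exp (s • B) u)
      (NormedSpace.exp (s • B) (B u)) s := fun s => by
    simpa using (hasDerivAt_exp_smul_const B s).clm_apply (hasDerivAt_const s u)
  have := norm_image_sub_le_of_norm_deriv_le_segment' (a := 0) (b := t)
    (fun s _ => (hd s).hasDerivWithinAt)
    (fun s hs => expSemigroup_norm_le hq hB hs.1 (B u)) t ⟨ht, le_rfl⟩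
  simpa using this

lemma expSemigroup_taylor_norm_le {B : H →L[ℝ] H} {t : ℝ} (ht : 0 ≤ t) (u : H) {C : ℝ}
    (hC : ∀ s ∈ Icc 0 t, ‖NormedSpace.exp (s • B) (B u) - B u‖ ≤ C) :
    ‖NormedSpace.exp (t • B) u - u - t • B u‖ ≤ C * t := by
  have hd : ∀ s : ℝ, HasDerivAt (fun s : ℝ => NormedSpace.exp (s • B) u - s • B u)
      (NormedSpace.exp (s • B) (B u) - B u) s := fun s => by
    have h1 : HasDerivAt (fun s : ℝ => NormedSpace.exp (s • B) u)
      (NormedSpace.exp (s • B) (B u)) s := by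
        simpa using (hasDerivAt_exp_smul_const B s).clm_apply (hasDerivAt_const s u)
    have h2 : HasDerivAt (fun s : ℝ => s • B u) (B u) s := by
      simpa using (hasDerivAt_id s).smul_const (B u)
    exact h1.sub h2
  have := norm_image_sub_le_of_norm_deriv_le_segment' (a := 0) (b := t)
    (fun s _ => (hd s).hasDerivWithinAt)
    (fun s hs => hC s ⟨hs.1, hs.2.le⟩) t ⟨ht, le_rfl⟩
  convert this using 2
  · simp; abel
  · simp

/-- The curve s ↦ exp(sA) exp((t-s)B) u joins exp(tB)u to exp(tA)u. Since A and B commute, its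
derivative is exp(sA) exp((t-s)B)(Au - Bu), which involves A and B only through Au - Bu. -/
lemma expSemigroup_sub_norm_le (hq : IsEquivInner q c) {A B : H →L[ℝ] H} (hAB : Commute A B)
    (hA : ∀ u, q (A u) u ≤ 0) (hB : ∀ u, q (B u) u ≤ 0) {t : ℝ} (ht : 0 ≤ t) (u : H) :
    ‖NormedSpace.exp (t • A) u - NormedSpace.exp (t • B) u‖ ≤
      Real.sqrt (‖q‖ / c) ^ 2 * ‖A u - B u‖ * t := by
  have hdA : ∀ s : ℝ, HasDerivAt (fun s : ℝ => NormedSpace.exp (s • A))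
      (NormedSpace.exp (s • A) * A) s := hasDerivAt_exp_smul_const A
  have hdB : ∀ s : ℝ, HasDerivAt (fun s : ℝ => NormedSpace.exp ((t - s) • B) u)
      (-(B (NormedSpace.exp ((t - s) • B) u))) s := fun s => by
    have h1 := (hasDerivAt_exp_smul_const' B (t - s)).clm_apply (hasDerivAt_const (t - s) u)
    have h2 := h1.scomp s ((hasDerivAt_id s).const_sub t)
    simpa [Function.comp_def] using h2
  have hcB : ∀ s : ℝ, Commute B (NormedSpace.exp (s • B)) := fun s =>
    ((Commute.refl B).smul_right s).exp_right
  have hcA : ∀ s : ℝ, Commute A (NormedSpace.exp (s • B)) := fun s =>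
    (hAB.smul_right s).exp_right
  have hd : ∀ s : ℝ, HasDerivAt
      (fun s : ℝ => NormedSpace.exp (s • A) (NormedSpace.exp ((t - s) • B) u))
      (NormedSpace.exp (s • A) (NormedSpace.exp ((t - s) • B) (A u - B u))) s := fun s => by
    convert (hdA s).clm_apply (hdB s) using 1
    have e1 : A (NormedSpace.exp ((t - s) • B) u) = NormedSpace.exp ((t - s) • B) (A u) :=
      congrArg (fun f : H →L[ℝ] H => f u) (hcA (t - s)).eq
    have e2 : B (NormedSpace.exp ((t - s) • B) u) = NormedSpace.exp ((t - s) • B) (B u) :=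
      congrArg (fun f : H →L[ℝ] H => f u) (hcB (t - s)).eq
    simp only [mul_apply_eq_comp]
    rw [e1, e2, map_sub, map_sub, map_neg, sub_eq_add_neg]
  have hK := Real.sqrt_nonneg (‖q‖ / c)
  have := norm_image_sub_le_of_norm_deriv_le_segment' (a := 0) (b := t)
    (fun s _ => (hd s).hasDerivWithinAt)
    (fun s hs => (expSemigroup_norm_le hq hA hs.1 _).trans
      (mul_le_mul_of_nonneg_left (expSemigroup_norm_le hq hB (sub_nonneg.2 hs.2.le) _) hK))
    t ⟨ht, le_rfl⟩
  simp at this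
  rw [sq, mul_assoc (Real.sqrt (‖q‖ / c))]
  exact this

end Generation

/-! ### Strongly continuous semigroups -/

section Semigroup

variable {H : Type*} [NormedAddCommGroup H] [InnerProductSpace ℝ H]

/-- Strongly continuous semigroups (at times `t ≥ 0`) on a Hilbert space. -/
structure IsStrongSemigroup (T : ℝ → H →L[ℝ] H) : Prop where
  zero : T 0 = ContinuousLinearMap.id ℝ H
  add : ∀ s t : ℝ, 0 ≤ s → 0 ≤ t → T (s + t) = (T s).comp (T t)
  strongCont : ∀ x : H, Tendsto (fun t => T t x) (𝓝[>] 0) (𝓝 x)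

/-- The relation `G` is the graph of the generator of `T`. -/
def HasGenerator (T : ℝ → H →L[ℝ] H) (G : H → H → Prop) : Prop :=
  ∀ x y : H, G x y ↔ Tendsto (fun t : ℝ => t⁻¹ • (T t x - x)) (𝓝[>] 0) (𝓝 y)

variable {q : H →L[ℝ] H →L[ℝ] ℝ} {c κ : ℝ} {G : H → H → Prop} {T : ℝ → H →L[ℝ] H}

/-- T(t) is the strong limit of exp(tBₙ) for the Yosida approximations Bₙ. Everything is checked on
the dense domain, where Bₙx converges, and extended through the uniform bound K. -/
theorem IsMDissipative.exists_semigroup [CompleteSpace H] (hG : IsMDissipative q κ G)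
    (hq : IsEquivInner q c) : ∃ T : ℝ → H →L[ℝ] H, IsStrongSemigroup T ∧ HasGenerator T G := by
  obtain ⟨B, hcomm, hB, hlimB⟩ := hG.exists_yosida hq
  set K := Real.sqrt (‖q‖ / c) with hK
  have hK0 : 0 ≤ K := Real.sqrt_nonneg _
  have hdense := hG.dense_domain hq
  have hbound : ∀ (n : ℕ) (t : ℝ), 0 ≤ t → ∀ u, ‖NormedSpace.exp (t • B n) u‖ ≤ K * ‖u‖ :=
    by
    intro n t ht u
    exact expSemigroup_norm_le hq (hB n) ht u
  have hcauchy : ∀ t : ℝ, 0 ≤ t → ∀ x, CauchySeq fun n => NormedSpace.exp (t • B n) x := by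
    intro t ht x
    rw [Metric.cauchySeq_iff]
    intro e he
    obtain ⟨x', ⟨y, hy⟩, hx'⟩ := hdense.exists_dist_lt x (show 0 < e / (4 * (K + 1)) by positivity)
    obtain ⟨N, hN⟩ := Metric.cauchySeq_iff.1 (hlimB x' y hy).cauchySeq
      (e / (2 * (K ^ 2 * t + 1))) (by positivity)
    refine ⟨N, fun m hm n hn => ?_⟩
    have h1 := hN m hm n hn
    have h2 := expSemigroup_sub_norm_le hq (hcomm m n) (hB m) (hB n) ht x'
    rw [dist_eq_norm] at h1 hx' ⊢
    rw [lt_div_iff₀ (by positivity)] at h1 hx'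
    have e1 : NormedSpace.exp (t • B m) x - NormedSpace.exp (t • B n) x =
      NormedSpace.exp (t • B m) (x - x') - NormedSpace.exp (t • B n) (x - x') +
      (NormedSpace.exp (t • B m) x' - NormedSpace.exp (t • B n) x') := by
      simp only [map_sub]; abel
    rw [e1]
    have h3 := norm_add_le (NormedSpace.exp (t • B m) (x - x') - NormedSpace.exp (t • B n) (x - x'))
      (NormedSpace.exp (t • B m) x' - NormedSpace.exp (t • B n) x')
    have h4 := norm_sub_le (NormedSpace.exp (t • B m) (x - x')) (NormedSpace.exp (t • B n) (x - x'))
    have h5 := hbound m t ht (x - x')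
    have h6 := hbound n t ht (x - x')
    rw [← hK] at h2
    nlinarith [norm_nonneg (x - x'), norm_nonneg (B m x' - B n x')]
  have hlim : ∀ (t : ℝ) (x : H), ∃ y,
      Tendsto (fun n => NormedSpace.exp ((max t 0) • B n) x) atTop (𝓝 y) :=
    fun t x => cauchySeq_tendsto_of_complete (hcauchy _ (le_max_right _ _) x)
  choose f hf using hlim
  -- Clamping time at 0 makes the family total; the exponentials are controlled only for t ≥ 0.
  let T : ℝ → H →L[ℝ] H := fun t => continuousLinearMapOfTendsto
    (fun n => NormedSpace.exp ((max t 0) • B n)) (tendsto_pi_nhds.2 (hf t))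
  have hT : ∀ t, 0 ≤ t → ∀ x, Tendsto (fun n => NormedSpace.exp (t • B n) x) atTop (𝓝 (T t x)) := by
    intro t ht x
    have := hf t x
    rw [max_eq_left ht] at this
    exact this
  -- Continuity at time 0, uniformly in n. It passes to the limit, giving strong continuity of T,
  -- and also controls the Taylor remainder in `hgen`.
  have hequi : ∀ y, ∀ e > 0, ∃ δ > (0 : ℝ), ∀ n : ℕ, ∀ s ∈ Icc (0 : ℝ) δ,
      ‖NormedSpace.exp (s • B n) y - y‖ ≤ e := by
    intro y e he
    obtain ⟨y', ⟨z, hz⟩, hy'⟩ := hdense.exists_dist_lt y (show 0 < e / (2 * (K + 1)) by positivity)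
    obtain ⟨M, hM⟩ := (hlimB y' z hz).norm.bddAbove_range
    have hM' : ∀ n, ‖B n y'‖ ≤ M := fun n => hM ⟨n, rfl⟩
    have hM0 : 0 ≤ M := (norm_nonneg _).trans (hM' 0)
    refine ⟨e / (2 * (K * M + 1)), by positivity, fun n s hs => ?_⟩
    have h1 := expSemigroup_sub_self_norm_le hq (hB n) hs.1 y'
    have h2 := hbound n s hs.1 (y - y')
    have e1 : NormedSpace.exp (s • B n) y - y = NormedSpace.exp (s • B n) (y - y') - (y - y') +
      (NormedSpace.exp (s • B n) y' - y') := by simp only [map_sub]; abel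
    rw [e1]
    have h3 := norm_add_le (NormedSpace.exp (s • B n) (y - y') - (y - y'))
      (NormedSpace.exp (s • B n) y' - y')
    have h4 := norm_sub_le (NormedSpace.exp (s • B n) (y - y')) (y - y')
    rw [dist_eq_norm, lt_div_iff₀ (by positivity)] at hy'
    have h5 := hs.2
    rw [le_div_iff₀ (by positivity)] at h5
    have h6 : K * ‖B n y'‖ * s ≤ K * M * s := by
      have := hM' n
      have := hs.1
      gcongr
    have h7 : K * M * s ≤ e / 2 := by nlinarith [hs.1]
    rw [← hK] at h1
    linarith
  have hcontr : ∀ t, 0 ≤ t → ∀ u, q (T t u) (T t u) ≤ q u u := by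
    intro t ht u
    have h1 : Tendsto (fun n => q (NormedSpace.exp (t • B n) u) (NormedSpace.exp (t • B n) u))
        atTop (𝓝 (q (T t u) (T t u))) := by
      have hc : Continuous fun v => q v v := by fun_prop
      exact (hc.tendsto _).comp (hT t ht u)
    exact le_of_tendsto' h1 fun n => expSemigroup_contractive hq (hB n) ht u
  have hzero : T 0 = ContinuousLinearMap.id ℝ H := by
    ext x
    refine tendsto_nhds_unique (hT 0 le_rfl x) ?_
    simp
  have hgen : ∀ x y, G x y → Tendsto (fun t : ℝ => t⁻¹ • (T t x - x)) (𝓝[>] 0) (𝓝 y) := by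
    intro x y hxy
    rw [Metric.tendsto_nhdsWithin_nhds]
    intro e he
    obtain ⟨δ, hδ, h⟩ := hequi y (e / 2) (by positivity)
    refine ⟨δ, hδ, fun t ht htd => ?_⟩
    have ht0 : 0 < t := ht
    rw [dist_zero_right, Real.norm_of_nonneg ht0.le] at htd
    have h1 : ∀ n, ‖NormedSpace.exp (t • B n) x - x - t • B n x‖ ≤
        ((K + 1) * ‖B n x - y‖ + e / 2) * t := by
      intro n
      refine expSemigroup_taylor_norm_le ht0.le x fun s hs => ?_
      have e1 : NormedSpace.exp (s • B n) (B n x) - B n x =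
        NormedSpace.exp (s • B n) (B n x - y) - (B n x - y) +
        (NormedSpace.exp (s • B n) y - y) := by simp only [map_sub]; abel
      rw [e1]
      have h2 := norm_add_le (NormedSpace.exp (s • B n) (B n x - y) - (B n x - y))
        (NormedSpace.exp (s • B n) y - y)
      have h3 := norm_sub_le (NormedSpace.exp (s • B n) (B n x - y)) (B n x - y)
      have h4 := hbound n s hs.1 (B n x - y)
      have h5 := h n s ⟨hs.1, hs.2.trans htd.le⟩
      linarith
    have h2 : ‖T t x - x - t • y‖ ≤ ((K + 1) * ‖y - y‖ + e / 2) * t := by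
      have l1 := (((hT t ht0.le x).sub_const x).sub ((hlimB x y hxy).const_smul t)).norm
      have l2 := ((((hlimB x y hxy).sub_const y).norm.const_mul (K + 1)).add_const
        (e / 2)).mul_const t
      exact le_of_tendsto_of_tendsto' l1 l2 h1
    rw [sub_self, norm_zero, mul_zero, zero_add] at h2
    rw [dist_eq_norm]
    have e2 : t⁻¹ • (T t x - x) - y = t⁻¹ • (T t x - x - t • y) := by
      rw [smul_sub t⁻¹ _ (t • y), smul_smul, inv_mul_cancel₀ ht0.ne', one_smul]
    rw [e2, norm_smul, Real.norm_of_nonneg (by positivity)]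
    calc t⁻¹ * ‖T t x - x - t • y‖ ≤ t⁻¹ * (e / 2 * t) := by gcongr
      _ = e / 2 := by field_simp
      _ < e := by linarith
  refine ⟨T, ⟨hzero, ?_, ?_⟩, fun x y => ⟨hgen x y, fun h => ?_⟩⟩
  · intro s t hs ht
    ext x
    refine tendsto_nhds_unique (hT (s + t) (add_nonneg hs ht) x) ?_
    have h1 : ∀ n, NormedSpace.exp ((s + t) • B n) x =
        NormedSpace.exp (s • B n) (NormedSpace.exp (t • B n) x - T t x) +
          NormedSpace.exp (s • B n) (T t x) := by
      intro n
      have hcm : Commute (s • B n) (t • B n) := ((Commute.refl (B n)).smul_left s).smul_right t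
      let _ : NormedAlgebra ℚ (H →L[ℝ] H) := NormedAlgebra.restrictScalars ℚ ℝ _
      rw [add_smul, NormedSpace.exp_add_of_commute hcm, map_sub]
      simp
    simp_rw [h1]
    have h2 : Tendsto (fun n => NormedSpace.exp (s • B n) (NormedSpace.exp (t • B n) x - T t x))
        atTop (𝓝 0) := by
      refine squeeze_zero_norm (fun n => hbound n s hs _) ?_
      simpa using (((hT t ht x).sub_const (T t x)).norm).const_mul K
    simpa using h2.add (hT s hs (T t x))
  · intro x
    rw [Metric.tendsto_nhdsWithin_nhds]
    intro e he
    obtain ⟨δ, hδ, h⟩ := hequi x (e / 2) (by positivity)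
    refine ⟨δ, hδ, fun t ht htd => ?_⟩
    have ht0 : 0 < t := ht
    rw [dist_zero_right, Real.norm_of_nonneg ht0.le] at htd
    rw [dist_eq_norm]
    refine lt_of_le_of_lt (le_of_tendsto' (((hT t ht0.le x).sub_const x).norm)
      fun n => h n t ⟨ht0.le, htd.le⟩) (by linarith)
  -- So far the generator of T extends G; maximality gives equality. Choose (w, z) in G with z - w =
  -- y - x. Then x - w is in the domain of the generator with image y - z = x - w, and contractivity
  -- of T forces q(x-w, x-w) ≤ 0.
  · obtain ⟨w, z, hwz, hv⟩ := hG.exists_perturbed hq (C := -ContinuousLinearMap.id ℝ H)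
      (fun x => by simpa using hq.nonneg x) (y - x)
    have hd := h.sub (hgen w z hwz)
    have e1 : ∀ t : ℝ, t⁻¹ • (T t x - x) - t⁻¹ • (T t w - w) = t⁻¹ • (T t (x - w) - (x - w)) := by
      intro t; rw [map_sub]; module
    simp_rw [e1] at hd
    have hle : q (y - z) (x - w) ≤ 0 := by
      have hc : Continuous fun v => q v (x - w) := by fun_prop
      refine le_of_tendsto ((hc.tendsto _).comp hd) ?_
      filter_upwards [self_mem_nhdsWithin] with t ht
      have ht0 : 0 < t := ht
      simp only [Function.comp_apply, map_smul, smul_apply, smul_eq_mul]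
      refine mul_nonpos_of_nonneg_of_nonpos (by positivity) ?_
      have h1 := hcontr t ht0.le (x - w)
      have h2 := hq.nonneg (T t (x - w) - (x - w))
      set d := x - w
      simp only [map_sub, _root_.sub_apply] at h2 ⊢
      have := hq.symm d (T t d)
      linarith
    have hdz : y - z = x - w := by
      have : z + -w = y - x := by simpa using hv
      have h3 : z = y - x + w := by rw [← this]; abel
      rw [h3]; abel
    rw [hdz] at hle
    have h0 := hq.eq_zero hle
    rw [h0] at hdz
    rw [sub_eq_zero.1 h0, sub_eq_zero.1 hdz]
    exact hwz

namespace IsStrongSemigroup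

lemma tendsto_zero_right (hT : IsStrongSemigroup T) (x : H) :
    Tendsto (fun t => T t x) (𝓝[≥] 0) (𝓝 x) := by
  have h := hT.strongCont x
  have h0 : T 0 x = x := by rw [hT.zero]; rfl
  have : ContinuousWithinAt (fun t => T t x) (Ioi 0) 0 := by
    rw [ContinuousWithinAt, h0]; exact h
  have h1 : Tendsto (fun t => T t x) (𝓝[≥] 0) (𝓝 (T 0 x)) := continuousWithinAt_Ioi_iff_Ici.1 this
  rwa [h0] at h1

/-- Otherwise ‖T(tₙ)‖ is unbounded for some tₙ → 0, although T(tₙ)x converges for every x. This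
contradicts the Banach–Steinhaus theorem. -/
lemma exists_bound_near_zero [CompleteSpace H] (hT : IsStrongSemigroup T) :
    ∃ δ > 0, ∃ M : ℝ, ∀ t ∈ Icc 0 δ, ‖T t‖ ≤ M := by
  by_contra! hcon
  have h1 : ∀ n : ℕ, ∃ t ∈ Icc (0 : ℝ) (1 / ((n : ℝ) + 1)), (n : ℝ) < ‖T t‖ := fun n =>
    hcon _ (by positivity) n
  choose t ht htn using h1
  have htlim : Tendsto t atTop (𝓝[≥] 0) := by
    rw [tendsto_nhdsWithin_iff]
    exact ⟨squeeze_zero (fun n => (ht n).1) (fun n => (ht n).2)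
      tendsto_one_div_add_atTop_nhds_zero_nat, Eventually.of_forall fun n => (ht n).1⟩
  obtain ⟨C, hC⟩ := banach_steinhaus (g := fun n => T (t n)) fun x => by
    obtain ⟨M, hM⟩ := ((hT.tendsto_zero_right x).comp htlim).norm.bddAbove_range
    exact ⟨M, fun n => hM ⟨n, rfl⟩⟩
  obtain ⟨n, hn⟩ := exists_nat_gt C
  exact absurd (hC n) (not_le.2 (hn.trans (htn n)))

lemma exists_bound [CompleteSpace H] (hT : IsStrongSemigroup T) (τ : ℝ) :
    ∃ M : ℝ, 0 ≤ M ∧ ∀ t ∈ Icc 0 τ, ‖T t‖ ≤ M := by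
  obtain ⟨δ, hδ, M, hM⟩ := hT.exists_bound_near_zero
  have h1 : ∀ k : ℕ, ∀ t ∈ Icc 0 (((k : ℝ) + 1) * δ), ‖T t‖ ≤ (max M 1) ^ (k + 1) := by
    intro k
    induction k with
    | zero => intro t ht; simpa using Or.inl (hM t (by simpa using ht))
    | succ k ih =>
      intro t ht
      push_cast at ht
      rcases le_total t δ with h | h
      · calc ‖T t‖ ≤ max M 1 := (hM t ⟨ht.1, h⟩).trans (le_max_left _ _)
          _ ≤ _ := le_self_pow₀ (le_max_right _ _) (by omega)
      · have e : T t = (T δ).comp (T (t - δ)) := by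
          rw [← hT.add _ _ hδ.le (by linarith)]; congr 1; ring
        rw [e, pow_succ', ]
        refine (ContinuousLinearMap.opNorm_comp_le _ _).trans ?_
        have := ih (t - δ) ⟨by linarith, by linarith [ht.2]⟩
        have := hM δ ⟨hδ.le, le_rfl⟩
        have := le_max_left M 1
        gcongr
        exact (hM δ ⟨hδ.le, le_rfl⟩).trans (le_max_left _ _)
  obtain ⟨k, hk⟩ := exists_nat_ge (τ / δ)
  refine ⟨(max M 1) ^ (k + 1), by positivity, fun t ht => h1 k t ⟨ht.1, ht.2.trans ?_⟩⟩
  rw [div_le_iff₀ hδ] at hk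
  nlinarith

/-- Right continuity is immediate from the semigroup law. Factoring out the earlier time, T(s)x -
T(t)x is T(min s t) applied to ±(T(|s-t|)x - x), and the local bound handles both sides at once. -/
lemma continuousOn [CompleteSpace H] (hT : IsStrongSemigroup T) (x : H) :
    ContinuousOn (fun t => T t x) (Ici 0) := by
  intro t ht
  have ht0 : (0 : ℝ) ≤ t := ht
  obtain ⟨M, hM0, hM⟩ := hT.exists_bound (t + 1)
  have key : ∀ s ∈ Icc 0 (t + 1), ‖T s x - T t x‖ ≤ M * ‖T |s - t| x - x‖ := by
    intro s hs
    rcases le_total s t with h | h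
    · have e : T t x = T s (T |s - t| x) := by
        rw [← ContinuousLinearMap.comp_apply, ← hT.add _ _ hs.1 (abs_nonneg _), abs_sub_comm,
          abs_of_nonneg (by linarith)]
        congr 2; ring
      rw [e, ← map_sub, norm_sub_rev (T |s - t| x), ]
      exact ((T s).le_opNorm _).trans (by gcongr; exact hM s hs)
    · have e : T s x = T t (T |s - t| x) := by
        rw [← ContinuousLinearMap.comp_apply, ← hT.add _ _ ht0 (abs_nonneg _),
          abs_of_nonneg (by linarith)]
        congr 2; ring
      rw [e, ← map_sub]
      exact ((T t).le_opNorm _).trans (by gcongr; exact hM t ⟨ht0, by linarith⟩)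
  rw [ContinuousWithinAt, tendsto_iff_norm_sub_tendsto_zero]
  have h2 : Tendsto (fun s : ℝ => |s - t|) (𝓝[Ici 0] t) (𝓝[≥] 0) := by
    rw [tendsto_nhdsWithin_iff]
    refine ⟨?_, Eventually.of_forall fun s => mem_Ici.2 (abs_nonneg _)⟩
    have : Continuous fun s : ℝ => |s - t| := by fun_prop
    simpa using (this.tendsto t).mono_left nhdsWithin_le_nhds
  have h3 := ((((hT.tendsto_zero_right x).comp h2).sub_const x).norm).const_mul M
  rw [sub_self, norm_zero, mul_zero] at h3
  refine squeeze_zero' (Eventually.of_forall fun _ => norm_nonneg _) ?_ h3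
  have : Iio (t + 1) ∈ 𝓝[Ici 0] t := mem_nhdsWithin_of_mem_nhds (Iio_mem_nhds (by linarith))
  filter_upwards [self_mem_nhdsWithin, this] with s hs hs'
  exact key s ⟨hs, le_of_lt hs'⟩

lemma orbit_mem_generator (hT : IsStrongSemigroup T) (hTG : HasGenerator T G) {x y : H}
    (h : G x y) {t : ℝ} (ht : 0 ≤ t) : G (T t x) (T t y) := by
  rw [hTG] at h ⊢
  refine (((T t).continuous.tendsto y).comp h).congr' ?_
  filter_upwards [self_mem_nhdsWithin] with s hs
  have hs0 : (0 : ℝ) < s := hs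
  rw [Function.comp_apply, map_smul, map_sub, ← ContinuousLinearMap.comp_apply,
    ← hT.add _ _ ht hs0.le, add_comm, hT.add _ _ hs0.le ht, ContinuousLinearMap.comp_apply]

lemma hasDerivWithinAt_orbit (hT : IsStrongSemigroup T) (hTG : HasGenerator T G) {x y : H}
    (h : G x y) {t : ℝ} (ht : 0 ≤ t) :
    HasDerivWithinAt (fun t => T t x) (T t y) (Ici t) t := by
  have h1 := (hTG _ _).1 (hT.orbit_mem_generator hTG h ht)
  rw [← hasDerivWithinAt_Ioi_iff_Ici, hasDerivWithinAt_iff_tendsto_slope' (by simp)]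
  have h2 : Tendsto (fun s : ℝ => s - t) (𝓝[>] t) (𝓝[>] 0) := by
    rw [tendsto_nhdsWithin_iff]
    constructor
    · have : Continuous fun s : ℝ => s - t := by fun_prop
      simpa using (this.tendsto t).mono_left nhdsWithin_le_nhds
    · filter_upwards [self_mem_nhdsWithin] with s hs
      exact mem_Ioi.2 (sub_pos.2 (mem_Ioi.1 hs))
  refine (h1.comp h2).congr' ?_
  filter_upwards [self_mem_nhdsWithin] with s hs
  have hs0 : t < s := hs
  rw [Function.comp_apply, slope_def_module, ← ContinuousLinearMap.comp_apply (T (s - t)),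
    ← hT.add _ _ (by linarith) ht, sub_add_cancel]

end IsStrongSemigroup

/-- The right derivative of exp(2κs) q(w,w) is nonpositive. The curve `w` is arbitrary so that the
lemma covers a single orbit as well as the difference of orbits of two semigroups with the same
generator. -/
lemma IsMDissipative.orbit_decay (hG : IsMDissipative q κ G) (hq : IsEquivInner q c) {w w' : ℝ → H}
    (hw : ContinuousOn w (Ici 0)) (hw' : ∀ t, 0 ≤ t → HasDerivWithinAt w (w' t) (Ici t) t)
    (hGw : ∀ t, 0 ≤ t → G (w t) (w' t)) {t : ℝ} (ht : 0 ≤ t) :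
    q (w t) (w t) ≤ Real.exp (-(2 * κ) * t) * q (w 0) (w 0) := by
  have hd : ∀ s, 0 ≤ s → HasDerivWithinAt (fun s => Real.exp (2 * κ * s) * q (w s) (w s))
      (Real.exp (2 * κ * s) * (2 * κ) * q (w s) (w s) +
        Real.exp (2 * κ * s) * (q (w' s) (w s) + q (w s) (w' s))) (Ici s) s := by
    intro s hs
    have h1 : HasDerivWithinAt (fun s => Real.exp (2 * κ * s)) (Real.exp (2 * κ * s) * (2 * κ))
        (Ici s) s := by
      simpa using ((hasDerivAt_id s).const_mul (2 * κ)).exp.hasDerivWithinAt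
    have h2 := (q.hasFDerivAt.comp_hasDerivWithinAt s (hw' s hs)).clm_apply (hw' s hs)
    exact h1.mul h2
  have h := image_le_of_deriv_right_le_deriv_boundary (a := 0) (b := t)
    (f := fun s => Real.exp (2 * κ * s) * q (w s) (w s)) (B := fun _ => q (w 0) (w 0))
    (B' := fun _ => 0)
    (by
      have : ContinuousOn (fun s => q (w s) (w s)) (Icc 0 t) := by
        have h3 : ContinuousOn w (Icc 0 t) := hw.mono Icc_subset_Ici_self
        exact (q.continuous.comp_continuousOn h3).clm_apply h3
      have h4 : Continuous fun s => Real.exp (2 * κ * s) := by fun_prop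
      exact h4.continuousOn.mul this)
    (fun s hs => hd s hs.1) (by simp) continuousOn_const
    (fun s _ => hasDerivWithinAt_const _ _ _)
    (fun s hs => by
      have h1 := hG.dissip (hGw s hs.1)
      rw [hq.symm (w s) (w' s)]
      have := Real.exp_pos (2 * κ * s)
      nlinarith)
    (x := t) ⟨ht, le_rfl⟩
  have h1 : Real.exp (-(2 * κ) * t) * (Real.exp (2 * κ * t) * q (w t) (w t)) = q (w t) (w t) := by
    rw [← mul_assoc, ← Real.exp_add]; simp
  rw [← h1]
  exact mul_le_mul_of_nonneg_left h (Real.exp_pos _).le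

lemma IsMDissipative.semigroup_decay [CompleteSpace H] (hG : IsMDissipative q κ G)
    (hq : IsEquivInner q c) (hT : IsStrongSemigroup T) (hTG : HasGenerator T G) {t : ℝ}
    (ht : 0 ≤ t) (x : H) : q (T t x) (T t x) ≤ Real.exp (-(2 * κ) * t) * q x x := by
  have hcl : IsClosed {x | q (T t x) (T t x) ≤ Real.exp (-(2 * κ) * t) * q x x} := by
    apply isClosed_le <;> fun_prop
  refine closure_minimal ?_ hcl (hG.dense_domain hq x)
  rintro x ⟨y, hxy⟩
  have := hG.orbit_decay hq (hT.continuousOn x)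
    (fun t ht => hT.hasDerivWithinAt_orbit hTG hxy ht)
    (fun t ht => hT.orbit_mem_generator hTG hxy ht) ht
  simpa [hT.zero] using this

/-- A semigroup is determined by its generator. -/
lemma IsMDissipative.semigroup_unique [CompleteSpace H] (hG : IsMDissipative q κ G)
    (hq : IsEquivInner q c) (hT : IsStrongSemigroup T) (hTG : HasGenerator T G)
    {T' : ℝ → H →L[ℝ] H} (hT' : IsStrongSemigroup T') (hTG' : HasGenerator T' G) {t : ℝ}
    (ht : 0 ≤ t) : T t = T' t := by
  have hcl : IsClosed {x | T t x = T' t x} := isClosed_eq (T t).continuous (T' t).continuous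
  ext x
  refine closure_minimal ?_ hcl (hG.dense_domain hq x)
  rintro x ⟨y, hxy⟩
  have := hG.orbit_decay hq ((hT.continuousOn x).sub (hT'.continuousOn x))
    (fun t ht => (hT.hasDerivWithinAt_orbit hTG hxy ht).sub
      (hT'.hasDerivWithinAt_orbit hTG' hxy ht))
    (fun t ht => hG.sub (hT.orbit_mem_generator hTG hxy ht)
      (hT'.orbit_mem_generator hTG' hxy ht)) ht
  refine sub_eq_zero.1 (hq.eq_zero ?_)
  simpa [hT.zero, hT'.zero] using this

end Semigroup

/-! ### Matrices as operators, and multiplication operators on `L²` -/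

section MatrixOperators

lemma mv_apply {m n : ℕ} (M : Matrix (Fin m) (Fin n) ℝ) (x : EuclideanSpace ℝ (Fin n)) (i : Fin m) :
    mv M x i = ∑ j, M i j * x j := by
  simp [mv, Matrix.mulVec, dotProduct]

lemma mv_mul {m n k : ℕ} (A : Matrix (Fin m) (Fin n) ℝ) (B : Matrix (Fin n) (Fin k) ℝ)
    (x : EuclideanSpace ℝ (Fin k)) : mv (A * B) x = mv A (mv B x) := by
  simp [mv, Matrix.toLpLin_apply]

lemma mv_one (x : E2) : mv (1 : Matrix (Fin 2) (Fin 2) ℝ) x = x := by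
  simp [mv]

/-- The map `M ↦ mv M`. -/
noncomputable def mvLin (m n : ℕ) : Matrix (Fin m) (Fin n) ℝ →ₗ[ℝ]
    (EuclideanSpace ℝ (Fin n) →L[ℝ] EuclideanSpace ℝ (Fin m)) where
  toFun := mv
  map_add' A B := by ext x i; simp [mv]
  map_smul' a A := by ext x i; simp [mv]

lemma mv_add {m n : ℕ} (A B : Matrix (Fin m) (Fin n) ℝ) : mv (A + B) = mv A + mv B :=
  (mvLin m n).map_add A B

lemma mv_sub {m n : ℕ} (A B : Matrix (Fin m) (Fin n) ℝ) : mv (A - B) = mv A - mv B :=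
  (mvLin m n).map_sub A B

lemma mv_neg {m n : ℕ} (A : Matrix (Fin m) (Fin n) ℝ) : mv (-A) = -mv A :=
  (mvLin m n).map_neg A

lemma continuous_mv {m n : ℕ} : Continuous (mv : Matrix (Fin m) (Fin n) ℝ → _) :=
  (mvLin m n).continuous_of_finiteDimensional

lemma mv_inv_apply {M : Matrix (Fin 2) (Fin 2) ℝ} (hM : M.PosDef) (x : E2) :
    mv M (mv M⁻¹ x) = x := by
  rw [← mv_mul, Matrix.mul_nonsing_inv _ ((Matrix.isUnit_iff_isUnit_det _).1 hM.isUnit), mv_one]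

lemma mv_inv_apply' {M : Matrix (Fin 2) (Fin 2) ℝ} (hM : M.PosDef) (x : E2) :
    mv M⁻¹ (mv M x) = x := by
  rw [← mv_mul, Matrix.nonsing_inv_mul _ ((Matrix.isUnit_iff_isUnit_det _).1 hM.isUnit), mv_one]

variable {K : ℝ → Matrix (Fin 2) (Fin 2) ℝ}

lemma memLp_of_continuousOn {E : Type*} [NormedAddCommGroup E] {f : ℝ → E}
    (hf : ContinuousOn f (Icc 0 1)) (p : ENNReal) : MemLp f p unitVol := by
  obtain ⟨C, hC⟩ := isCompact_Icc.exists_bound_of_continuousOn hf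
  refine MemLp.of_bound ((hf.mono Ioo_subset_Icc_self).aestronglyMeasurable measurableSet_Ioo) C ?_
  filter_upwards [ae_restrict_mem measurableSet_Ioo] with x hx using hC x (Ioo_subset_Icc_self hx)

lemma continuousOn_mv (hK : ContinuousOn K (Icc 0 1)) :
    ContinuousOn (fun ξ => mv (K ξ)) (Icc 0 1) :=
  continuous_mv.comp_continuousOn hK

/-- Multiplication by a continuous matrix function. -/
lemma exists_mulOperator (hK : ContinuousOn K (Icc 0 1)) :
    ∃ M : L2 →L[ℝ] L2, ∀ ζ : L2, ⇑(M ζ) =ᵐ[unitVol] fun ξ => mv (K ξ) (ζ ξ) := by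
  have h := memLp_of_continuousOn (continuousOn_mv hK) ⊤
  refine ⟨ContinuousLinearMap.holderL unitVol ⊤ 2 2 (ContinuousLinearMap.id ℝ (E2 →L[ℝ] E2))
    (h.toLp _), fun ζ => ?_⟩
  have h1 := ContinuousLinearMap.coeFn_holder (r := 2) (ContinuousLinearMap.id ℝ (E2 →L[ℝ] E2))
    (h.toLp _) ζ
  refine h1.trans ?_
  filter_upwards [h.coeFn_toLp] with ξ hξ
  rw [hξ]; rfl

/-- The kernel functional as a bounded operator. -/
lemma exists_kernelOperator (hK : ContinuousOn K (Icc 0 1)) :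
    ∃ k : L2 →L[ℝ] E2, ∀ ζ : L2, k ζ = kernelInt K ζ := by
  have h := memLp_of_continuousOn (continuousOn_mv hK) 2
  refine ⟨ContinuousLinearMap.lpPairing unitVol 2 2 (ContinuousLinearMap.id ℝ (E2 →L[ℝ] E2))
    (h.toLp _), fun ζ => ?_⟩
  rw [ContinuousLinearMap.lpPairing_eq_integral, kernelInt]
  refine integral_congr_ae ?_
  filter_upwards [h.coeFn_toLp] with ξ hξ
  rw [hξ]; rfl

lemma kernelInt_congr {f g : ℝ → E2} (h : f =ᵐ[unitVol] g) : kernelInt K f = kernelInt K g := by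
  refine integral_congr_ae ?_
  filter_upwards [h] with ξ hξ
  rw [hξ]

lemma toL2_coe {f : ℝ → E2} (hf : ContinuousOn f (Icc 0 1)) : ⇑(toL2 f) =ᵐ[unitVol] f := by
  have h := memLp_of_continuousOn hf 2
  rw [toL2, dif_pos h]
  exact h.coeFn_toLp

lemma ae_unit {p : ℝ → Prop} (h : ∀ ξ ∈ Ioo (0 : ℝ) 1, p ξ) : ∀ᵐ ξ ∂unitVol, p ξ := by
  filter_upwards [ae_restrict_mem measurableSet_Ioo] with x hx using h x hx

lemma eqOn_Icc_of_ae_unit {f g : ℝ → E2} (h : f =ᵐ[unitVol] g) (hf : ContinuousOn f (Icc 0 1))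
    (hg : ContinuousOn g (Icc 0 1)) : EqOn f g (Icc 0 1) := by
  refine Measure.eqOn_Icc_of_ae_eq volume zero_ne_one ?_ hf hg
  rwa [← restrict_Ioo_eq_restrict_Icc]

lemma const_coe (c : E2) : ⇑(Lp.const 2 unitVol c : L2) =ᵐ[unitVol] fun _ => c :=
  Lp.coeFn_const 2 unitVol c

end MatrixOperators

/-! ### The weighted inner product -/

section Weight

variable {Q : ℝ → Matrix (Fin 2) (Fin 2) ℝ}

lemma mv_symm {M : Matrix (Fin 2) (Fin 2) ℝ} (hM : M.PosDef) (x y : E2) :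
    ⟪x, mv M y⟫ = ⟪y, mv M x⟫ := by
  have h : M 0 1 = M 1 0 := by
    have := hM.isHermitian.apply 1 0
    simpa using this
  simp only [PiLp.inner_apply, mv_apply, Fin.sum_univ_two]
  simp
  rw [h]; ring

/-- The diagonal entries are continuous and positive on a compact interval, so each has a positive
minimum. -/
lemma exists_diag_lower_bound (hQ : ContinuousOn Q (Icc 0 1))
    (hd : ∀ ξ ∈ Icc (0 : ℝ) 1, (Q ξ).IsDiag) (hp : ∀ ξ ∈ Icc (0 : ℝ) 1, (Q ξ).PosDef) :
    ∃ c > 0, ∀ ξ ∈ Icc (0 : ℝ) 1, ∀ x : E2, c * ‖x‖ ^ 2 ≤ ⟪x, mv (Q ξ) x⟫ := by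
  have hne : (Icc (0 : ℝ) 1).Nonempty := nonempty_Icc.2 zero_le_one
  have hi : ∀ i, ∃ c > 0, ∀ ξ ∈ Icc (0 : ℝ) 1, c ≤ Q ξ i i := by
    intro i
    have hc : ContinuousOn (fun ξ => Q ξ i i) (Icc 0 1) :=
      (continuous_apply_apply i i).comp_continuousOn hQ
    obtain ⟨ξ₀, h₀, hmin⟩ := isCompact_Icc.exists_isMinOn hne hc
    exact ⟨Q ξ₀ i i, (hp ξ₀ h₀).diag_pos, fun ξ hξ => hmin hξ⟩
  obtain ⟨c0, hc0, h0⟩ := hi 0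
  obtain ⟨c1, hc1, h1⟩ := hi 1
  refine ⟨min c0 c1, lt_min hc0 hc1, fun ξ hξ x => ?_⟩
  have e1 : Q ξ 0 1 = 0 := hd ξ hξ (by decide)
  have e2 : Q ξ 1 0 = 0 := hd ξ hξ (by decide)
  rw [EuclideanSpace.norm_sq_eq]
  simp only [PiLp.inner_apply, mv_apply, Fin.sum_univ_two, e1, e2]
  simp
  have := h0 ξ hξ
  have := h1 ξ hξ
  have := min_le_left c0 c1
  have := min_le_right c0 c1
  nlinarith [sq_nonneg (x 0), sq_nonneg (x 1)]

/-- The integral formula allows arbitrary representatives, because the images under operators such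
as `sourceOp` are known only almost everywhere. -/
lemma exists_weighted_inner (hQ : ContinuousOn Q (Icc 0 1))
    (hd : ∀ ξ ∈ Icc (0 : ℝ) 1, (Q ξ).IsDiag) (hp : ∀ ξ ∈ Icc (0 : ℝ) 1, (Q ξ).PosDef) :
    ∃ (q : L2 →L[ℝ] L2 →L[ℝ] ℝ) (c : ℝ), IsEquivInner q c ∧
      ∀ (ζ η : L2) (f g : ℝ → E2), ⇑ζ =ᵐ[unitVol] f → ⇑η =ᵐ[unitVol] g →
        q ζ η = ∫ ξ, ⟪f ξ, mv (Q ξ) (g ξ)⟫ ∂unitVol := by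
  obtain ⟨M, hM⟩ := exists_mulOperator hQ
  obtain ⟨c, hc, hcx⟩ := exists_diag_lower_bound hQ hd hp
  let q : L2 →L[ℝ] L2 →L[ℝ] ℝ :=
    (innerSL ℝ : L2 →L[ℝ] L2 →L[ℝ] ℝ).bilinearComp (ContinuousLinearMap.id ℝ L2) M
  have hq : ∀ ζ η : L2, q ζ η = ∫ ξ, ⟪ζ ξ, mv (Q ξ) (η ξ)⟫ ∂unitVol := by
    intro ζ η
    have : q ζ η = ⟪ζ, M η⟫ := rfl
    rw [this, L2.inner_def]
    refine integral_congr_ae ?_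
    filter_upwards [hM η] with ξ hξ
    rw [hξ]
  refine ⟨q, c, ⟨fun x y => ?_, hc, fun x => ?_⟩, fun ζ η f g hf hg => ?_⟩
  · rw [hq, hq]
    refine integral_congr_ae (ae_unit fun ξ hξ => ?_)
    exact mv_symm (hp ξ (Ioo_subset_Icc_self hξ)) _ _
  · rw [← real_inner_self_eq_norm_sq, L2.inner_def, hq, ← integral_const_mul]
    refine integral_mono_ae ((L2.integrable_inner x x).const_mul c) ?_ (ae_unit fun ξ hξ => ?_)
    · refine (L2.integrable_inner x (M x)).congr ?_
      filter_upwards [hM x] with ξ hξ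
      rw [hξ]
    · simpa using hcx ξ (Ioo_subset_Icc_self hξ) (x ξ)
  · rw [hq]
    refine integral_congr_ae ?_
    filter_upwards [hf, hg] with ξ hξ hξ'
    rw [hξ, hξ']

end Weight

/-! ### Primitives of square-integrable functions -/

section Primitive

/-- The primitive vanishing at `0`. -/
noncomputable def primitive (g : ℝ → E2) (ξ : ℝ) : E2 := ∫ s in (0 : ℝ)..ξ, g s

lemma integrable_coe (g : L2) : Integrable g unitVol :=
  (Lp.memLp g).integrable (by norm_num)

lemma integrableOn_Icc_coe (g : L2) : IntegrableOn g (Icc 0 1) volume := by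
  rw [integrableOn_Icc_iff_integrableOn_Ioo]; exact integrable_coe g

lemma intervalIntegrable_coe (g : L2) : IntervalIntegrable g volume 0 1 := by
  rw [intervalIntegrable_iff_integrableOn_Icc_of_le zero_le_one]
  exact integrableOn_Icc_coe g

lemma intervalIntegrable_coe' (g : L2) {ξ : ℝ} (hξ : ξ ∈ Icc (0 : ℝ) 1) :
    IntervalIntegrable g volume 0 ξ :=
  (intervalIntegrable_coe g).mono_set (by
    rw [uIcc_of_le hξ.1, uIcc_of_le zero_le_one]; exact Icc_subset_Icc_right hξ.2)

lemma primitive_zero (g : ℝ → E2) : primitive g 0 = 0 := by simp [primitive]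

lemma primitive_continuousOn (g : L2) : ContinuousOn (primitive g) (Icc 0 1) := by
  have := intervalIntegral.continuousOn_primitive_interval (μ := volume) (a := 0) (b := 1) (f := g)
    (by rw [uIcc_of_le zero_le_one]; exact integrableOn_Icc_coe g)
  rwa [uIcc_of_le zero_le_one] at this

lemma primitive_congr {f g : ℝ → E2} (h : f =ᵐ[unitVol] g) {ξ : ℝ} (hξ : ξ ∈ Icc (0 : ℝ) 1) :
    primitive f ξ = primitive g ξ := by
  refine intervalIntegral.integral_congr_ae ?_
  rw [EventuallyEq, ae_restrict_iff' measurableSet_Ioo] at h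
  have h1 : ∀ᵐ s : ℝ, s ≠ 1 := by
    simp [ae_iff]
  filter_upwards [h, h1] with s hs hs1 hsξ
  rw [uIoc_of_le hξ.1] at hsξ
  exact hs ⟨hsξ.1, lt_of_le_of_ne (hsξ.2.trans hξ.2) hs1⟩

lemma primitive_add (f g : L2) {ξ : ℝ} (hξ : ξ ∈ Icc (0 : ℝ) 1) :
    primitive (f + g : L2) ξ = primitive f ξ + primitive g ξ := by
  rw [primitive_congr (Lp.coeFn_add f g) hξ]
  exact intervalIntegral.integral_add (intervalIntegrable_coe' f hξ) (intervalIntegrable_coe' g hξ)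

lemma primitive_smul (a : ℝ) (g : L2) {ξ : ℝ} (hξ : ξ ∈ Icc (0 : ℝ) 1) :
    primitive (a • g : L2) ξ = a • primitive g ξ := by
  rw [primitive_congr (Lp.coeFn_smul a g) hξ]
  exact intervalIntegral.integral_smul a _

/-- The Volterra operator `g ↦ ∫₀^· g` on `L²`, as a linear map. -/
noncomputable def volterra : L2 →ₗ[ℝ] L2 where
  toFun g := toL2 (primitive g)
  map_add' f g := by
    apply Lp.ext
    filter_upwards [toL2_coe (primitive_continuousOn (f + g)), toL2_coe (primitive_continuousOn f),
      toL2_coe (primitive_continuousOn g), Lp.coeFn_add (toL2 (primitive f)) (toL2 (primitive g)),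
      ae_restrict_mem measurableSet_Ioo] with ξ h1 h2 h3 h4 hξ
    rw [h1, h4, Pi.add_apply, h2, h3, primitive_add f g (Ioo_subset_Icc_self hξ)]
  map_smul' a g := by
    apply Lp.ext
    filter_upwards [toL2_coe (primitive_continuousOn (a • g)), toL2_coe (primitive_continuousOn g),
      Lp.coeFn_smul a (toL2 (primitive g)), ae_restrict_mem measurableSet_Ioo] with ξ h1 h2 h3 hξ
    rw [h1, RingHom.id_apply, h3, Pi.smul_apply, h2, primitive_smul a g (Ioo_subset_Icc_self hξ)]

lemma volterra_coe (g : L2) : ⇑(volterra g) =ᵐ[unitVol] primitive g :=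
  toL2_coe (primitive_continuousOn g)

lemma isContRep_volterra (g : L2) : IsContRep (volterra g) (primitive g) :=
  ⟨primitive_continuousOn g, volterra_coe g⟩

lemma integral_unit_eq_interval {E : Type*} [NormedAddCommGroup E] [NormedSpace ℝ E] (f : ℝ → E) :
    ∫ ξ, f ξ ∂unitVol = ∫ ξ in (0 : ℝ)..1, f ξ := by
  rw [intervalIntegral.integral_of_le zero_le_one, integral_Ioc_eq_integral_Ioo]

lemma integrable_smul_coe {ψ : ℝ → ℝ} (hψ : Continuous ψ) (g : L2) :
    Integrable (fun ξ => ψ ξ • g ξ) unitVol := by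
  obtain ⟨C, hC⟩ := isCompact_Icc.exists_bound_of_continuousOn (s := Icc (0 : ℝ) 1) hψ.continuousOn
  exact (integrable_coe g).bdd_smul C hψ.aestronglyMeasurable
    (ae_unit fun ξ hξ => hC ξ (Ioo_subset_Icc_self hξ))

/-- Integration by parts for absolutely continuous functions, coordinate by coordinate. The boundary
terms vanish because the test function is supported in the open interval. -/
lemma hasWeakDeriv_volterra (g : L2) : HasWeakDeriv (volterra g) g := by
  intro ψ hψ _ hsupp
  have hψ1 : ContDiff ℝ 1 ψ := hψ.of_le (by exact_mod_cast le_top)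
  have hψ' : Continuous (deriv ψ) := hψ1.continuous_deriv le_rfl
  have h0 : ψ 0 = 0 := image_eq_zero_of_notMem_tsupport fun h => by simpa using hsupp h
  have h1 : ψ 1 = 0 := image_eq_zero_of_notMem_tsupport fun h => by simpa using hsupp h
  ext i
  let pr : E2 →L[ℝ] ℝ := EuclideanSpace.proj i
  have e1 : (∫ ξ, deriv ψ ξ • volterra g ξ ∂unitVol) i =
      ∫ ξ, deriv ψ ξ * (volterra g ξ) i ∂unitVol :=
    (pr.integral_comp_comm (integrable_smul_coe hψ' (volterra g))).symm
  have e2 : (∫ ξ, ψ ξ • g ξ ∂unitVol) i = ∫ ξ, ψ ξ * (g ξ) i ∂unitVol :=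
    (pr.integral_comp_comm (integrable_smul_coe hψ.continuous g)).symm
  have hgi : IntervalIntegrable (fun ξ => (g ξ) i) volume 0 1 := by
    have := intervalIntegrable_coe g
    exact ⟨pr.integrable_comp this.1, pr.integrable_comp this.2⟩
  set Gi : ℝ → ℝ := fun ξ => ∫ s in (0 : ℝ)..ξ, (g s) i with hGi
  have hGac : AbsolutelyContinuousOnInterval Gi 0 1 :=
    hgi.absolutelyContinuousOnInterval_intervalIntegral (by simp)
  have hψac : AbsolutelyContinuousOnInterval ψ 0 1 :=
    hψ1.contDiffOn.absolutelyContinuousOnInterval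
  have hparts := hψac.integral_mul_deriv_eq_deriv_mul hGac
  have e3 : ∫ ξ, deriv ψ ξ * (volterra g ξ) i ∂unitVol = ∫ ξ in (0 : ℝ)..1, deriv ψ ξ * Gi ξ := by
    rw [← integral_unit_eq_interval]
    refine integral_congr_ae ?_
    filter_upwards [volterra_coe g, ae_restrict_mem measurableSet_Ioo] with ξ hξ hξ'
    rw [hξ]
    congr 1
    exact (pr.intervalIntegral_comp_comm
      (intervalIntegrable_coe' g (Ioo_subset_Icc_self hξ'))).symm
  have e4 : ∫ ξ, ψ ξ * (g ξ) i ∂unitVol = ∫ ξ in (0 : ℝ)..1, ψ ξ * deriv Gi ξ := by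
    rw [integral_unit_eq_interval]
    refine intervalIntegral.integral_congr_ae ?_
    filter_upwards [hgi.ae_hasDerivAt_integral] with ξ hξ hξ'
    rw [(hξ (uIoc_subset_uIcc hξ') 0 (by simp)).deriv]
  rw [e1, PiLp.neg_apply, e2, e3, e4, hparts, h0, h1]
  simp

end Primitive

/-! ### The transport operator -/

namespace SingleTrackModel

variable (P : SingleTrackModel) {Q : ℝ → Matrix (Fin 2) (Fin 2) ℝ} {ω₀ : ℝ}

/-- The value `𝒦₄ ζ` for `ζ = ∫₀^· g`. -/
lemma exists_boundaryFunctional : ∃ l : L2 →ₗ[ℝ] E2, ∀ g : L2,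
    l g = kernelInt P.K₄ (volterra g) + mv P.K₅ (primitive g 1) := by
  obtain ⟨k, hk⟩ := exists_kernelOperator P.K₄_cont
  have h1 : (1 : ℝ) ∈ Icc (0 : ℝ) 1 := ⟨zero_le_one, le_rfl⟩
  let p1 : L2 →ₗ[ℝ] E2 :=
    { toFun := fun g => primitive g 1
      map_add' := fun f g => primitive_add f g h1
      map_smul' := fun a g => primitive_smul a g h1 }
  exact ⟨k.toLinearMap ∘ₗ volterra + (mv P.K₅).toLinearMap ∘ₗ p1, fun g => by simp [hk, p1]⟩

lemma transportOp_volterra {g η : L2}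
    (h : ∀ᵐ ξ ∂unitVol, η ξ = -mv P.Lam (g ξ) +
      (kernelInt P.K₄ (volterra g) + mv P.K₅ (primitive g 1))) :
    P.transportOp (volterra g) η :=
  ⟨g, primitive g, hasWeakDeriv_volterra g, isContRep_volterra g, primitive_zero g, h⟩

lemma transportOp_add {ζ η ζ' η' : L2} (h : P.transportOp ζ η) (h' : P.transportOp ζ' η') :
    P.transportOp (ζ + ζ') (η + η') := by
  obtain ⟨k, hk⟩ := exists_kernelOperator P.K₄_cont
  obtain ⟨g, f, hw, ⟨hfc, hfa⟩, hf0, hη⟩ := h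
  obtain ⟨g', f', hw', ⟨hfc', hfa'⟩, hf0', hη'⟩ := h'
  refine ⟨g + g', f + f', ?_, ⟨hfc.add hfc', ?_⟩, by simp [hf0, hf0'], ?_⟩
  · intro ψ hψ hc hs
    have hψ' : Continuous (deriv ψ) :=
      (hψ.of_le (by exact_mod_cast le_top) : ContDiff ℝ 1 ψ).continuous_deriv le_rfl
    have e1 : ∫ ξ, deriv ψ ξ • (ζ + ζ' : L2) ξ ∂unitVol =
        ∫ ξ, (deriv ψ ξ • ζ ξ + deriv ψ ξ • ζ' ξ) ∂unitVol := by
      refine integral_congr_ae ?_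
      filter_upwards [Lp.coeFn_add ζ ζ'] with ξ hξ
      rw [hξ, Pi.add_apply, smul_add]
    have e2 : ∫ ξ, ψ ξ • (g + g' : L2) ξ ∂unitVol = ∫ ξ, (ψ ξ • g ξ + ψ ξ • g' ξ) ∂unitVol := by
      refine integral_congr_ae ?_
      filter_upwards [Lp.coeFn_add g g'] with ξ hξ
      rw [hξ, Pi.add_apply, smul_add]
    rw [e1, e2, integral_add (integrable_smul_coe hψ' _) (integrable_smul_coe hψ' _),
      integral_add (integrable_smul_coe hψ.continuous _) (integrable_smul_coe hψ.continuous _),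
      hw ψ hψ hc hs, hw' ψ hψ hc hs]
    abel
  · filter_upwards [Lp.coeFn_add ζ ζ', hfa, hfa'] with ξ h1 h2 h3
    rw [h1, Pi.add_apply, Pi.add_apply, h2, h3]
  · filter_upwards [Lp.coeFn_add η η', Lp.coeFn_add g g', hη, hη'] with ξ h1 h2 h3 h4
    rw [h1, Pi.add_apply, h2, Pi.add_apply, h3, h4, ← hk, ← hk, ← hk, Pi.add_apply]
    simp only [map_add]
    abel

lemma transportOp_smul (a : ℝ) {ζ η : L2} (h : P.transportOp ζ η) :
    P.transportOp (a • ζ) (a • η) := by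
  obtain ⟨k, hk⟩ := exists_kernelOperator P.K₄_cont
  obtain ⟨g, f, hw, ⟨hfc, hfa⟩, hf0, hη⟩ := h
  refine ⟨a • g, a • f, ?_, ⟨hfc.const_smul a, ?_⟩, by simp [hf0], ?_⟩
  · intro ψ hψ hc hs
    have e1 : ∫ ξ, deriv ψ ξ • (a • ζ : L2) ξ ∂unitVol = ∫ ξ, a • (deriv ψ ξ • ζ ξ) ∂unitVol := by
      refine integral_congr_ae ?_
      filter_upwards [Lp.coeFn_smul a ζ] with ξ hξ
      rw [hξ, Pi.smul_apply, smul_comm]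
    have e2 : ∫ ξ, ψ ξ • (a • g : L2) ξ ∂unitVol = ∫ ξ, a • (ψ ξ • g ξ) ∂unitVol := by
      refine integral_congr_ae ?_
      filter_upwards [Lp.coeFn_smul a g] with ξ hξ
      rw [hξ, Pi.smul_apply, smul_comm]
    rw [e1, e2, integral_smul, integral_smul, hw ψ hψ hc hs, smul_neg]
  · filter_upwards [Lp.coeFn_smul a ζ, hfa] with ξ h1 h2
    rw [h1, Pi.smul_apply, Pi.smul_apply, h2]
  · filter_upwards [Lp.coeFn_smul a η, Lp.coeFn_smul a g, hη] with ξ h1 h2 h3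
    rw [h1, Pi.smul_apply, h2, Pi.smul_apply, h3, ← hk, ← hk, Pi.smul_apply]
    simp only [map_smul]
    module

/-- The graph is single-valued: the weak derivative of 0 vanishes by the fundamental lemma of the
calculus of variations, and the continuous representative vanishes up to the endpoint 1, so 𝒦₄
contributes nothing. -/
lemma transportOp_zero {η : L2} (h : P.transportOp 0 η) : η = 0 := by
  obtain ⟨g, f, hw, ⟨hfc, hfa⟩, hf0, hη⟩ := h
  have hz : ⇑(0 : L2) =ᵐ[unitVol] fun _ => (0 : E2) := Lp.coeFn_zero E2 2 unitVol
  have hg : ∀ᵐ ξ ∂unitVol, ξ ∈ Ioo (0 : ℝ) 1 → g ξ = 0 := by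
    refine isOpen_Ioo.ae_eq_zero_of_integral_contDiff_smul_eq_zero
      ((integrable_coe g).locallyIntegrable.locallyIntegrableOn _) fun ψ hψ hc hs => ?_
    have h1 := hw ψ hψ hc hs
    have h2 : ∫ ξ, deriv ψ ξ • (0 : L2) ξ ∂unitVol = 0 := by
      rw [← integral_zero ℝ E2 (μ := unitVol)]
      refine integral_congr_ae ?_
      filter_upwards [hz] with ξ hξ
      rw [hξ, smul_zero]
    rw [h2] at h1
    exact neg_eq_zero.1 h1.symm
  have hf1 : f 1 = 0 := eqOn_Icc_of_ae_unit (hfa.symm.trans hz) hfc continuousOn_const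
    ⟨zero_le_one, le_rfl⟩
  obtain ⟨k, hk⟩ := exists_kernelOperator P.K₄_cont
  apply Lp.ext
  filter_upwards [hη, hg, hz, ae_restrict_mem measurableSet_Ioo] with ξ h1 h2 h3 h4
  rw [h1, h2 h4, hf1, ← hk, h3]
  simp

/-- `𝒜` is onto. -/
lemma exists_transportOp (hd : P.StrictlyDissipative Q ω₀) (v : L2) :
    ∃ g : L2, P.transportOp (volterra g) v ∧ ∀ᵐ ξ ∂unitVol, v ξ = -mv P.Lam (g ξ) +
      (kernelInt P.K₄ (volterra g) + mv P.K₅ (primitive g 1)) := by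
  obtain ⟨l, hl⟩ := P.exists_boundaryFunctional
  let Li : L2 →L[ℝ] L2 := (mv P.Lam⁻¹).compLpL 2 unitVol
  have hLi : ∀ u : L2, ⇑(Li u) =ᵐ[unitVol] fun ξ => mv P.Lam⁻¹ (u ξ) :=
    fun u => ContinuousLinearMap.coeFn_compLp _ u
  have hop : ∀ (g u : L2) (c : E2), g = Li (Lp.const 2 unitVol c - u) → l g = c →
      ∀ᵐ ξ ∂unitVol, u ξ = -mv P.Lam (g ξ) +
        (kernelInt P.K₄ (volterra g) + mv P.K₅ (primitive g 1)) := by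
    rintro g u c rfl hc
    filter_upwards [hLi (Lp.const 2 unitVol c - u), Lp.coeFn_sub (Lp.const 2 unitVol c : L2) u,
      const_coe c] with ξ h1 h2 h3
    rw [← hl, hc, h1, mv_inv_apply P.Lam_posDef, h2, Pi.sub_apply, h3]
    abel
  -- Writing ζ = ∫₀g and c = 𝒦₄ζ, the equation 𝒜ζ = v reads g = Λ⁻¹(c - v). The unknown reduces to c
  -- in ℝ², subject to c - l(Λ⁻¹c) = -l(Λ⁻¹v).
  let N : E2 →ₗ[ℝ] E2 := LinearMap.id -
    (l ∘ₗ Li.toLinearMap ∘ₗ (Lp.constL 2 unitVol ℝ : E2 →L[ℝ] L2).toLinearMap)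
  have hN : ∀ c, N c = c - l (Li (Lp.const 2 unitVol c)) := fun c => rfl
  -- A kernel vector c yields ζ(ξ) = ξ Λ⁻¹c with 𝒜ζ = 0. Strict dissipativity forces ζ = 0, and
  -- evaluation at ξ = 1 gives c = 0. In finite dimension injectivity is surjectivity.
  have hinj : Function.Injective N := by
    rw [injective_iff_map_eq_zero]
    intro c hc
    rw [hN, sub_eq_zero] at hc
    set g : L2 := Li (Lp.const 2 unitVol c) with hg
    have h1 := P.transportOp_volterra (hop g 0 c (by rw [sub_zero]) hc.symm)
    have h2 := hd.dissip _ _ h1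
    have h3 : ∫ ξ, ⟪(0 : L2) ξ, mv (Q ξ) (volterra g ξ)⟫ ∂unitVol = 0 := by
      rw [← integral_zero ℝ ℝ (μ := unitVol)]
      refine integral_congr_ae ?_
      filter_upwards [Lp.coeFn_zero E2 2 unitVol] with ξ hξ
      rw [hξ]; simp
    rw [h3] at h2
    have h4 : volterra g = 0 := by
      have := hd.rate_pos
      have h5 : ‖volterra g‖ ^ 2 ≤ 0 := by nlinarith
      exact norm_eq_zero.1 (pow_eq_zero_iff two_ne_zero |>.1 (le_antisymm h5 (sq_nonneg _)))
    have h5 := eqOn_Icc_of_ae_unit (f := primitive g) (g := fun _ => 0)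
      ((volterra_coe g).symm.trans (by rw [h4]; exact Lp.coeFn_zero E2 2 unitVol))
      (primitive_continuousOn g) continuousOn_const (x := 1) ⟨zero_le_one, le_rfl⟩
    have h6 : ⇑g =ᵐ[unitVol] fun _ => mv P.Lam⁻¹ c := by
      filter_upwards [hLi (Lp.const 2 unitVol c), const_coe c] with ξ h1 h2
      rw [h1, h2]
    rw [primitive_congr h6 ⟨zero_le_one, le_rfl⟩] at h5
    simp [primitive] at h5
    rw [← mv_inv_apply P.Lam_posDef c, h5, map_zero]
  obtain ⟨c, hc⟩ := LinearMap.injective_iff_surjective.1 hinj (-l (Li v))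
  rw [hN] at hc
  have h := hop (Li (Lp.const 2 unitVol c - v)) v c rfl (by
    rw [map_sub, map_sub]; rw [sub_eq_neg_add]
    exact (sub_eq_iff_eq_add.1 hc).symm)
  exact ⟨_, P.transportOp_volterra h, h⟩

/-- The assumed decay is in terms of ‖ζ‖²; dividing the rate by an upper bound of q(ζ,ζ)/‖ζ‖²
restates it in terms of q. The added 1 keeps the denominator positive. -/
lemma isMDissipative_transportOp (hd : P.StrictlyDissipative Q ω₀)
    {q : L2 →L[ℝ] L2 →L[ℝ] ℝ}
    (hqQ : ∀ (ζ η : L2) (f g : ℝ → E2), ⇑ζ =ᵐ[unitVol] f → ⇑η =ᵐ[unitVol] g →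
      q ζ η = ∫ ξ, ⟪f ξ, mv (Q ξ) (g ξ)⟫ ∂unitVol) :
    IsMDissipative q (ω₀ / (‖q‖ + 1)) P.transportOp where
  add h h' := P.transportOp_add h h'
  smul a _ _ h := P.transportOp_smul a h
  zero_right h := P.transportOp_zero h
  rate_pos := by have := hd.rate_pos; positivity
  dissip {ζ η} h := by
    rw [hqQ η ζ η ζ ae_eq_rfl ae_eq_rfl]
    refine (hd.dissip ζ η h).trans ?_
    have h1 := (abs_le.1 (apply_le_norm q ζ ζ)).2
    have h2 := hd.rate_pos
    have h3 : q ζ ζ ≤ (‖q‖ + 1) * ‖ζ‖ ^ 2 := by nlinarith [sq_nonneg ‖ζ‖]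
    rw [neg_mul, neg_mul, neg_le_neg_iff, div_mul_eq_mul_div, div_le_iff₀ (by positivity)]
    nlinarith
  surj v := by
    obtain ⟨g, hg, -⟩ := P.exists_transportOp hd v
    exact ⟨_, hg⟩

/-- The time-scale separation enters here: q is unchanged while the rate grows like 1/ε. -/
lemma isMDissipative_fastOp {q : L2 →L[ℝ] L2 →L[ℝ] ℝ} {κ ε : ℝ} (hε : 0 < ε)
    (h : IsMDissipative q κ P.transportOp) : IsMDissipative q (κ / ε) (P.fastOp ε) where
  add := by
    rintro x y x' y' ⟨η, hη, rfl⟩ ⟨η', hη', rfl⟩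
    exact ⟨_, h.add hη hη', (smul_add _ _ _).symm⟩
  smul := by
    rintro a x y ⟨η, hη, rfl⟩
    exact ⟨_, h.smul a hη, smul_comm _ _ _⟩
  zero_right := by
    rintro y ⟨η, hη, rfl⟩
    rw [h.zero_right hη, smul_zero]
  rate_pos := div_pos h.rate_pos hε
  dissip := by
    rintro x y ⟨η, hη, rfl⟩
    have := mul_le_mul_of_nonneg_left (h.dissip hη) (inv_pos.2 hε).le
    simp only [map_smul, smul_apply, smul_eq_mul]
    refine this.trans (le_of_eq ?_)
    rw [div_eq_mul_inv]; ring
  surj v := by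
    obtain ⟨x, hx⟩ := h.surj (ε • v)
    exact ⟨x, _, hx, by rw [smul_smul, inv_mul_cancel₀ hε.ne', one_smul]⟩

end SingleTrackModel

/-! ### Quasi-steady profiles -/

namespace SingleTrackModel

variable (P : SingleTrackModel) {Q : ℝ → Matrix (Fin 2) (Fin 2) ℝ} {ω₀ : ℝ}

/-- The weighted inner product represents the weight `Q`. -/
def Represents (q : L2 →L[ℝ] L2 →L[ℝ] ℝ) (Q : ℝ → Matrix (Fin 2) (Fin 2) ℝ) : Prop :=
  ∀ (ζ η : L2) (f g : ℝ → E2), ⇑ζ =ᵐ[unitVol] f → ⇑η =ᵐ[unitVol] g →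
    q ζ η = ∫ ξ, ⟪f ξ, mv (Q ξ) (g ξ)⟫ ∂unitVol

/-- `ζ ↦ 𝒦₃ ζ` as a bounded operator. -/
noncomputable def kernelThree : L2 →L[ℝ] E2 := (exists_kernelOperator P.K₃_cont).choose

lemma kernelThree_apply (ζ : L2) : P.kernelThree ζ = kernelInt P.K₃ ζ :=
  (exists_kernelOperator P.K₃_cont).choose_spec ζ

/-- `ζ ↦ ζ + 𝒦₃ ζ` as a bounded operator. -/
noncomputable def sourceShift : L2 →L[ℝ] L2 :=
  ContinuousLinearMap.id ℝ L2 + (Lp.constL 2 unitVol ℝ : E2 →L[ℝ] L2).comp P.kernelThree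

lemma sourceShift_apply (ζ : L2) :
    P.sourceShift ζ = ζ + Lp.const 2 unitVol (kernelInt P.K₃ ζ) := by
  rw [← kernelThree_apply]; rfl

/-- `ζ ↦ Σ(y) [ζ + 𝒦₃ ζ]` as a bounded operator. -/
noncomputable def sourceOp (y : E2) : L2 →L[ℝ] L2 :=
  ((mv (P.Sig y)).compLpL 2 unitVol).comp P.sourceShift

lemma sourceOp_apply (y : E2) (ζ : L2) :
    P.sourceOp y ζ = (mv (P.Sig y)).compLp (ζ + Lp.const 2 unitVol (kernelInt P.K₃ ζ)) := by
  rw [← sourceShift_apply]; rfl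

lemma sourceOp_coe (y : E2) (ζ : L2) :
    ⇑(P.sourceOp y ζ) =ᵐ[unitVol] fun ξ => mv (P.Sig y) (ζ ξ + kernelInt P.K₃ ζ) := by
  rw [sourceOp_apply]
  filter_upwards [ContinuousLinearMap.coeFn_compLp (mv (P.Sig y))
      (ζ + Lp.const 2 unitVol (kernelInt P.K₃ ζ)),
    Lp.coeFn_add ζ (Lp.const 2 unitVol (kernelInt P.K₃ ζ)),
    const_coe (kernelInt P.K₃ ζ)] with ξ h1 h2 h3
  rw [h1, h2, Pi.add_apply, h3]

lemma pdeSource_eq (X U : E2) (z : L2) :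
    P.pdeSource X U z = P.sourceOp (P.slip X U) z + Lp.const 2 unitVol (P.h₂ (P.slip X U)) := by
  rw [sourceOp_apply]; rfl

lemma sourceOp_dissipative (hd : P.StrictlyDissipative Q ω₀) (hs : P.SourceDissipative Q)
    {q : L2 →L[ℝ] L2 →L[ℝ] ℝ} (hqQ : Represents q Q) (y : E2) (ζ : L2) :
    q (P.sourceOp y ζ) ζ ≤ 0 := by
  rw [hqQ _ _ _ _ (P.sourceOp_coe y ζ) ae_eq_rfl]
  refine le_trans (le_of_eq ?_) (hs.dissip y ζ)
  exact integral_congr_ae (ae_unit fun ξ hξ =>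
    mv_symm (hd.Q_posDef ξ (Ioo_subset_Icc_self hξ)) _ _)

/-- The stationary problem is 𝒜ζ + Σ(y)[ζ + 𝒦₃ζ] = -h₂(y), solvable in L² because Σ(y) is a bounded
dissipative perturbation. Regularity follows by bootstrapping: ζ = ∫₀g is continuous, the equation
then gives g a continuous representative, so ζ is C¹. -/
lemma exists_isSteadyProfile (hd : P.StrictlyDissipative Q ω₀) (hs : P.SourceDissipative Q)
    (y : E2) : ∃ f, P.IsSteadyProfile y f := by
  obtain ⟨q, c, hq, hqQ⟩ := exists_weighted_inner hd.Q_cont hd.Q_diag hd.Q_posDef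
  have hG := P.isMDissipative_transportOp hd hqQ
  obtain ⟨ζ, η, hζη, hη⟩ := hG.exists_perturbed hq (P.sourceOp_dissipative hd hs hqQ y)
    (-Lp.const 2 unitVol (P.h₂ y))
  obtain ⟨g, hg, hgη⟩ := P.exists_transportOp hd η
  have hζ : volterra g = ζ := by
    have h1 := hG.norm_le hq (C := 0) (by simp) (hG.sub hg hζη)
    simpa [sub_eq_zero] using h1
  subst hζ
  set k := kernelInt P.K₃ (volterra g)
  set l := kernelInt P.K₄ (volterra g) + mv P.K₅ (primitive g 1)
  -- Extending the primitive constantly outside [0,1] makes `Gt` continuous on the whole line, so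
  -- that its primitive is C¹ everywhere.
  let Gt : ℝ → E2 := fun ξ => mv P.Lam⁻¹ (mv (P.Sig y)
    (IccExtend zero_le_one ((Icc (0 : ℝ) 1).domRestrict (primitive g)) ξ + k) + l + P.h₂ y)
  have hGt : Continuous Gt := by
    have : Continuous (IccExtend zero_le_one ((Icc (0 : ℝ) 1).domRestrict (primitive g))) :=
      (continuousOn_iff_continuous_domRestrict.1 (primitive_continuousOn g)).Icc_extend'
    fun_prop
  have hGt_mem : ∀ ξ ∈ Icc (0 : ℝ) 1,
      Gt ξ = mv P.Lam⁻¹ (mv (P.Sig y) (primitive g ξ + k) + l + P.h₂ y) := by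
    intro ξ hξ
    simp only [Gt]
    rw [IccExtend_of_mem _ _ hξ]; rfl
  have hgG : ⇑g =ᵐ[unitVol] Gt := by
    have e1 : η = -Lp.const 2 unitVol (P.h₂ y) - P.sourceOp y (volterra g) := by
      rw [← hη]; abel
    filter_upwards [hgη, P.sourceOp_coe y (volterra g), const_coe (P.h₂ y), volterra_coe g,
      Lp.coeFn_sub (-Lp.const 2 unitVol (P.h₂ y)) (P.sourceOp y (volterra g)),
      Lp.coeFn_neg (Lp.const 2 unitVol (P.h₂ y) : L2),
      ae_restrict_mem measurableSet_Ioo] with ξ h1 h2 h3 h4 h5 h6 h7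
    rw [e1, h5, Pi.sub_apply, h6, Pi.neg_apply, h3, h2, h4] at h1
    rw [hGt_mem ξ (Ioo_subset_Icc_self h7), ← mv_inv_apply' P.Lam_posDef (g ξ)]
    congr 1
    have h8 : mv P.Lam (g ξ) = l - (-mv P.Lam (g ξ) + l) := by abel
    rw [h8, ← h1]
    abel
  have hFf : ∀ ξ ∈ Icc (0 : ℝ) 1, primitive Gt ξ = primitive g ξ := fun ξ hξ =>
    (primitive_congr hgG hξ).symm
  have hderiv : ∀ ξ, HasDerivAt (primitive Gt) (Gt ξ) ξ := fun ξ =>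
    (hGt.integral_hasStrictDerivAt 0 ξ).hasDerivAt
  have hae : ⇑(volterra g) =ᵐ[unitVol] primitive Gt :=
    (volterra_coe g).trans (ae_unit fun ξ hξ => (hFf ξ (Ioo_subset_Icc_self hξ)).symm)
  refine ⟨primitive Gt, ?_, primitive_zero _, fun ξ hξ => ?_⟩
  · refine ContDiff.contDiffOn (contDiff_one_iff_deriv.2
      ⟨fun ξ => (hderiv ξ).differentiableAt, ?_⟩)
    rwa [show deriv (primitive Gt) = Gt from funext fun ξ => (hderiv ξ).deriv]
  · have hξ' := Ioo_subset_Icc_self hξ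
    rw [(hderiv ξ).deriv, hGt_mem ξ hξ', mv_inv_apply P.Lam_posDef, hFf ξ hξ',
      hFf 1 ⟨zero_le_one, le_rfl⟩, ← kernelInt_congr hae, ← kernelInt_congr hae]

variable {P} in
lemma IsSteadyProfile.continuousOn {y : E2} {f : ℝ → E2} (h : P.IsSteadyProfile y f) :
    ContinuousOn f (Icc 0 1) := h.1.continuousOn

/-- The derivative of a steady profile, from the stationary equation. -/
noncomputable def profileSlope (y : E2) (f : ℝ → E2) (ξ : ℝ) : E2 :=
  mv P.Lam⁻¹ (mv (P.Sig y) (f ξ + kernelInt P.K₃ f) +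
    (kernelInt P.K₄ f + mv P.K₅ (f 1)) + P.h₂ y)

variable {P} in
lemma IsSteadyProfile.continuousOn_slope {y : E2} {f : ℝ → E2} (h : P.IsSteadyProfile y f) :
    ContinuousOn (P.profileSlope y f) (Icc 0 1) := by
  have hf := h.continuousOn
  unfold profileSlope
  fun_prop

variable {P} in
lemma IsSteadyProfile.primitive_slope {y : E2} {f : ℝ → E2} (h : P.IsSteadyProfile y f)
    {ξ : ℝ} (hξ : ξ ∈ Icc (0 : ℝ) 1) : primitive (P.profileSlope y f) ξ = f ξ := by
  have hsub : Icc 0 ξ ⊆ Icc (0 : ℝ) 1 := Icc_subset_Icc_right hξ.2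
  rw [primitive, intervalIntegral.integral_eq_sub_of_hasDerivAt_of_le hξ.1
    (h.continuousOn.mono hsub) (f' := P.profileSlope y f), h.2.1, sub_zero]
  · intro s hs
    have hs' : s ∈ Ioo (0 : ℝ) 1 := ⟨hs.1, hs.2.trans_le hξ.2⟩
    have hdiff : DifferentiableAt ℝ f s :=
      (h.1.differentiableOn one_ne_zero).differentiableAt (Icc_mem_nhds hs'.1 hs'.2)
    have e : deriv f s = P.profileSlope y f s := by
      rw [← mv_inv_apply' P.Lam_posDef (deriv f s), h.2.2 s hs', profileSlope]
    rw [← e]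
    exact hdiff.hasDerivAt
  · exact (h.continuousOn_slope.mono hsub).intervalIntegrable_of_Icc hξ.1

variable {P} in
/-- The source term is determined by the steady profile. -/
lemma IsSteadyProfile.source_eq {y : E2} {f : ℝ → E2} (h : P.IsSteadyProfile y f) :
    P.h₂ y = mv P.Lam (f 1) - mv (P.Sig y) (kernelInt (fun _ => 1) f + kernelInt P.K₃ f) -
      (kernelInt P.K₄ f + mv P.K₅ (f 1)) := by
  have hint : ∀ {g : ℝ → E2}, ContinuousOn g (Icc 0 1) → Integrable g unitVol := fun hg =>
    (memLp_of_continuousOn hg 1).integrable le_rfl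
  have hvol : volume.real (Ioo (0 : ℝ) 1) = 1 := by simp [Measure.real]
  -- Integrate the stationary equation over (0,1): since f(0) = 0, the derivative term becomes
  -- Λf(1).
  have h1 : mv P.Lam (f 1) = ∫ ξ, mv P.Lam (P.profileSlope y f ξ) ∂unitVol := by
    rw [ContinuousLinearMap.integral_comp_comm _ (hint h.continuousOn_slope),
      integral_unit_eq_interval]
    exact congrArg _ (h.primitive_slope ⟨zero_le_one, le_rfl⟩).symm
  have h2 : kernelInt (fun _ => 1) f = ∫ ξ, f ξ ∂unitVol := by simp only [kernelInt, mv_one]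
  have h3 : ∫ ξ, mv P.Lam (P.profileSlope y f ξ) ∂unitVol =
      mv (P.Sig y) (∫ ξ, f ξ ∂unitVol + kernelInt P.K₃ f) +
        (kernelInt P.K₄ f + mv P.K₅ (f 1)) + P.h₂ y := by
    simp only [profileSlope, mv_inv_apply P.Lam_posDef, add_assoc, map_add]
    have hf := h.continuousOn
    rw [integral_add (hint (by fun_prop)) (integrable_const _),
      ContinuousLinearMap.integral_comp_comm _ (hint hf)]
    simp [hvol]
  rw [h1, h3, h2]
  abel

variable {P} in
/-- Steady profiles belong to the domain of `𝒜`. -/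
lemma IsSteadyProfile.transportOp {y : E2} {f : ℝ → E2} (h : P.IsSteadyProfile y f) :
    P.transportOp (toL2 f) (-(P.sourceOp y (toL2 f) + Lp.const 2 unitVol (P.h₂ y))) := by
  have hf := h.continuousOn
  have hfa := toL2_coe hf
  have hga := toL2_coe h.continuousOn_slope
  set Gt := P.profileSlope y f with hGt
  have hprim : ∀ ξ ∈ Icc (0 : ℝ) 1, primitive (toL2 Gt) ξ = f ξ := by
    intro ξ hξ
    rw [primitive_congr hga hξ, h.primitive_slope hξ]
  have hvol : volterra (toL2 Gt) = toL2 f := by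
    apply Lp.ext
    filter_upwards [volterra_coe (toL2 Gt), hfa, ae_restrict_mem measurableSet_Ioo]
      with ξ h1 h2 h3
    rw [h1, h2, hprim ξ (Ioo_subset_Icc_self h3)]
  rw [← hvol]
  refine P.transportOp_volterra ?_
  rw [hvol, hprim 1 ⟨zero_le_one, le_rfl⟩, kernelInt_congr hfa]
  filter_upwards [Lp.coeFn_neg (P.sourceOp y (toL2 f) + Lp.const 2 unitVol (P.h₂ y)),
    Lp.coeFn_add (P.sourceOp y (toL2 f)) (Lp.const 2 unitVol (P.h₂ y)),
    P.sourceOp_coe y (toL2 f), const_coe (P.h₂ y), hga, hfa] with ξ h1 h2 h3 h4 h5 h6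
  rw [h1, Pi.neg_apply, h2, Pi.add_apply, h3, h4, h5, h6, kernelInt_congr hfa, hGt, profileSlope,
    mv_inv_apply P.Lam_posDef]
  module

lemma isSteadyProfile_profile (hd : P.StrictlyDissipative Q ω₀) (hs : P.SourceDissipative Q)
    (y : E2) : P.IsSteadyProfile y (P.profile y) :=
  Classical.epsilon_spec (P.exists_isSteadyProfile hd hs y)

lemma profile_lipschitz (hsm : P.SmoothSteadyState) : ∃ M : ℝ, 0 ≤ M ∧
    ∀ ξ ∈ Icc (0 : ℝ) 1, ∀ y y' : E2, ‖P.profile y ξ - P.profile y' ξ‖ ≤ M * ‖y - y'‖ := by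
  obtain ⟨M, hM0, hM⟩ := hsm.profile_bound
  refine ⟨M, hM0, fun ξ hξ y y' => ?_⟩
  have hdiff : ContDiff ℝ 1 fun y' => P.profile y' ξ := by
    rw [← contDiffOn_univ]
    exact hsm.profile_C1.comp (f := fun y' : E2 => (ξ, y')) (by fun_prop)
      fun y' _ => ⟨hξ, mem_univ _⟩
  exact Convex.norm_image_sub_le_of_norm_fderiv_le (𝕜 := ℝ)
    (fun y _ => (hdiff.differentiable one_ne_zero).differentiableAt) (fun y _ => hM ξ hξ y)
    convex_univ (mem_univ _) (mem_univ _)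

lemma norm_le_of_ae_unit {ζ : L2} {C : ℝ} (hC : 0 ≤ C) (h : ∀ᵐ ξ ∂unitVol, ‖ζ ξ‖ ≤ C) :
    ‖ζ‖ ≤ C := by
  have := Lp.norm_le_of_ae_bound hC h
  have hm : measureUnivNNReal unitVol = 1 := by simp [measureUnivNNReal]
  simpa [hm] using this

lemma toL2_profile_lipschitz (hd : P.StrictlyDissipative Q ω₀) (hs : P.SourceDissipative Q)
    (hsm : P.SmoothSteadyState) : ∃ M : ℝ, 0 ≤ M ∧
    (∀ y y' : E2, ‖toL2 (P.profile y) - toL2 (P.profile y')‖ ≤ M * ‖y - y'‖) ∧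
    ∀ y y' : E2, ‖P.profile y 1 - P.profile y' 1‖ ≤ M * ‖y - y'‖ := by
  obtain ⟨M, hM0, hM⟩ := P.profile_lipschitz hsm
  refine ⟨M, hM0, fun y y' => norm_le_of_ae_unit (by positivity) ?_,
    fun y y' => hM 1 ⟨zero_le_one, le_rfl⟩ y y'⟩
  filter_upwards [Lp.coeFn_sub (toL2 (P.profile y)) (toL2 (P.profile y')),
    toL2_coe (P.isSteadyProfile_profile hd hs y).continuousOn,
    toL2_coe (P.isSteadyProfile_profile hd hs y').continuousOn,
    ae_restrict_mem measurableSet_Ioo] with ξ h1 h2 h3 h4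
  rw [h1, Pi.sub_apply, h2, h3]
  exact hM ξ (Ioo_subset_Icc_self h4) y y'

end SingleTrackModel

/-! ### Mild solutions for globally Lipschitz nonlinearities -/

section Mild

variable {H : Type*} [NormedAddCommGroup H] [NormedSpace ℝ H]
variable {S : ℝ → H →L[ℝ] H} {K : ℝ} {N : H → H} {L : ℝ}

lemma continuous_uncurry_of_strong (hS : ∀ x, Continuous fun t => S t x) (hK : ∀ t, ‖S t‖ ≤ K) :
    Continuous fun p : ℝ × H => S p.1 p.2 := by
  rw [continuous_iff_continuousAt]
  rintro ⟨t₀, x₀⟩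
  rw [ContinuousAt, tendsto_iff_norm_sub_tendsto_zero]
  have h1 : Tendsto (fun p : ℝ × H => K * ‖p.2 - x₀‖ + ‖S p.1 x₀ - S t₀ x₀‖) (𝓝 (t₀, x₀))
      (𝓝 0) := by
    have hc : Continuous fun p : ℝ × H => K * ‖p.2 - x₀‖ + ‖S p.1 x₀ - S t₀ x₀‖ := by
      have := (hS x₀).comp (continuous_fst (X := ℝ) (Y := H))
      simp only [Function.comp_def] at this
      fun_prop
    simpa using hc.tendsto (t₀, x₀)
  refine squeeze_zero (fun _ => norm_nonneg _) (fun p => ?_) h1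
  have e : S p.1 p.2 - S t₀ x₀ = S p.1 (p.2 - x₀) + (S p.1 x₀ - S t₀ x₀) := by
    rw [map_sub]; abel
  rw [e]
  refine (norm_add_le _ _).trans ?_
  gcongr
  exact ((S p.1).le_opNorm _).trans (by gcongr; exact hK _)

lemma continuous_convolution (hS : ∀ x, Continuous fun t => S t x) (hK : ∀ t, ‖S t‖ ≤ K)
    {f : ℝ → H} (hf : Continuous f) {τ : ℝ → ℝ} (hτ : Continuous τ) :
    Continuous fun t => ∫ s in (0 : ℝ)..τ t, S (τ t - s) (f s) := by
  have h := continuous_uncurry_of_strong hS hK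
  refine intervalIntegral.continuous_parametric_intervalIntegral_of_continuous
    (f := fun t s => S (τ t - s) (f s)) ?_ hτ
  exact h.comp (f := fun p : ℝ × ℝ => (τ p.1 - p.2, f p.2)) (by fun_prop)

lemma exp_neg_mul_integral_exp_le {γ : ℝ} (hγ : 0 < γ) (t : ℝ) :
    Real.exp (-(γ * t)) * ∫ s in (0 : ℝ)..t, Real.exp (γ * s) ≤ 1 / γ := by
  have h1 : ∫ s in (0 : ℝ)..t, Real.exp (γ * s) = (Real.exp (γ * t) - 1) / γ := by
    rw [intervalIntegral.integral_comp_mul_left (fun s => Real.exp s) hγ.ne', integral_exp]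
    simp
    ring
  rw [h1, mul_div_assoc', mul_sub, ← Real.exp_add]
  have := Real.exp_pos (-(γ * t))
  gcongr
  simp
  positivity

/-- Banach's fixed point theorem for the rescaled unknown v(t) = exp(-γt) u(t) among bounded
continuous functions on ℝ. The weight gives a contraction on the whole half-line at once, and
boundedness of `N` makes the map preserve bounded functions. -/
theorem exists_mild [CompleteSpace H] (hS : ∀ x, Continuous fun t => S t x)
    (hK : ∀ t, ‖S t‖ ≤ K) (hL : ∀ x y, ‖N x - N y‖ ≤ L * ‖x - y‖) {b : ℝ}
    (hb : ∀ x, ‖N x‖ ≤ b) (u₀ : H) :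
    ∃ u : ℝ → H, Continuous u ∧ ∀ t, 0 ≤ t →
      u t = S t u₀ + ∫ s in (0 : ℝ)..t, S (t - s) (N (u s)) := by
  have hK0 : 0 ≤ K := (norm_nonneg _).trans (hK 0)
  have hb0 : 0 ≤ b := (norm_nonneg _).trans (hb 0)
  set L' := max L 0 with hL'
  have hL'' : ∀ x y, ‖N x - N y‖ ≤ L' * ‖x - y‖ := fun x y =>
    (hL x y).trans (by gcongr; exact le_max_left _ _)
  have hL0 : 0 ≤ L' := le_max_right _ _
  have hN : Continuous N := (LipschitzWith.of_dist_le_mul (K := L.toNNReal) fun x y => by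
    rw [dist_eq_norm, dist_eq_norm]
    exact (hL x y).trans (by gcongr; exact Real.le_coe_toNNReal L)).continuous
  -- The map has Lipschitz constant K L'/γ, which this choice keeps below 1/2.
  set γ : ℝ := 2 * (K * L') + 1 with hγdef
  have hγ : 0 < γ := by positivity
  have hpos : Continuous fun t : ℝ => max t 0 := by fun_prop
  let I : (ℝ → H) → ℝ → H := fun v t =>
    ∫ s in (0 : ℝ)..max t 0, S (max t 0 - s) (N (Real.exp (γ * s) • v s))
  have hIc : ∀ v : ℝ → H, Continuous v → Continuous (I v) := fun v hv =>
    continuous_convolution hS hK (f := fun s => N (Real.exp (γ * s) • v s))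
      (hN.comp (by fun_prop)) hpos
  let Ψ : (ℝ → H) → ℝ → H := fun v t => Real.exp (-(γ * max t 0)) • (S (max t 0) u₀ + I v t)
  have hΨc : ∀ v : ℝ → H, Continuous v → Continuous (Ψ v) := by
    intro v hv
    have h1 := (hS u₀).comp hpos
    have h2 := hIc v hv
    simp only [Function.comp_def] at h1
    fun_prop
  have hΨb : ∀ (v : ℝ → H) t, ‖Ψ v t‖ ≤ K * ‖u₀‖ + K * b / γ := by
    intro v t
    set τ := max t 0
    have hτ : 0 ≤ τ := le_max_right _ _
    have h1 : ‖I v t‖ ≤ K * b * |τ - 0| := by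
      refine intervalIntegral.norm_integral_le_of_norm_le_const fun s _ => ?_
      refine ((S _).le_opNorm _).trans ?_
      gcongr
      · exact hK _
      · exact hb _
    rw [sub_zero, abs_of_nonneg hτ] at h1
    have h2 : ‖S τ u₀‖ ≤ K * ‖u₀‖ := ((S τ).le_opNorm _).trans (by gcongr; exact hK τ)
    rw [norm_smul, Real.norm_of_nonneg (Real.exp_pos _).le]
    have h3 : Real.exp (-(γ * τ)) ≤ 1 := Real.exp_le_one_iff.2 (by
      have : 0 ≤ γ * τ := by positivity
      linarith)
    have h4 : Real.exp (-(γ * τ)) * (γ * τ) ≤ 1 := by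
      have h5 : γ * τ ≤ Real.exp (γ * τ) := by linarith [Real.add_one_le_exp (γ * τ)]
      calc Real.exp (-(γ * τ)) * (γ * τ) ≤ Real.exp (-(γ * τ)) * Real.exp (γ * τ) := by gcongr
        _ = 1 := by rw [← Real.exp_add]; simp
    calc Real.exp (-(γ * τ)) * ‖S τ u₀ + I v t‖
        ≤ Real.exp (-(γ * τ)) * (K * ‖u₀‖ + K * b * τ) := by
          gcongr; exact (norm_add_le _ _).trans (add_le_add h2 h1)
      _ = Real.exp (-(γ * τ)) * (K * ‖u₀‖) + K * b / γ * (Real.exp (-(γ * τ)) * (γ * τ)) := by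
          field_simp
      _ ≤ 1 * (K * ‖u₀‖) + K * b / γ * 1 := by gcongr
      _ = _ := by ring
  let Φ : BoundedContinuousFunction ℝ H → BoundedContinuousFunction ℝ H := fun v =>
    BoundedContinuousFunction.ofNormedAddCommGroup (Ψ v) (hΨc v v.continuous) _ (hΨb v)
  have hcontr : ContractingWith (1 / 2) Φ := by
    refine ⟨by rw [← NNReal.coe_lt_coe]; norm_num, LipschitzWith.of_dist_le_mul fun v w => ?_⟩
    rw [BoundedContinuousFunction.dist_le (by positivity)]
    intro t
    set τ := max t 0 with hτdef
    have hτ : 0 ≤ τ := le_max_right _ _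
    have hint : ∀ v : BoundedContinuousFunction ℝ H, IntervalIntegrable
        (fun s => S (τ - s) (N (Real.exp (γ * s) • v s))) volume 0 τ := by
      intro v
      refine Continuous.intervalIntegrable ?_ _ _
      have hv := v.continuous
      exact (continuous_uncurry_of_strong hS hK).comp
        (f := fun s => (τ - s, N (Real.exp (γ * s) • v s)))
        ((by fun_prop : Continuous fun s => τ - s).prodMk (hN.comp (by fun_prop)))
    have e1 : Φ v t - Φ w t = Real.exp (-(γ * τ)) • ∫ s in (0 : ℝ)..τ,
        S (τ - s) (N (Real.exp (γ * s) • v s) - N (Real.exp (γ * s) • w s)) := by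
      have : Φ v t - Φ w t = Ψ v t - Ψ w t := rfl
      rw [this]
      simp only [Ψ, I, map_sub]
      rw [intervalIntegral.integral_sub (hint v) (hint w)]
      module
    have h1 : ‖∫ s in (0 : ℝ)..τ,
        S (τ - s) (N (Real.exp (γ * s) • v s) - N (Real.exp (γ * s) • w s))‖ ≤
        ∫ s in (0 : ℝ)..τ, K * L' * dist v w * Real.exp (γ * s) := by
      refine intervalIntegral.norm_integral_le_of_norm_le hτ (ae_of_all _ fun s _ => ?_)
        (Continuous.intervalIntegrable (by fun_prop) _ _)
      refine ((S _).le_opNorm _).trans ?_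
      have h2 := hL'' (Real.exp (γ * s) • v s) (Real.exp (γ * s) • w s)
      rw [← smul_sub, norm_smul, Real.norm_of_nonneg (Real.exp_pos _).le,
        ← dist_eq_norm (v s)] at h2
      calc _ ≤ K * (L' * (Real.exp (γ * s) * dist v w)) := by
            gcongr
            · exact hK _
            · refine h2.trans ?_
              gcongr
              exact BoundedContinuousFunction.dist_coe_le_dist s
        _ = _ := by ring
    rw [intervalIntegral.integral_const_mul] at h1
    rw [dist_eq_norm, e1, norm_smul, Real.norm_of_nonneg (Real.exp_pos _).le]
    have h3 := exp_neg_mul_integral_exp_le hγ τ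
    calc _ ≤ Real.exp (-(γ * τ)) * (K * L' * dist v w * ∫ s in (0 : ℝ)..τ, Real.exp (γ * s)) := by
          gcongr
      _ = K * L' * dist v w * (Real.exp (-(γ * τ)) * ∫ s in (0 : ℝ)..τ, Real.exp (γ * s)) := by ring
      _ ≤ K * L' * dist v w * (1 / γ) := by gcongr
      _ = (K * L' / γ) * dist v w := by ring
      _ ≤ 1 / 2 * dist v w := by
          have h6 : K * L' / γ ≤ 1 / 2 := by
            rw [div_le_iff₀ hγ]; linarith
          exact mul_le_mul_of_nonneg_right h6 dist_nonneg
      _ = _ := by simp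
  have hfix : Φ (hcontr.fixedPoint _) = hcontr.fixedPoint _ := hcontr.fixedPoint_isFixedPt
  set v := hcontr.fixedPoint _
  refine ⟨fun t => Real.exp (γ * t) • v t, ?_, fun t ht => ?_⟩
  · have := v.continuous
    fun_prop
  · have h1 : v t = Ψ v t := by
      conv_lhs => rw [← hfix]
      rfl
    change Real.exp (γ * t) • v t = _
    rw [h1]
    simp only [Ψ, I, max_eq_left ht]
    rw [smul_smul, ← Real.exp_add]
    simp

/-- The distance d of two solutions satisfies d ≤ K L' ∫₀d. Gronwall's inequality is applied to the
primitive of d, which is differentiable and vanishes at 0. -/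
theorem mild_unique (hS : ∀ x, Continuous fun t => S t x)
    (hK : ∀ t, ‖S t‖ ≤ K) (hL : ∀ x y, ‖N x - N y‖ ≤ L * ‖x - y‖) {u₀ : H} {u v : ℝ → H}
    (hu : ContinuousOn u (Ici 0)) (hv : ContinuousOn v (Ici 0))
    (hue : ∀ t, 0 ≤ t → u t = S t u₀ + ∫ s in (0 : ℝ)..t, S (t - s) (N (u s)))
    (hve : ∀ t, 0 ≤ t → v t = S t u₀ + ∫ s in (0 : ℝ)..t, S (t - s) (N (v s))) :
    EqOn u v (Ici 0) := by
  have hK0 : 0 ≤ K := (norm_nonneg _).trans (hK 0)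
  have hN : Continuous N := (LipschitzWith.of_dist_le_mul (K := L.toNNReal) fun x y => by
    rw [dist_eq_norm, dist_eq_norm]
    exact (hL x y).trans (by gcongr; exact Real.le_coe_toNNReal L)).continuous
  set L' := max L 0 with hL'
  have hL'' : ∀ x y, ‖N x - N y‖ ≤ L' * ‖x - y‖ := fun x y =>
    (hL x y).trans (by gcongr; exact le_max_left _ _)
  have hext : ∀ w : ℝ → H, ContinuousOn w (Ici 0) → Continuous fun t => w (max t 0) := fun w hw =>
    hw.comp_continuous (by fun_prop) fun t => mem_Ici.2 (le_max_right _ _)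
  have hint : ∀ w : ℝ → H, ContinuousOn w (Ici 0) → ∀ t, 0 ≤ t →
      IntervalIntegrable (fun s => S (t - s) (N (w s))) volume 0 t := by
    intro w hw t ht
    refine ContinuousOn.intervalIntegrable ?_
    rw [uIcc_of_le ht]
    have h1 : ContinuousOn w (Icc 0 t) := hw.mono Icc_subset_Ici_self
    exact (continuous_uncurry_of_strong hS hK).comp_continuousOn
      (f := fun s => (t - s, N (w s)))
      ((by fun_prop : Continuous fun s => t - s).continuousOn.prodMk (hN.comp_continuousOn h1))
  set d : ℝ → ℝ := fun t => ‖u (max t 0) - v (max t 0)‖ with hd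
  have hdc : Continuous d := ((hext u hu).sub (hext v hv)).norm
  have hdle : ∀ t, 0 ≤ t → d t ≤ K * L' * ∫ s in (0 : ℝ)..t, d s := by
    intro t ht
    have e1 : u t - v t = ∫ s in (0 : ℝ)..t, S (t - s) (N (u s) - N (v s)) := by
      rw [hue t ht, hve t ht, add_sub_add_left_eq_sub,
        ← intervalIntegral.integral_sub (hint u hu t ht) (hint v hv t ht)]
      simp only [map_sub]
    have e2 : d t = ‖u t - v t‖ := by simp only [hd, max_eq_left ht]
    rw [e2, e1, ← intervalIntegral.integral_const_mul]
    refine intervalIntegral.norm_integral_le_of_norm_le ht (ae_of_all _ fun s hs => ?_)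
      (Continuous.intervalIntegrable (by fun_prop) _ _)
    refine ((S _).le_opNorm _).trans ?_
    simp only [hd, max_eq_left hs.1.le]
    rw [mul_assoc]
    gcongr
    · exact hK _
    · exact hL'' _ _
  have hF : ∀ t, 0 ≤ t → ∫ s in (0 : ℝ)..t, d s = 0 := by
    intro t ht
    have hnn : ∀ t, 0 ≤ t → 0 ≤ ∫ s in (0 : ℝ)..t, d s := fun t ht =>
      intervalIntegral.integral_nonneg ht fun s _ => norm_nonneg _
    have hder : ∀ t, HasDerivAt (fun t => ∫ s in (0 : ℝ)..t, d s) (d t) t := fun t =>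
      (hdc.integral_hasStrictDerivAt 0 t).hasDerivAt
    have h1 := norm_le_gronwallBound_of_norm_deriv_right_le (a := 0) (b := t) (δ := 0)
      (K := K * L') (ε := 0) (f := fun t => ∫ s in (0 : ℝ)..t, d s) (f' := d)
      (fun s _ => (hder s).continuousAt.continuousWithinAt)
      (fun s _ => (hder s).hasDerivWithinAt) (by simp)
      (fun s hs => by
        rw [Real.norm_of_nonneg (norm_nonneg _), Real.norm_of_nonneg (hnn s hs.1), add_zero]
        exact hdle s hs.1) t ⟨ht, le_rfl⟩
    rw [sub_zero, gronwallBound_ε0_δ0] at h1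
    exact norm_le_zero_iff.1 h1
  intro t ht
  have h1 := hdle t ht
  rw [hF t ht, mul_zero] at h1
  simp only [hd, max_eq_left (mem_Ici.1 ht)] at h1
  exact sub_eq_zero.1 (norm_le_zero_iff.1 h1)

end Mild

/-! ### Truncation -/

section Truncation

variable {H : Type*} [NormedAddCommGroup H] [NormedSpace ℝ H]

/-- Radial retraction onto the ball of radius `R`. -/
noncomputable def radial (R : ℝ) (x : H) : H := (R / max R ‖x‖) • x

variable {R : ℝ}

lemma radial_of_norm_le (hR : 0 < R) {x : H} (h : ‖x‖ ≤ R) : radial R x = x := by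
  rw [radial, max_eq_left h, div_self hR.ne', one_smul]

lemma norm_radial_le (hR : 0 < R) (x : H) : ‖radial R x‖ ≤ R := by
  have h1 : 0 < max R ‖x‖ := lt_max_of_lt_left hR
  rw [radial, norm_smul, Real.norm_of_nonneg (by positivity), div_mul_eq_mul_div, div_le_iff₀ h1]
  gcongr
  exact le_max_right _ _

/-- The constant 2 is valid in every normed space. The product space `State` carries the maximum
norm, so no Hilbert space projection argument is available there. -/
lemma norm_radial_sub_le (hR : 0 < R) (x y : H) : ‖radial R x - radial R y‖ ≤ 2 * ‖x - y‖ := by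
  have hx : 0 < max R ‖x‖ := lt_max_of_lt_left hR
  have hy : 0 < max R ‖y‖ := lt_max_of_lt_left hR
  have e : radial R x - radial R y =
      (R / max R ‖x‖) • (x - y) + (R / max R ‖x‖ - R / max R ‖y‖) • y := by
    simp only [radial]; module
  have h1 : R / max R ‖x‖ ≤ 1 := (div_le_one hx).2 (le_max_left _ _)
  have h2 : |max R ‖y‖ - max R ‖x‖| ≤ ‖x - y‖ := by
    refine (abs_max_sub_max_le_max _ _ _ _).trans ?_
    rw [sub_self, abs_zero, max_eq_right (abs_nonneg _), abs_sub_comm]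
    exact abs_norm_sub_norm_le x y
  have h3 : R / max R ‖x‖ - R / max R ‖y‖ =
      (R / max R ‖x‖) * ((max R ‖y‖ - max R ‖x‖) / max R ‖y‖) := by field_simp
  have h4 : ‖(R / max R ‖x‖ - R / max R ‖y‖) • y‖ ≤ ‖x - y‖ := by
    rw [h3, norm_smul, norm_mul, Real.norm_of_nonneg (by positivity), Real.norm_eq_abs, abs_div,
      abs_of_pos hy]
    calc R / max R ‖x‖ * (|max R ‖y‖ - max R ‖x‖| / max R ‖y‖) * ‖y‖
        ≤ 1 * (‖x - y‖ / max R ‖y‖) * ‖y‖ := by gcongr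
      _ = ‖x - y‖ * (‖y‖ / max R ‖y‖) := by ring
      _ ≤ ‖x - y‖ * 1 := by
          gcongr
          exact (div_le_one hy).2 (le_max_right _ _)
      _ = _ := mul_one _
  rw [e]
  refine (norm_add_le _ _).trans ?_
  have h5 : ‖(R / max R ‖x‖) • (x - y)‖ ≤ ‖x - y‖ := by
    rw [norm_smul, Real.norm_of_nonneg (by positivity)]
    exact mul_le_of_le_one_left (norm_nonneg _) h1
  linarith

end Truncation

/-! ### Quadratic Lyapunov functions for Hurwitz matrices -/

section Lyapunov

section BanachAlgebra

attribute [local instance] Matrix.linftyOpNormedRing Matrix.linftyOpNormedAlgebra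

/-- By compactness of the spectrum the spectral radius is below 1, and Gelfand's formula gives ‖aⁿ‖
≤ rⁿ eventually, for some r < 1. -/
lemma tendsto_norm_pow_of_spectrum {A : Type*} [NormedRing A] [NormedAlgebra ℂ A] [CompleteSpace A]
    [Nontrivial A] (a : A) (h : ∀ μ ∈ spectrum ℂ a, ‖μ‖ < 1) :
    Tendsto (fun n : ℕ => a ^ n) atTop (𝓝 0) := by
  have h1 : spectralRadius ℂ a < 1 := by
    have := spectrum.spectralRadius_lt_of_forall_lt a (r := 1) fun k hk => by
      rw [← NNReal.coe_lt_coe]; simpa using h k hk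
    simpa using this
  obtain ⟨r, hr1, hr2⟩ := ENNReal.lt_iff_exists_nnreal_btwn.1 h1
  have hr2' : r < 1 := by exact_mod_cast hr2
  have h2 := (spectrum.pow_nnnorm_pow_one_div_tendsto_nhds_spectralRadius a).eventually
    (gt_mem_nhds hr1)
  rw [tendsto_zero_iff_norm_tendsto_zero]
  have h3 : Tendsto (fun n : ℕ => (r : ℝ) ^ n) atTop (𝓝 0) :=
    tendsto_pow_atTop_nhds_zero_of_lt_one r.2 (by exact_mod_cast hr2')
  refine squeeze_zero' (Eventually.of_forall fun _ => norm_nonneg _) ?_ h3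
  filter_upwards [h2, eventually_gt_atTop 0] with n hn hn0
  have hn' : (0 : ℝ) < n := by exact_mod_cast hn0
  have h4 : ((‖a ^ n‖₊ : ENNReal) ^ (1 / (n : ℝ))) ^ (n : ℝ) ≤ (r : ENNReal) ^ (n : ℝ) := by
    gcongr
  rw [← ENNReal.rpow_mul, one_div_mul_cancel hn'.ne', ENNReal.rpow_one, ENNReal.rpow_natCast] at h4
  have h5 : ‖a ^ n‖₊ ≤ r ^ n := by exact_mod_cast h4
  exact_mod_cast h5

/-- If Re l ≤ -δ and |l| ≤ b, then |1 + sl|² ≤ 1 - 2sδ + s²b². With s = δ/(b²+1) one has s²b² < sδ,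
so the value is below 1. -/
lemma exists_euler_step {A : Type*} [NormedRing A] [NormedAlgebra ℂ A] [CompleteSpace A]
    [Nontrivial A] (a : A) (h : ∀ μ ∈ spectrum ℂ a, μ.re < 0) :
    ∃ s : ℝ, 0 < s ∧ ∀ μ ∈ spectrum ℂ (1 + (s : ℂ) • a), ‖μ‖ < 1 := by
  obtain ⟨μ₀, hμ₀, hmax⟩ := (spectrum.isCompact (𝕜 := ℂ) a).exists_isMaxOn
    (spectrum.nonempty a) Complex.continuous_re.continuousOn
  have hδ := h μ₀ hμ₀
  set δ := -μ₀.re with hδdef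
  have hδ0 : 0 < δ := by linarith
  obtain ⟨b, hb⟩ := (spectrum.isCompact (𝕜 := ℂ) a).isBounded.exists_norm_le
  refine ⟨δ / (b ^ 2 + 1), by positivity, fun μ hμ => ?_⟩
  set s := δ / (b ^ 2 + 1) with hs
  have hs0 : 0 < s := by positivity
  have hsne : (s : ℂ) ≠ 0 := by exact_mod_cast hs0.ne'
  have hl : (s : ℂ)⁻¹ * (μ - 1) ∈ spectrum ℂ a := by
    have h1 : μ = (s : ℂ) * ((s : ℂ)⁻¹ * (μ - 1)) + 1 := by field_simp; ring
    rw [h1] at hμ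
    have e1 : (1 : A) + (s : ℂ) • a = algebraMap ℂ A 1 + (s : ℂ) • a := by rw [map_one]
    rw [e1, spectrum.add_mem_add_iff] at hμ
    have h2 := (spectrum.smul_mem_smul_iff (a := a) (s := (s : ℂ)⁻¹ * (μ - 1))
      (r := Units.mk0 (s : ℂ) hsne)).1
    exact h2 hμ
  set l := (s : ℂ)⁻¹ * (μ - 1) with hldef
  have hμl : μ = 1 + (s : ℂ) * l := by rw [hldef]; field_simp; ring
  have hre : l.re ≤ -δ := by have := hmax hl; simp at this; linarith
  have hnl := hb l hl
  have hsq : ‖μ‖ ^ 2 < 1 := by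
    rw [← Complex.normSq_eq_norm_sq, hμl, Complex.normSq_apply]
    simp only [Complex.add_re, Complex.one_re, Complex.mul_re, Complex.ofReal_re, Complex.ofReal_im,
      Complex.add_im, Complex.one_im, Complex.mul_im, zero_mul, sub_zero, add_zero, zero_add]
    have h3 : l.re * l.re + l.im * l.im ≤ b ^ 2 := by
      rw [← Complex.normSq_apply, Complex.normSq_eq_norm_sq]
      have := norm_nonneg l
      nlinarith
    have h4 : s * (b ^ 2 + 1) = δ := by rw [hs]; field_simp
    have h5 : s ^ 2 * (l.re * l.re + l.im * l.im) ≤ s ^ 2 * b ^ 2 := by gcongr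
    have h6 : s * l.re ≤ s * -δ := by gcongr
    have h7 : s ^ 2 * b ^ 2 = s * δ - s ^ 2 := by rw [← h4]; ring
    nlinarith [mul_pos hs0 hδ0]
  nlinarith [norm_nonneg μ]

/-- The limit is stated entrywise, so that it does not refer to the matrix norm used locally. -/
lemma IsHurwitz.exists_pow_tendsto {n : Type*} [Fintype n] [DecidableEq n] [Nonempty n]
    {M : Matrix n n ℝ} (hM : IsHurwitz M) :
    ∃ s : ℝ, 0 < s ∧ ∀ i j, Tendsto (fun k : ℕ => ((1 + s • M) ^ k) i j) atTop (𝓝 0) := by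
  obtain ⟨s, hs, h⟩ := exists_euler_step (M.map (fun x : ℝ => (x : ℂ))) hM
  have h1 := tendsto_norm_pow_of_spectrum _ h
  refine ⟨s, hs, fun i j => ?_⟩
  have h2 : ∀ N : Matrix n n ℂ, ‖N i j‖ ≤ ‖N‖ := by
    intro N
    have h3 : ‖N i j‖₊ ≤ ‖N‖₊ := by
      rw [Matrix.linfty_opNNNorm_def]
      exact (Finset.single_le_sum (f := fun j => ‖N i j‖₊) (fun _ _ => zero_le)
        (Finset.mem_univ j)).trans
        (Finset.le_sup (f := fun i => ∑ j, ‖N i j‖₊) (Finset.mem_univ i))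
    exact h3
  have e : ∀ k : ℕ, ((1 + (s : ℂ) • M.map (fun x : ℝ => (x : ℂ))) ^ k) =
      ((1 + s • M) ^ k).map (Complex.ofRealHom) := by
    intro k
    rw [← RingHom.mapMatrix_apply, map_pow, map_add, map_one]
    congr 2
    ext i j
    simp
  refine squeeze_zero_norm (fun k => ?_) (tendsto_zero_iff_norm_tendsto_zero.1 h1)
  refine le_trans (le_of_eq ?_) (h2 _)
  rw [e]
  simp

end BanachAlgebra

/-- A discrete substitute for integrating the flow: p(x,y) = Σ_{k<N} ⟨Bᵏx, Bᵏy⟩ with B = 1 + sM and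
‖Bᴺ‖ < 1/2. Telescoping gives p(Bx,Bx) - p(x,x) = ‖Bᴺx‖² - ‖x‖² ≤ -(3/4)‖x‖². The left side is 2s
p(Mx,x) + s² p(Mx,Mx); dropping the last term yields the rate 3/(8s). -/
theorem IsHurwitz.exists_lyapunov {n : Type*} [Fintype n] [DecidableEq n] [Nonempty n]
    {M : Matrix n n ℝ} (hM : IsHurwitz M) :
    ∃ (p : EuclideanSpace ℝ n →L[ℝ] EuclideanSpace ℝ n →L[ℝ] ℝ) (a : ℝ), IsEquivInner p 1 ∧
      0 < a ∧ ∀ x, p (Matrix.toEuclideanCLM (𝕜 := ℝ) M x) x ≤ -a * ‖x‖ ^ 2 := by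
  obtain ⟨s, hs, hlim⟩ := hM.exists_pow_tendsto
  set E := EuclideanSpace ℝ n
  let T : E →L[ℝ] E := Matrix.toEuclideanCLM (𝕜 := ℝ) M
  let B : E →L[ℝ] E := 1 + s • T
  have hB : B = Matrix.toEuclideanCLM (𝕜 := ℝ) (1 + s • M) := by
    simp [B, T, map_add, map_smul]
  have hpow : Tendsto (fun k : ℕ => B ^ k) atTop (𝓝 0) := by
    have h1 : Tendsto (fun k : ℕ => (1 + s • M) ^ k) atTop (𝓝 0) := by
      exact tendsto_pi_nhds.2 fun i => tendsto_pi_nhds.2 fun j => hlim i j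
    have h2 : Continuous fun N : Matrix n n ℝ => (Matrix.toEuclideanCLM (𝕜 := ℝ) N : E →L[ℝ] E) :=
      ({ toFun := fun N => Matrix.toEuclideanCLM (𝕜 := ℝ) N
         map_add' := map_add _
         map_smul' := map_smul _ } :
        Matrix n n ℝ →ₗ[ℝ] E →L[ℝ] E).continuous_of_finiteDimensional
    have h3 := (h2.tendsto 0).comp h1
    simp only [map_zero] at h3
    refine h3.congr fun k => ?_
    simp only [Function.comp_apply]
    rw [map_pow, hB]
  obtain ⟨N, hN⟩ := ((tendsto_zero_iff_norm_tendsto_zero.1 hpow).eventually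
    (gt_mem_nhds (show (0 : ℝ) < 1 / 2 by norm_num))).and (eventually_gt_atTop 0) |>.exists
  obtain ⟨hN, hN0⟩ := hN
  let p : E →L[ℝ] E →L[ℝ] ℝ := ∑ k ∈ Finset.range N,
    (innerSL ℝ : E →L[ℝ] E →L[ℝ] ℝ).bilinearComp (B ^ k) (B ^ k)
  have hp : ∀ x y, p x y = ∑ k ∈ Finset.range N, ⟪(B ^ k) x, (B ^ k) y⟫ := by
    intro x y
    simp only [p, sum_apply]
    rfl
  have hsymm : ∀ x y, p x y = p y x := fun x y => by
    rw [hp, hp]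
    exact Finset.sum_congr rfl fun k _ => real_inner_comm _ _
  have hnn : ∀ x, 0 ≤ p x x := fun x => by
    rw [hp]
    exact Finset.sum_nonneg fun k _ => real_inner_self_nonneg
  refine ⟨p, 3 / (8 * s), ⟨hsymm, one_pos, fun x => ?_⟩, by positivity, fun x => ?_⟩
  · rw [hp, one_mul, ← real_inner_self_eq_norm_sq]
    have := Finset.single_le_sum (f := fun k => ⟪(B ^ k) x, (B ^ k) x⟫)
      (fun k _ => real_inner_self_nonneg) (Finset.mem_range.2 hN0)
    simpa using this
  · have h1 : p (B x) (B x) - p x x = ‖(B ^ N) x‖ ^ 2 - ‖x‖ ^ 2 := by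
      rw [hp, hp, ← Finset.sum_sub_distrib]
      have e : ∀ k, ⟪(B ^ k) (B x), (B ^ k) (B x)⟫ - ⟪(B ^ k) x, (B ^ k) x⟫ =
          ‖(B ^ (k + 1)) x‖ ^ 2 - ‖(B ^ k) x‖ ^ 2 := by
        intro k
        rw [real_inner_self_eq_norm_sq, real_inner_self_eq_norm_sq, pow_succ]
        rfl
      simp_rw [e]
      rw [Finset.sum_range_sub (fun k => ‖(B ^ k) x‖ ^ 2)]
      simp
    have h2 : p (B x) (B x) = p x x + 2 * s * p (T x) x + s ^ 2 * p (T x) (T x) := by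
      have e : B x = x + s • T x := by simp [B]
      rw [e]
      simp only [map_add, map_smul, add_apply, smul_apply, smul_eq_mul]
      rw [hsymm x (T x)]
      ring
    have h3 : ‖(B ^ N) x‖ ≤ 1 / 2 * ‖x‖ := ((B ^ N).le_opNorm x).trans (by gcongr)
    have h4 : ‖(B ^ N) x‖ ^ 2 ≤ 1 / 4 * ‖x‖ ^ 2 := by
      have := norm_nonneg ((B ^ N) x)
      nlinarith
    have h5 := mul_nonneg (sq_nonneg s) (hnn (T x))
    have h6 : 2 * s * p (T x) x ≤ -(3 / 4) * ‖x‖ ^ 2 := by linarith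
    have h7 : p (T x) x ≤ (-(3 / 4) * ‖x‖ ^ 2) / (2 * s) := by
      rw [le_div_iff₀ (by positivity)]; linarith
    refine h7.trans (le_of_eq ?_)
    field_simp
    ring

end Lyapunov

/-! ### Maps that are Lipschitz on bounded sets -/

section LipschitzOnBounded

set_option linter.unusedSectionVars false

variable {E F G K : Type*} [NormedAddCommGroup E] [NormedSpace ℝ E] [NormedAddCommGroup F]
  [NormedSpace ℝ F] [NormedAddCommGroup G] [NormedSpace ℝ G] [NormedAddCommGroup K]
  [NormedSpace ℝ K]

/-- `f` is Lipschitz on every ball around the origin. -/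
def LipschitzOnBounded (f : E → F) : Prop :=
  ∀ R : ℝ, ∃ L : ℝ, 0 ≤ L ∧ ∀ x y, ‖x‖ ≤ R → ‖y‖ ≤ R → ‖f x - f y‖ ≤ L * ‖x - y‖

namespace LipschitzOnBounded

lemma of_lipschitz {f : E → F} {L : ℝ} (hL : 0 ≤ L) (h : ∀ x y, ‖f x - f y‖ ≤ L * ‖x - y‖) :
    LipschitzOnBounded f := fun _ => ⟨L, hL, fun x y _ _ => h x y⟩

lemma clm (T : E →L[ℝ] F) : LipschitzOnBounded T :=
  of_lipschitz (norm_nonneg T) fun x y => by rw [← map_sub]; exact T.le_opNorm _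

lemma const (b : F) : LipschitzOnBounded fun _ : E => b :=
  of_lipschitz le_rfl fun x y => by simp

lemma add {f g : E → F} (hf : LipschitzOnBounded f) (hg : LipschitzOnBounded g) :
    LipschitzOnBounded fun x => f x + g x := by
  intro R
  obtain ⟨L, hL, h⟩ := hf R
  obtain ⟨L', hL', h'⟩ := hg R
  refine ⟨L + L', by positivity, fun x y hx hy => ?_⟩
  rw [add_sub_add_comm, add_mul]
  exact (norm_add_le _ _).trans (add_le_add (h x y hx hy) (h' x y hx hy))

lemma neg {f : E → F} (hf : LipschitzOnBounded f) : LipschitzOnBounded fun x => -f x := by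
  intro R
  obtain ⟨L, hL, h⟩ := hf R
  refine ⟨L, hL, fun x y hx hy => ?_⟩
  rw [← neg_sub', norm_neg]
  exact h x y hx hy

lemma sub {f g : E → F} (hf : LipschitzOnBounded f) (hg : LipschitzOnBounded g) :
    LipschitzOnBounded fun x => f x - g x := by
  simpa only [sub_eq_add_neg] using hf.add hg.neg

lemma exists_bound {f : E → F} (hf : LipschitzOnBounded f) (R : ℝ) :
    ∃ b : ℝ, 0 ≤ b ∧ ∀ x, ‖x‖ ≤ R → ‖f x‖ ≤ b := by
  obtain ⟨L, hL, h⟩ := hf |R|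
  refine ⟨L * |R| + ‖f 0‖, by positivity, fun x hx => ?_⟩
  have h1 := h x 0 (hx.trans (le_abs_self R)) (by simp)
  rw [sub_zero] at h1
  have h2 := norm_add_le (f x - f 0) (f 0)
  rw [sub_add_cancel] at h2
  have h3 : L * ‖x‖ ≤ L * |R| := by gcongr; exact hx.trans (le_abs_self R)
  linarith

lemma comp {g : F → G} {f : E → F} (hg : LipschitzOnBounded g) (hf : LipschitzOnBounded f) :
    LipschitzOnBounded fun x => g (f x) := by
  intro R
  obtain ⟨b, -, hb⟩ := hf.exists_bound R
  obtain ⟨L, hL, h⟩ := hf R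
  obtain ⟨L', hL', h'⟩ := hg b
  refine ⟨L' * L, by positivity, fun x y hx hy => ?_⟩
  refine (h' _ _ (hb x hx) (hb y hy)).trans ?_
  rw [mul_assoc]
  gcongr
  exact h x y hx hy

lemma bilin (B : F →L[ℝ] G →L[ℝ] K) {f : E → F} {g : E → G} (hf : LipschitzOnBounded f)
    (hg : LipschitzOnBounded g) : LipschitzOnBounded fun x => B (f x) (g x) := by
  intro R
  obtain ⟨b, hb0, hb⟩ := hf.exists_bound R
  obtain ⟨b', hb0', hb'⟩ := hg.exists_bound R
  obtain ⟨L, hL, h⟩ := hf R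
  obtain ⟨L', hL', h'⟩ := hg R
  refine ⟨‖B‖ * b * L' + ‖B‖ * L * b', by positivity, fun x y hx hy => ?_⟩
  have e : B (f x) (g x) - B (f y) (g y) = B (f x) (g x - g y) + B (f x - f y) (g y) := by
    simp only [map_sub, sub_apply]; abel
  rw [e]
  refine (norm_add_le _ _).trans ?_
  calc ‖B (f x) (g x - g y)‖ + ‖B (f x - f y) (g y)‖
      ≤ ‖B‖ * ‖f x‖ * ‖g x - g y‖ + ‖B‖ * ‖f x - f y‖ * ‖g y‖ :=
        add_le_add (B.le_opNorm₂ _ _) (B.le_opNorm₂ _ _)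
    _ ≤ ‖B‖ * b * (L' * ‖x - y‖) + ‖B‖ * (L * ‖x - y‖) * b' := by
        gcongr
        · exact hb x hx
        · exact h' x y hx hy
        · exact h x y hx hy
        · exact hb' y hy
    _ = _ := by ring

lemma prodMk {f : E → F} {g : E → G} (hf : LipschitzOnBounded f) (hg : LipschitzOnBounded g) :
    LipschitzOnBounded fun x => (f x, g x) := by
  intro R
  obtain ⟨L, hL, h⟩ := hf R
  obtain ⟨L', hL', h'⟩ := hg R
  refine ⟨max L L', le_max_of_le_left hL, fun x y hx hy => ?_⟩
  rw [Prod.mk_sub_mk, Prod.norm_mk]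
  refine max_le ((h x y hx hy).trans ?_) ((h' x y hx hy).trans ?_)
  · gcongr; exact le_max_left _ _
  · gcongr; exact le_max_right _ _

lemma of_contDiff [FiniteDimensional ℝ E] {f : E → F} (hf : ContDiff ℝ 1 f) :
    LipschitzOnBounded f := by
  intro R
  have : ProperSpace E := FiniteDimensional.proper ℝ E
  obtain ⟨L, hL⟩ := (hf.locallyLipschitz.locallyLipschitzOn
    (s := Metric.closedBall (0 : E) R)).exists_lipschitzOnWith_of_compact
    (isCompact_closedBall 0 R)
  refine ⟨L, L.2, fun x y hx hy => ?_⟩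
  rw [← dist_eq_norm, ← dist_eq_norm]
  exact hL.dist_le_mul x (by simpa using hx) y (by simpa using hy)

/-- Composition with the radial retraction is bounded and globally Lipschitz. -/
lemma comp_radial {f : E → F} (hf : LipschitzOnBounded f) {R : ℝ} (hR : 0 < R) :
    (∃ L : ℝ, ∀ x y, ‖f (radial R x) - f (radial R y)‖ ≤ L * ‖x - y‖) ∧
      ∃ b : ℝ, ∀ x, ‖f (radial R x)‖ ≤ b := by
  obtain ⟨L, hL, h⟩ := hf R
  obtain ⟨b, -, hb⟩ := hf.exists_bound R
  refine ⟨⟨L * 2, fun x y => ?_⟩, b, fun x => hb _ (norm_radial_le hR x)⟩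
  refine (h _ _ (norm_radial_le hR x) (norm_radial_le hR y)).trans ?_
  rw [mul_assoc]
  gcongr
  exact norm_radial_sub_le hR x y

lemma continuous {f : E → F} (hf : LipschitzOnBounded f) : Continuous f := by
  rw [continuous_iff_continuousAt]
  intro x
  obtain ⟨L, hL, h⟩ := hf (‖x‖ + 1)
  have h1 : Tendsto (fun y => L * ‖y - x‖) (𝓝 x) (𝓝 0) := by
    have hc : Continuous fun y => L * ‖y - x‖ := by fun_prop
    simpa using hc.tendsto x
  rw [ContinuousAt, tendsto_iff_norm_sub_tendsto_zero]
  refine squeeze_zero' (Eventually.of_forall fun _ => norm_nonneg _) ?_ h1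
  filter_upwards [Metric.closedBall_mem_nhds x one_pos] with y hy
  refine h y x ?_ (by linarith)
  rw [Metric.mem_closedBall, dist_eq_norm] at hy
  have := norm_add_le (y - x) x
  rw [sub_add_cancel] at this
  linarith

end LipschitzOnBounded

end LipschitzOnBounded

/-! ### The closed-loop nonlinearity -/

namespace SingleTrackModel

variable (P : SingleTrackModel) {Q : ℝ → Matrix (Fin 2) (Fin 2) ℝ} {ω₀ : ℝ}

lemma lipschitzOnBounded_mv_Sig (hs : P.SourceDissipative Q) :
    LipschitzOnBounded fun y => mv (P.Sig y) := by
  obtain ⟨L, hL, h⟩ := hs.lipschitz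
  exact LipschitzOnBounded.of_lipschitz hL fun x y => by rw [← mv_sub]; exact h x y

/-- The quasi-steady profile as an element of `L²`. -/
noncomputable def profileL2 (y : E2) : L2 := toL2 (P.profile y)

lemma profileL2_coe (hd : P.StrictlyDissipative Q ω₀) (hs : P.SourceDissipative Q) (y : E2) :
    ⇑(P.profileL2 y) =ᵐ[unitVol] P.profile y :=
  toL2_coe (P.isSteadyProfile_profile hd hs y).continuousOn

lemma lipschitzOnBounded_profileL2 (hd : P.StrictlyDissipative Q ω₀) (hs : P.SourceDissipative Q)
    (hsm : P.SmoothSteadyState) : LipschitzOnBounded P.profileL2 := by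
  obtain ⟨M, hM, h, -⟩ := P.toL2_profile_lipschitz hd hs hsm
  exact LipschitzOnBounded.of_lipschitz hM h

lemma lipschitzOnBounded_kernelInt_profile (hd : P.StrictlyDissipative Q ω₀)
    (hs : P.SourceDissipative Q) (hsm : P.SmoothSteadyState)
    {K : ℝ → Matrix (Fin 2) (Fin 2) ℝ} (hK : ContinuousOn K (Icc 0 1)) :
    LipschitzOnBounded fun y => kernelInt K (P.profile y) := by
  obtain ⟨k, hk⟩ := exists_kernelOperator hK
  have h : (fun y => kernelInt K (P.profile y)) = fun y => k (P.profileL2 y) := by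
    funext y
    rw [hk, kernelInt_congr (P.profileL2_coe hd hs y)]
  rw [h]
  exact (LipschitzOnBounded.clm k).comp (P.lipschitzOnBounded_profileL2 hd hs hsm)

lemma lipschitzOnBounded_mv_Sig_apply (hs : P.SourceDissipative Q) {f : E2 → E2}
    (hf : LipschitzOnBounded f) : LipschitzOnBounded fun y => mv (P.Sig y) (f y) :=
  LipschitzOnBounded.bilin (ContinuousLinearMap.id ℝ (E2 →L[ℝ] E2))
    (P.lipschitzOnBounded_mv_Sig hs) hf

/-- Although `h₂` is only assumed continuous, the integrated stationary equation expresses it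
through Σ and the profile, both Lipschitz in y. -/
lemma lipschitzOnBounded_h₂ (hd : P.StrictlyDissipative Q ω₀) (hs : P.SourceDissipative Q)
    (hsm : P.SmoothSteadyState) : LipschitzOnBounded P.h₂ := by
  obtain ⟨M, hM, -, h1⟩ := P.toL2_profile_lipschitz hd hs hsm
  have h1' : LipschitzOnBounded fun y => P.profile y 1 := LipschitzOnBounded.of_lipschitz hM h1
  have e : P.h₂ = fun y => mv P.Lam (P.profile y 1) -
      mv (P.Sig y) (kernelInt (fun _ => 1) (P.profile y) + kernelInt P.K₃ (P.profile y)) -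
      (kernelInt P.K₄ (P.profile y) + mv P.K₅ (P.profile y 1)) :=
    funext fun y => (P.isSteadyProfile_profile hd hs y).source_eq
  rw [e]
  refine (((LipschitzOnBounded.clm (mv P.Lam)).comp h1').sub
    (P.lipschitzOnBounded_mv_Sig_apply hs ?_)).sub
    ((P.lipschitzOnBounded_kernelInt_profile hd hs hsm P.K₄_cont).add
      ((LipschitzOnBounded.clm (mv P.K₅)).comp h1'))
  exact (P.lipschitzOnBounded_kernelInt_profile hd hs hsm continuousOn_const).add
    (P.lipschitzOnBounded_kernelInt_profile hd hs hsm P.K₃_cont)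

/-- Likewise `h₁` is Φ minus forces generated by the profile, and Φ is C¹. -/
lemma lipschitzOnBounded_h₁ (hd : P.StrictlyDissipative Q ω₀) (hs : P.SourceDissipative Q)
    (hsm : P.SmoothSteadyState) : LipschitzOnBounded P.h₁ := by
  have e : P.h₁ = fun y => P.steadyForce y - (kernelInt P.K₁ (P.profile y) +
      mv (P.Sig y) (kernelInt P.K₂ (P.profile y))) := by
    funext y
    rw [steadyForce]; abel
  rw [e]
  exact (LipschitzOnBounded.of_contDiff hsm.force_C1).sub
    ((P.lipschitzOnBounded_kernelInt_profile hd hs hsm P.K₁_cont).add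
      (P.lipschitzOnBounded_mv_Sig_apply hs
        (P.lipschitzOnBounded_kernelInt_profile hd hs hsm P.K₂_cont)))

/-- The state space of `(X, z, X̂)`. -/
abbrev State : Type := E2 × L2 × E2

/-- The slip angles in closed loop, as a function of `(X, X̂)`. -/
noncomputable def loopSlip (Xs Us : E2) (F : Matrix (Fin 2) (Fin 2) ℝ) (X Xhat : E2) : E2 :=
  P.slip X (feedback Xs Us F Xhat)

/-- The closed-loop nonlinearity on `(X, z, X̂)`. -/
noncomputable def loopRHS (ε : ℝ) (Xs Us : E2) (F : Matrix (Fin 2) (Fin 2) ℝ)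
    (L : Matrix (Fin 2) (Fin 1) ℝ) (u : State) : State :=
  (P.odeRHS u.1 (feedback Xs Us F u.2.2) u.2.1,
    ε⁻¹ • P.pdeSource u.1 (feedback Xs Us F u.2.2) u.2.1,
    P.observerRHS L u.2.2 (feedback Xs Us F u.2.2) (mv yawRateOutput u.1))

lemma lipschitzOnBounded_loopRHS (hd : P.StrictlyDissipative Q ω₀) (hs : P.SourceDissipative Q)
    (hsm : P.SmoothSteadyState) (ε : ℝ) (Xs Us : E2) (F : Matrix (Fin 2) (Fin 2) ℝ)
    (L : Matrix (Fin 2) (Fin 1) ℝ) : LipschitzOnBounded (P.loopRHS ε Xs Us F L) := by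
  have hX : LipschitzOnBounded fun u : State => u.1 :=
    LipschitzOnBounded.clm (ContinuousLinearMap.fst ℝ E2 (L2 × E2))
  have h2 : LipschitzOnBounded fun u : State => u.2 :=
    LipschitzOnBounded.clm (ContinuousLinearMap.snd ℝ E2 (L2 × E2))
  have hz : LipschitzOnBounded fun u : State => u.2.1 :=
    (LipschitzOnBounded.clm (ContinuousLinearMap.fst ℝ L2 E2)).comp h2
  have hh : LipschitzOnBounded fun u : State => u.2.2 :=
    (LipschitzOnBounded.clm (ContinuousLinearMap.snd ℝ L2 E2)).comp h2
  have hmv : ∀ {m n : ℕ} (M : Matrix (Fin m) (Fin n) ℝ) {f : State → EuclideanSpace ℝ (Fin n)},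
      LipschitzOnBounded f → LipschitzOnBounded fun u => mv M (f u) := fun M _ hf =>
    (LipschitzOnBounded.clm (mv M)).comp hf
  have hfb : LipschitzOnBounded fun u : State => feedback Xs Us F u.2.2 :=
    (LipschitzOnBounded.const Us).add (hmv F (hh.sub (LipschitzOnBounded.const Xs)))
  have hsl : LipschitzOnBounded fun u : State => P.slip u.1 (feedback Xs Us F u.2.2) :=
    (hmv P.A₂ hX).add (hmv P.G₂ hfb)
  have hsl' : LipschitzOnBounded fun u : State => P.slip u.2.2 (feedback Xs Us F u.2.2) :=
    (hmv P.A₂ hh).add (hmv P.G₂ hfb)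
  have hSig := (P.lipschitzOnBounded_mv_Sig hs).comp hsl
  have hker : ∀ {K : ℝ → Matrix (Fin 2) (Fin 2) ℝ}, ContinuousOn K (Icc 0 1) →
      LipschitzOnBounded fun u : State => kernelInt K u.2.1 := by
    intro K hK
    obtain ⟨k, hk⟩ := exists_kernelOperator hK
    have : (fun u : State => kernelInt K u.2.1) = fun u => k u.2.1 := funext fun u => (hk _).symm
    rw [this]
    exact (LipschitzOnBounded.clm k).comp hz
  refine LipschitzOnBounded.prodMk ?_ (LipschitzOnBounded.prodMk ?_ ?_)
  · refine (((hmv P.A₁ hX).add (hmv P.G₁ ((hker P.K₁_cont).add ?_))).add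
      (hmv P.G₁ ((P.lipschitzOnBounded_h₁ hd hs hsm).comp hsl))).add (LipschitzOnBounded.const P.b)
    exact LipschitzOnBounded.bilin (ContinuousLinearMap.id ℝ (E2 →L[ℝ] E2)) hSig (hker P.K₂_cont)
  · refine (LipschitzOnBounded.clm (ε⁻¹ • ContinuousLinearMap.id ℝ L2)).comp
      (f := fun u : State => P.pdeSource u.1 (feedback Xs Us F u.2.2) u.2.1) ?_
    simp only [pdeSource_eq]
    refine LipschitzOnBounded.add ?_ ((LipschitzOnBounded.clm
      (Lp.constL 2 unitVol ℝ : E2 →L[ℝ] L2)).comp ((P.lipschitzOnBounded_h₂ hd hs hsm).comp hsl))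
    exact LipschitzOnBounded.bilin
      ((ContinuousLinearMap.id ℝ (E2 →L[ℝ] E2)).compLpL₂ 2 unitVol) hSig
      ((LipschitzOnBounded.clm P.sourceShift).comp hz)
  · exact (((hmv P.A₁ hh).add (hmv P.G₁
      ((LipschitzOnBounded.of_contDiff hsm.force_C1).comp hsl'))).add
      (LipschitzOnBounded.const P.b)).sub (hmv L ((hmv yawRateOutput hX).sub
        (hmv yawRateOutput hh)))

end SingleTrackModel

/-! ### Energy estimates along mild solutions -/

section Energy

/-- A fencing lemma: exponential decay below a threshold. -/
lemma exp_decay_of_dini {V D : ℝ → ℝ} {v c : ℝ} (hc : 0 < c) (hV : ContinuousOn V (Ici 0))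
    (hV0 : 0 ≤ V 0) (hv : V 0 < v)
    (hD : ∀ t, 0 ≤ t → ∀ r, D t < r → ∃ᶠ s in 𝓝[>] t, slope V t s < r)
    (hdec : ∀ t, 0 ≤ t → V t ≤ v → D t ≤ -c * V t) {t : ℝ} (ht : 0 ≤ t) :
    V t ≤ V 0 * Real.exp (-(c / 2) * t) := by
  -- Comparison with the barrier (V 0 + δ) exp(-(c/2)s). At a contact point V is positive and at
  -- most v, so D ≤ -cV < -(c/2)V, the slope of the barrier. The halved rate and δ > 0 provide the
  -- strict inequality; finally δ → 0.
  have key : ∀ δ > 0, V 0 + δ ≤ v → V t ≤ (V 0 + δ) * Real.exp (-(c / 2) * t) := by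
    intro δ hδ hδv
    have hB : ∀ s, HasDerivAt (fun s => (V 0 + δ) * Real.exp (-(c / 2) * s))
        ((V 0 + δ) * (Real.exp (-(c / 2) * s) * -(c / 2))) s := fun s => by
      simpa using (((hasDerivAt_id s).const_mul (-(c / 2))).exp).const_mul (V 0 + δ)
    refine image_le_of_liminf_slope_right_lt_deriv_boundary' (f := V) (f' := D)
      (B := fun s => (V 0 + δ) * Real.exp (-(c / 2) * s))
      (hV.mono Icc_subset_Ici_self) (fun s hs => hD s hs.1) (by simp; linarith)
      (fun s _ => (hB s).continuousAt.continuousWithinAt) (fun s _ => (hB s).hasDerivWithinAt)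
      (fun s hs hsB => ?_) ⟨ht, le_rfl⟩
    have h1 : Real.exp (-(c / 2) * s) ≤ 1 := Real.exp_le_one_iff.2 (by nlinarith [hs.1])
    have h2 := Real.exp_pos (-(c / 2) * s)
    have h3 : 0 < V s := by rw [hsB]; positivity
    have h4 : V s ≤ v := by rw [hsB]; nlinarith
    have h5 := hdec s hs.1 h4
    have h6 : (V 0 + δ) * (Real.exp (-(c / 2) * s) * -(c / 2)) = -(c / 2) * V s := by
      rw [hsB]; ring
    rw [h6]
    nlinarith
  have hlim : Tendsto (fun δ : ℝ => (V 0 + δ) * Real.exp (-(c / 2) * t)) (𝓝[>] 0)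
      (𝓝 (V 0 * Real.exp (-(c / 2) * t))) := by
    have hcont : Continuous fun δ : ℝ => (V 0 + δ) * Real.exp (-(c / 2) * t) := by fun_prop
    simpa using (hcont.tendsto 0).mono_left nhdsWithin_le_nhds
  refine ge_of_tendsto hlim ?_
  filter_upwards [Ioo_mem_nhdsGT (show (0 : ℝ) < v - V 0 by linarith)] with δ hδ
  exact key δ hδ.1 (by linarith [hδ.2])

variable {H : Type*} [NormedAddCommGroup H] [InnerProductSpace ℝ H] [CompleteSpace H]
variable {q : H →L[ℝ] H →L[ℝ] ℝ} {c κ : ℝ} {G : H → H → Prop} {T : ℝ → H →L[ℝ] H}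

lemma IsStrongSemigroup.continuous_extend (hT : IsStrongSemigroup T) (x : H) :
    Continuous fun t => T (max t 0) x :=
  (hT.continuousOn x).comp_continuous (by fun_prop) fun _ => mem_Ici.2 (le_max_right _ _)

lemma IsMDissipative.semigroup_norm_le (hG : IsMDissipative q κ G) (hq : IsEquivInner q c)
    (hT : IsStrongSemigroup T) (hTG : HasGenerator T G) {t : ℝ} (ht : 0 ≤ t) :
    ‖T t‖ ≤ Real.sqrt (‖q‖ / c) := by
  refine ContinuousLinearMap.opNorm_le_bound _ (Real.sqrt_nonneg _) fun x => ?_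
  refine hq.norm_le_of_apply_le ((hG.semigroup_decay hq hT hTG ht x).trans ?_)
  refine mul_le_of_le_one_left (hq.nonneg x) (Real.exp_le_one_iff.2 ?_)
  have := mul_nonneg hG.rate_pos.le ht
  linarith

/-- This replaces differentiability of `z`. By the semigroup law z(t+h) - T(h)z(t) is the integral
of T(t+h-s)g(s) over [t, t+h], and joint continuity of the integrand gives the limit of its average.
-/
lemma mild_step (hG : IsMDissipative q κ G) (hq : IsEquivInner q c) (hT : IsStrongSemigroup T)
    (hTG : HasGenerator T G) {z g : ℝ → H} {z₀ : H} (hg : ContinuousOn g (Ici 0))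
    (hz : ∀ t, 0 ≤ t → z t = T t z₀ + ∫ s in (0 : ℝ)..t, T (t - s) (g s)) {t : ℝ} (ht : 0 ≤ t) :
    Tendsto (fun h : ℝ => h⁻¹ • (z (t + h) - T h (z t))) (𝓝[>] 0) (𝓝 (g t)) := by
  have hcont : Continuous fun p : ℝ × H => T (max p.1 0) p.2 :=
    continuous_uncurry_of_strong (S := fun t => T (max t 0)) hT.continuous_extend
      fun t => hG.semigroup_norm_le hq hT hTG (le_max_right _ _)
  have hg' : Continuous fun s => g (max s 0) :=
    hg.comp_continuous (by fun_prop) fun _ => mem_Ici.2 (le_max_right _ _)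
  have hjoint : Continuous fun p : ℝ × ℝ => T (max p.1 0) (g (max p.2 0)) :=
    hcont.comp (f := fun p : ℝ × ℝ => (p.1, g (max p.2 0)))
      (continuous_fst.prodMk (hg'.comp continuous_snd))
  have hint : ∀ b a' b' : ℝ, IntervalIntegrable (fun s => T (max (b - s) 0) (g (max s 0)))
      volume a' b' := fun b a' b' =>
    (hjoint.comp (f := fun s : ℝ => (b - s, s)) (by fun_prop)).intervalIntegrable _ _
  have hcongr : ∀ b a' b' : ℝ, 0 ≤ a' → a' ≤ b' → b' ≤ b → ∫ s in a'..b', T (b - s) (g s) =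
      ∫ s in a'..b', T (max (b - s) 0) (g (max s 0)) := by
    intro b a' b' h1 h2 h3
    refine intervalIntegral.integral_congr fun s hs => ?_
    rw [uIcc_of_le h2] at hs
    rw [max_eq_left (by linarith [hs.2]), max_eq_left (by linarith [hs.1])]
  have hstep : ∀ h : ℝ, 0 < h → z (t + h) - T h (z t) =
      ∫ s in t..(t + h), T (max (t + h - s) 0) (g (max s 0)) := by
    intro h hh
    rw [hz (t + h) (by linarith), hz t ht, map_add, ← ContinuousLinearMap.comp_apply (T h),
      ← hT.add _ _ hh.le ht, hcongr _ _ _ le_rfl ht le_rfl,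
      hcongr _ _ _ le_rfl (by linarith) le_rfl,
      ← (T h).intervalIntegral_comp_comm (hint t 0 t),
      ← intervalIntegral.integral_add_adjacent_intervals (hint (t + h) 0 t)
        (hint (t + h) t (t + h))]
    have e : ∫ s in (0 : ℝ)..t, T h (T (max (t - s) 0) (g (max s 0))) =
        ∫ s in (0 : ℝ)..t, T (max (t + h - s) 0) (g (max s 0)) := by
      refine intervalIntegral.integral_congr fun s hs => ?_
      rw [uIcc_of_le ht] at hs
      rw [max_eq_left (show 0 ≤ t - s by linarith [hs.2]),
        max_eq_left (show 0 ≤ t + h - s by linarith [hs.2]),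
        ← ContinuousLinearMap.comp_apply, ← hT.add _ _ hh.le (by linarith [hs.2])]
      congr 2
      ring
    rw [e, add_comm h t]
    abel
  rw [Metric.tendsto_nhdsWithin_nhds]
  intro e he
  obtain ⟨δ, hδ, hδe⟩ := Metric.continuousAt_iff.1 (hjoint.continuousAt (x := (0, t))) (e / 2)
    (by positivity)
  refine ⟨δ, hδ, fun h hh hhδ => ?_⟩
  have hh0 : 0 < h := hh
  rw [dist_zero_right, Real.norm_of_nonneg hh0.le] at hhδ
  have e0 : T (max 0 0) (g (max t 0)) = g t := by
    rw [max_self, max_eq_left ht, hT.zero]; rfl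
  have h1 : ‖∫ s in t..(t + h), (T (max (t + h - s) 0) (g (max s 0)) - g t)‖ ≤
      e / 2 * |t + h - t| := by
    refine intervalIntegral.norm_integral_le_of_norm_le_const fun s hs => ?_
    rw [uIoc_of_le (by linarith)] at hs
    have h2 : dist (t + h - s, s) ((0 : ℝ), t) < δ := by
      rw [Prod.dist_eq, max_lt_iff, Real.dist_eq, Real.dist_eq, abs_lt, abs_lt]
      refine ⟨⟨?_, ?_⟩, ?_, ?_⟩ <;> linarith [hs.1, hs.2]
    have h3 := hδe h2
    simp only [e0] at h3
    rw [dist_eq_norm] at h3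
    exact h3.le
  rw [intervalIntegral.integral_sub (hint _ _ _) (by simp), intervalIntegral.integral_const,
    ← hstep h hh0, add_sub_cancel_left, abs_of_pos hh0] at h1
  rw [dist_eq_norm]
  have e2 : h⁻¹ • (z (t + h) - T h (z t)) - g t = h⁻¹ • (z (t + h) - T h (z t) - h • g t) := by
    rw [smul_sub h⁻¹ _ (h • g t), smul_smul, inv_mul_cancel₀ hh0.ne', one_smul]
  rw [e2, norm_smul, Real.norm_of_nonneg (by positivity)]
  calc h⁻¹ * ‖z (t + h) - T h (z t) - h • g t‖ ≤ h⁻¹ * (e / 2 * h) := by gcongr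
    _ = e / 2 := by field_simp
    _ < e := by linarith

/-- Upper bound for the right Dini derivative of `q (z - π) (z - π)`, where `z` is a mild
solution and `π` is a path in the domain of the generator. -/
lemma energy_dini (hG : IsMDissipative q κ G) (hq : IsEquivInner q c) (hT : IsStrongSemigroup T)
    (hTG : HasGenerator T G) {z π g : ℝ → H} {z₀ : H} (hg : ContinuousOn g (Ici 0))
    (hz : ∀ t, 0 ≤ t → z t = T t z₀ + ∫ s in (0 : ℝ)..t, T (t - s) (g s)) {t : ℝ} (ht : 0 ≤ t)
    {v : H} (hv : G (π t) v) {E : Type*} [NormedAddCommGroup E] [NormedSpace ℝ E] {α : ℝ → E}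
    {α' : E} {M : ℝ} (hα : HasDerivWithinAt α α' (Ici t) t)
    (hπ : ∀ s, ‖π s - π t‖ ≤ M * ‖α s - α t‖) :
    ∃ U : ℝ → ℝ, Tendsto U (𝓝[>] t) (𝓝 (-(2 * κ) * q (z t - π t) (z t - π t) +
        2 * q (z t - π t) (g t + v) + 2 * (‖q‖ * ‖z t - π t‖ * (M * ‖α'‖)))) ∧
      ∀ᶠ s in 𝓝[>] t, slope (fun s => q (z s - π s) (z s - π s)) t s ≤ U s := by
  have hshift : Tendsto (fun s : ℝ => s - t) (𝓝[>] t) (𝓝[>] 0) := by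
    rw [tendsto_nhdsWithin_iff]
    constructor
    · have : Continuous fun s : ℝ => s - t := by fun_prop
      simpa using (this.tendsto t).mono_left nhdsWithin_le_nhds
    · filter_upwards [self_mem_nhdsWithin] with s hs
      exact mem_Ioi.2 (sub_pos.2 (mem_Ioi.1 hs))
  set ζ : H := z t - π t with hζ
  have h0 : Tendsto (fun s : ℝ => s - t) (𝓝[>] t) (𝓝 0) := hshift.mono_right nhdsWithin_le_nhds
  have hx : Tendsto (fun s => T (s - t) ζ) (𝓝[>] t) (𝓝 ζ) := (hT.strongCont ζ).comp hshift
  -- With h = s - t, z(s) - π(s) = T(h)ζ + h d(s) - (π(s) - π(t)). The first quotient in `d` tends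
  -- to g(t) by `mild_step`, the second to v because π(t) is in the domain.
  let d : ℝ → H := fun s => (s - t)⁻¹ • (z s - T (s - t) (z t)) +
    (s - t)⁻¹ • (T (s - t) (π t) - π t)
  have hd : Tendsto d (𝓝[>] t) (𝓝 (g t + v)) := by
    have h1 := (mild_step hG hq hT hTG hg hz ht).comp hshift
    have h2 := ((hTG _ _).1 hv).comp hshift
    refine (h1.add h2).congr fun s => ?_
    simp only [Function.comp_apply, d, add_sub_cancel]
  have ha : Tendsto (fun s => ‖slope α t s‖) (𝓝[>] t) (𝓝 ‖α'‖) := by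
    have := hα
    rw [← hasDerivWithinAt_Ioi_iff_Ici, hasDerivWithinAt_iff_tendsto_slope' (by simp)] at this
    exact this.norm
  have hexp : Tendsto (fun s => slope (fun s => Real.exp (-(2 * κ) * (s - t))) t s) (𝓝[>] t)
      (𝓝 (-(2 * κ))) := by
    have h1 : HasDerivAt (fun s => Real.exp (-(2 * κ) * (s - t))) (-(2 * κ)) t := by
      have := (((hasDerivAt_id t).sub_const t).const_mul (-(2 * κ))).exp
      simpa using this
    have h2 := h1.hasDerivWithinAt (s := Ioi t)
    rwa [hasDerivWithinAt_iff_tendsto_slope' (by simp)] at h2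
  -- The terms bound, in order: the decay of q along T(h)ζ, the drift `d`, the motion of π (only
  -- Lipschitz in α, hence a norm bound), and the quadratic remainder of order h.
  refine ⟨fun s => slope (fun s => Real.exp (-(2 * κ) * (s - t))) t s * q ζ ζ +
    2 * q (T (s - t) ζ) (d s) + 2 * (‖q‖ * ‖T (s - t) ζ‖ * (M * ‖slope α t s‖)) +
    (s - t) * (‖q‖ * (‖d s‖ + M * ‖slope α t s‖) ^ 2), ?_, ?_⟩
  · have hqc : Continuous fun p : H × H => q p.1 p.2 := by fun_prop
    have h1 := hexp.mul_const (q ζ ζ)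
    have h2 := ((hqc.tendsto (ζ, g t + v)).comp (hx.prodMk_nhds hd)).const_mul 2
    have h3 := ((hx.norm.const_mul ‖q‖).mul (ha.const_mul M)).const_mul 2
    have h4 := h0.mul (((hd.norm.add (ha.const_mul M)).pow 2).const_mul ‖q‖)
    have h5 := ((h1.add h2).add h3).add h4
    simpa using h5
  · filter_upwards [self_mem_nhdsWithin] with s hs
    have hs0 : 0 < s - t := sub_pos.2 hs
    set h := s - t with hh
    have e1 : z s - π s = T h ζ + (h • d s - (π s - π t)) := by
      simp only [d, hζ, ← hh, smul_add, smul_smul, mul_inv_cancel₀ hs0.ne', one_smul, map_sub]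
      abel
    set x := T h ζ
    set y := h • d s - (π s - π t) with hy
    have hΔ : ‖π s - π t‖ ≤ h * (M * ‖slope α t s‖) := by
      refine (hπ s).trans (le_of_eq ?_)
      rw [slope_def_module, norm_smul, norm_inv, Real.norm_of_nonneg hs0.le]
      field_simp
    have hyn : ‖y‖ ≤ h * (‖d s‖ + M * ‖slope α t s‖) := by
      refine (norm_sub_le _ _).trans ?_
      rw [norm_smul, Real.norm_of_nonneg hs0.le]
      linarith
    have h1 : q x x ≤ Real.exp (-(2 * κ) * h) * q ζ ζ := hG.semigroup_decay hq hT hTG hs0.le ζ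
    have h2 : q x y ≤ h * q x (d s) + ‖q‖ * ‖x‖ * (h * (M * ‖slope α t s‖)) := by
      rw [hy, map_sub, map_smul, smul_eq_mul]
      have h3 := (abs_le.1 (apply_le_norm q x (π s - π t))).1
      have h4 : ‖q‖ * ‖x‖ * ‖π s - π t‖ ≤ ‖q‖ * ‖x‖ * (h * (M * ‖slope α t s‖)) := by gcongr
      linarith
    have h3 : q y y ≤ ‖q‖ * (h * (‖d s‖ + M * ‖slope α t s‖)) ^ 2 := by
      refine ((abs_le.1 (apply_le_norm q y y)).2).trans ?_
      rw [mul_assoc, ← sq]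
      gcongr
    rw [slope_def_field, div_le_iff₀ hs0]
    rw [e1, ← hζ, slope_def_field]
    have e2 : q (x + y) (x + y) = q x x + 2 * q x y + q y y := by
      simp only [map_add, add_apply]
      rw [hq.symm y x]; ring
    rw [e2, ← hh, sub_self, mul_zero, Real.exp_zero]
    have e3 : ((Real.exp (-(2 * κ) * h) - 1) / h * q ζ ζ + 2 * q x (d s) +
        2 * (‖q‖ * ‖x‖ * (M * ‖slope α t s‖)) +
        h * (‖q‖ * (‖d s‖ + M * ‖slope α t s‖) ^ 2)) * h =
        (Real.exp (-(2 * κ) * h) - 1) * q ζ ζ + 2 * (h * q x (d s)) +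
        2 * (‖q‖ * ‖x‖ * (h * (M * ‖slope α t s‖))) +
        ‖q‖ * (h * (‖d s‖ + M * ‖slope α t s‖)) ^ 2 := by
      field_simp
    rw [e3]
    linarith

end Energy

/-! ### Linearization of the slow subsystem -/

/-- The pair `(a, b)` as a single vector indexed by `Fin 2 ⊕ Fin 2`. -/
noncomputable def stack : E2 × E2 →L[ℝ] EuclideanSpace ℝ (Fin 2 ⊕ Fin 2) :=
  LinearMap.toContinuousLinearMap
    { toFun := fun w => WithLp.toLp 2 (Sum.elim w.1 w.2)
      map_add' := fun w w' => by ext (i | i) <;> simp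
      map_smul' := fun r w => by ext (i | i) <;> simp }

lemma norm_stack_sq (a b : E2) : ‖stack (a, b)‖ ^ 2 = ‖a‖ ^ 2 + ‖b‖ ^ 2 := by
  rw [EuclideanSpace.norm_sq_eq, Fintype.sum_sum_type, EuclideanSpace.norm_sq_eq,
    EuclideanSpace.norm_sq_eq]
  rfl

lemma norm_le_norm_stack_left (a b : E2) : ‖a‖ ≤ ‖stack (a, b)‖ :=
  abs_le_of_sq_le_sq' (by rw [norm_stack_sq]; nlinarith [sq_nonneg ‖b‖]) (norm_nonneg _) |>.2

lemma norm_le_norm_stack_right (a b : E2) : ‖b‖ ≤ ‖stack (a, b)‖ :=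
  abs_le_of_sq_le_sq' (by rw [norm_stack_sq]; nlinarith [sq_nonneg ‖a‖]) (norm_nonneg _) |>.2

lemma norm_stack_le (a b : E2) : ‖stack (a, b)‖ ≤ ‖a‖ + ‖b‖ :=
  abs_le_of_sq_le_sq' (by
    rw [norm_stack_sq]; nlinarith [mul_nonneg (norm_nonneg a) (norm_nonneg b)]) (by positivity) |>.2

lemma toEuclideanCLM_fromBlocks_stack (A B C D : Matrix (Fin 2) (Fin 2) ℝ) (a b : E2) :
    Matrix.toEuclideanCLM (𝕜 := ℝ) (Matrix.fromBlocks A B C D) (stack (a, b)) =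
      stack (mv A a + mv B b, mv C a + mv D b) := by
  have h : WithLp.ofLp (stack (a, b)) = Sum.elim (WithLp.ofLp a) (WithLp.ofLp b) := by
    funext i; rcases i with i | i <;> rfl
  have e : WithLp.ofLp (Matrix.toEuclideanCLM (𝕜 := ℝ) (Matrix.fromBlocks A B C D) (stack (a, b)))
      = Matrix.mulVec (Matrix.fromBlocks A B C D) (Sum.elim (WithLp.ofLp a) (WithLp.ofLp b)) := by
    rw [← h]; rfl
  apply WithLp.ofLp_injective
  rw [e, Matrix.fromBlocks_mulVec]
  funext i
  rcases i with i | i <;> rfl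

lemma fderiv_eq_mv_jacobian (f : E2 → E2) (y : E2) : fderiv ℝ f y = mv (jacobian f y) := by
  refine ContinuousLinearMap.ext fun x => ?_
  have hx : x = x 0 • EuclideanSpace.single (0 : Fin 2) (1 : ℝ) +
      x 1 • EuclideanSpace.single (1 : Fin 2) (1 : ℝ) := by
    ext i; fin_cases i <;> simp
  ext i
  rw [mv_apply]
  conv_lhs => rw [hx]
  simp [jacobian, Fin.sum_univ_two]
  ring

namespace SingleTrackModel

variable (P : SingleTrackModel) {Q : ℝ → Matrix (Fin 2) (Fin 2) ℝ} {ω₀ : ℝ}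

lemma loopSlip_sub (Xs Us : E2) (F : Matrix (Fin 2) (Fin 2) ℝ) (X Xhat : E2) :
    P.loopSlip Xs Us F X Xhat - P.slip Xs Us =
      mv P.A₂ (X - Xs) + mv P.G₂ (mv F ((X - Xs) - (X - Xhat))) := by
  simp only [loopSlip, slip, feedback, map_sub, map_add]
  abel

lemma norm_loopSlip_sub_le (Xs Us : E2) (F : Matrix (Fin 2) (Fin 2) ℝ) (X Xhat : E2) :
    ‖P.loopSlip Xs Us F X Xhat - P.slip Xs Us‖ ≤
      (‖mv P.A₂‖ + ‖mv P.G₂‖ * ‖mv F‖ * 2) * ‖stack (X - Xs, X - Xhat)‖ := by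
  have h1 := norm_le_norm_stack_left (X - Xs) (X - Xhat)
  have h2 := norm_le_norm_stack_right (X - Xs) (X - Xhat)
  rw [loopSlip_sub]
  set ρ := ‖stack (X - Xs, X - Xhat)‖
  have h3 : ‖(X - Xs) - (X - Xhat)‖ ≤ 2 * ρ := (norm_sub_le _ _).trans (by linarith)
  calc _ ≤ ‖mv P.A₂ (X - Xs)‖ + ‖mv P.G₂ (mv F ((X - Xs) - (X - Xhat)))‖ := norm_add_le _ _
    _ ≤ ‖mv P.A₂‖ * ρ + ‖mv P.G₂‖ * (‖mv F‖ * (2 * ρ)) := by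
      gcongr
      · exact (mv P.A₂).le_opNorm_of_le h1
      · exact (mv P.G₂).le_opNorm_of_le ((mv F).le_opNorm_of_le h3)
    _ = _ := by ring

lemma norm_observer_slip_sub_le (Xs Us : E2) (F : Matrix (Fin 2) (Fin 2) ℝ) (X Xhat : E2) :
    ‖P.loopSlip Xs Us F Xhat Xhat - P.slip Xs Us‖ ≤
      (‖mv P.A₂‖ + ‖mv P.G₂‖ * ‖mv F‖) * 2 * ‖stack (X - Xs, X - Xhat)‖ := by
  have h1 := norm_le_norm_stack_left (X - Xs) (X - Xhat)
  have h2 := norm_le_norm_stack_right (X - Xs) (X - Xhat)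
  rw [loopSlip_sub, sub_self, sub_zero]
  set ρ := ‖stack (X - Xs, X - Xhat)‖
  have h3 : ‖Xhat - Xs‖ ≤ 2 * ρ := by
    have : Xhat - Xs = (X - Xs) - (X - Xhat) := by abel
    rw [this]
    exact (norm_sub_le _ _).trans (by linarith)
  calc _ ≤ ‖mv P.A₂ (Xhat - Xs)‖ + ‖mv P.G₂ (mv F (Xhat - Xs))‖ := norm_add_le _ _
    _ ≤ ‖mv P.A₂‖ * (2 * ρ) + ‖mv P.G₂‖ * (‖mv F‖ * (2 * ρ)) := by
      gcongr
      · exact (mv P.A₂).le_opNorm_of_le h3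
      · exact (mv P.G₂).le_opNorm_of_le ((mv F).le_opNorm_of_le h3)
    _ = _ := by ring

/-- The tire forces produced by a deviation `ζ` from the quasi-steady profile. -/
noncomputable def deviationForce (y : E2) (ζ : L2) : E2 :=
  kernelInt P.K₁ ζ + mv (P.Sig y) (kernelInt P.K₂ ζ)

/-- The equilibrium equation eliminates `b`, and splitting z into profile plus deviation collects
the profile's force into Φ(α). -/
lemma odeRHS_eq (hd : P.StrictlyDissipative Q ω₀) (hs : P.SourceDissipative Q) {Xs Us : E2}
    (heq : P.IsEquilibrium Xs Us) (F : Matrix (Fin 2) (Fin 2) ℝ) (X Xhat : E2) (z : L2) :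
    P.odeRHS X (feedback Xs Us F Xhat) z = mv P.A₁ (X - Xs) +
      mv P.G₁ (P.steadyForce (P.loopSlip Xs Us F X Xhat) - P.steadyForce (P.slip Xs Us)) +
      mv P.G₁ (P.deviationForce (P.loopSlip Xs Us F X Xhat)
        (z - P.profileL2 (P.loopSlip Xs Us F X Xhat))) := by
  set y := P.loopSlip Xs Us F X Xhat with hy
  obtain ⟨k₁, hk₁⟩ := exists_kernelOperator P.K₁_cont
  obtain ⟨k₂, hk₂⟩ := exists_kernelOperator P.K₂_cont
  have h1 : kernelInt P.K₁ (P.profile y) = k₁ (P.profileL2 y) := by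
    rw [hk₁]; exact kernelInt_congr (P.profileL2_coe hd hs y).symm
  have h2 : kernelInt P.K₂ (P.profile y) = k₂ (P.profileL2 y) := by
    rw [hk₂]; exact kernelInt_congr (P.profileL2_coe hd hs y).symm
  have h3 : P.steadyForce y = k₁ (P.profileL2 y) + mv (P.Sig y) (k₂ (P.profileL2 y)) + P.h₁ y := by
    rw [steadyForce, h1, h2]
  have h4 : P.b = -(mv P.A₁ Xs + mv P.G₁ (P.steadyForce (P.slip Xs Us))) :=
    eq_neg_of_add_eq_zero_right heq
  rw [odeRHS, show P.slip X (feedback Xs Us F Xhat) = y from rfl, deviationForce, h3, h4,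
    ← hk₁, ← hk₂, ← hk₁, ← hk₂]
  simp only [map_sub, map_add]
  abel

lemma odeRHS_sub_observerRHS_eq (hd : P.StrictlyDissipative Q ω₀) (hs : P.SourceDissipative Q)
    {Xs Us : E2} (heq : P.IsEquilibrium Xs Us) (F : Matrix (Fin 2) (Fin 2) ℝ)
    (L : Matrix (Fin 2) (Fin 1) ℝ) (X Xhat : E2) (z : L2) :
    P.odeRHS X (feedback Xs Us F Xhat) z -
        P.observerRHS L Xhat (feedback Xs Us F Xhat) (mv yawRateOutput X) =
      mv P.A₁ (X - Xhat) + mv P.G₁ (P.steadyForce (P.loopSlip Xs Us F X Xhat) -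
        P.steadyForce (P.loopSlip Xs Us F Xhat Xhat)) +
      mv P.G₁ (P.deviationForce (P.loopSlip Xs Us F X Xhat)
        (z - P.profileL2 (P.loopSlip Xs Us F X Xhat))) + mv L (mv yawRateOutput (X - Xhat)) := by
  have h4 : P.b = -(mv P.A₁ Xs + mv P.G₁ (P.steadyForce (P.slip Xs Us))) :=
    eq_neg_of_add_eq_zero_right heq
  rw [P.odeRHS_eq hd hs heq, observerRHS, h4,
    show P.slip Xhat (feedback Xs Us F Xhat) = P.loopSlip Xs Us F Xhat Xhat from rfl]
  simp only [map_sub]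
  abel

/-- The slow vector field agrees with its linearization up to a small relative error and a
term that is linear in the deviation of the fast variable. -/
lemma exists_linearization (hd : P.StrictlyDissipative Q ω₀) (hs : P.SourceDissipative Q)
    (hsm : P.SmoothSteadyState) {Xs Us : E2} (heq : P.IsEquilibrium Xs Us)
    (F : Matrix (Fin 2) (Fin 2) ℝ) (L : Matrix (Fin 2) (Fin 1) ℝ) :
    ∃ C : ℝ, 0 ≤ C ∧ ∀ η > 0, ∃ ρ₀ > 0, ∀ (X Xhat : E2) (z : L2),
      ‖stack (X - Xs, X - Xhat)‖ ≤ ρ₀ →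
      ‖stack (P.odeRHS X (feedback Xs Us F Xhat) z, P.odeRHS X (feedback Xs Us F Xhat) z -
          P.observerRHS L Xhat (feedback Xs Us F Xhat) (mv yawRateOutput X)) -
        Matrix.toEuclideanCLM (𝕜 := ℝ) (P.closedLoopMatrix (P.slip Xs Us) F L)
          (stack (X - Xs, X - Xhat))‖ ≤
      η * ‖stack (X - Xs, X - Xhat)‖ +
        C * ‖z - P.profileL2 (P.loopSlip Xs Us F X Xhat)‖ := by
  set αs := P.slip Xs Us with hαs
  obtain ⟨k₁, hk₁⟩ := exists_kernelOperator P.K₁_cont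
  obtain ⟨k₂, hk₂⟩ := exists_kernelOperator P.K₂_cont
  obtain ⟨b, hb0, hb⟩ := (P.lipschitzOnBounded_mv_Sig hs).exists_bound (‖αs‖ + 1)
  set k := (‖mv P.A₂‖ + ‖mv P.G₂‖ * ‖mv F‖) * 2 with hk
  have hk0 : 0 ≤ k := by positivity
  have hder : HasFDerivAt P.steadyForce (mv (P.stiffness αs)) αs := by
    rw [stiffness, ← fderiv_eq_mv_jacobian]
    exact (hsm.force_C1.differentiable one_ne_zero αs).hasFDerivAt
  -- The factor 2 occurs because the deviation force enters both the plant and the observer error.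
  refine ⟨2 * (‖mv P.G₁‖ * (‖k₁‖ + b * ‖k₂‖)), by positivity, fun η hη => ?_⟩
  -- The Taylor remainder of Φ appears once in the plant and twice in the observer error (at y and
  -- at y'), hence the 3.
  set η' := η / (3 * ‖mv P.G₁‖ * k + 1) with hη'
  have hη'0 : 0 < η' := by positivity
  obtain ⟨δ, hδ, hδr⟩ := Metric.eventually_nhds_iff.1 (hder.isLittleO.def hη'0)
  -- This radius gives kρ < min δ 1: the bound δ validates the Taylor estimate, the bound 1 keeps y
  -- in the ball where ‖Σ(y)‖ ≤ b.
  refine ⟨min δ 1 / (2 * (k + 1)), by positivity, fun X Xhat z hρ => ?_⟩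
  set y := P.loopSlip Xs Us F X Xhat with hy
  set y' := P.loopSlip Xs Us F Xhat Xhat with hy'
  set ρ := ‖stack (X - Xs, X - Xhat)‖ with hρd
  have hρ0 : 0 ≤ ρ := norm_nonneg _
  set ζ := z - P.profileL2 y with hζ
  have hkρ : k * ρ < min δ 1 := by
    have h1 : 0 < min δ 1 := by positivity
    rw [le_div_iff₀ (by positivity)] at hρ
    nlinarith
  have hyk : ‖y - αs‖ ≤ k * ρ := by
    refine (P.norm_loopSlip_sub_le Xs Us F X Xhat).trans ?_
    gcongr
    rw [hk]
    nlinarith [norm_nonneg (mv P.A₂)]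
  have hyk' : ‖y' - αs‖ ≤ k * ρ := P.norm_observer_slip_sub_le Xs Us F X Xhat
  have hr : ∀ x : E2, ‖x - αs‖ ≤ k * ρ →
      ‖P.steadyForce x - P.steadyForce αs - mv (P.stiffness αs) (x - αs)‖ ≤ η' * (k * ρ) := by
    intro x hx
    have h1 : dist x αs < δ := by
      rw [dist_eq_norm]
      exact hx.trans_lt (hkρ.trans_le (min_le_left _ _))
    exact (hδr h1).trans (by gcongr)
  have hf : ‖P.deviationForce y ζ‖ ≤ (‖k₁‖ + b * ‖k₂‖) * ‖ζ‖ := by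
    have h1 : ‖y‖ ≤ ‖αs‖ + 1 := by
      have h2 := norm_add_le (y - αs) αs
      rw [sub_add_cancel] at h2
      have h3 := min_le_right δ 1
      linarith
    rw [deviationForce, ← hk₁, ← hk₂]
    calc _ ≤ ‖k₁ ζ‖ + ‖mv (P.Sig y) (k₂ ζ)‖ := norm_add_le _ _
      _ ≤ ‖k₁‖ * ‖ζ‖ + b * (‖k₂‖ * ‖ζ‖) := by
        gcongr
        · exact k₁.le_opNorm ζ
        · exact (mv (P.Sig y)).le_of_opNorm_le_of_le (hb y h1) (k₂.le_opNorm ζ)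
      _ = _ := by ring
  have hdy : mv P.A₂ (X - Xhat) = (y - αs) - (y' - αs) := by
    rw [hy, hy', loopSlip_sub, loopSlip_sub]
    simp only [map_sub, sub_self, sub_zero]
    abel
  rw [P.odeRHS_sub_observerRHS_eq hd hs heq, P.odeRHS_eq hd hs heq, closedLoopMatrix,
    toEuclideanCLM_fromBlocks_stack, ← map_sub, Prod.mk_sub_mk, ← hαs, ← hy, ← hy', ← hζ]
  have e1 : mv P.A₁ (X - Xs) + mv P.G₁ (P.steadyForce y - P.steadyForce αs) +
      mv P.G₁ (P.deviationForce y ζ) -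
      (mv (P.Atilde αs + P.Gtilde αs * F) (X - Xs) +
        mv (-(P.G₁ * P.stiffness αs * P.G₂ * F)) (X - Xhat)) =
      mv P.G₁ (P.steadyForce y - P.steadyForce αs - mv (P.stiffness αs) (y - αs)) +
        mv P.G₁ (P.deviationForce y ζ) := by
    rw [hy, hαs, P.loopSlip_sub Xs Us F X Xhat, Atilde, Gtilde]
    simp only [mv_add, mv_neg, mv_mul, add_apply, neg_apply,
      map_add, map_sub]
    abel
  have e2 : mv P.A₁ (X - Xhat) + mv P.G₁ (P.steadyForce y - P.steadyForce y') +
      mv P.G₁ (P.deviationForce y ζ) + mv L (mv yawRateOutput (X - Xhat)) -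
      (mv 0 (X - Xs) +
        mv (P.A₁ + P.G₁ * P.stiffness αs * P.A₂ + L * yawRateOutput) (X - Xhat)) =
      mv P.G₁ ((P.steadyForce y - P.steadyForce αs - mv (P.stiffness αs) (y - αs)) -
        (P.steadyForce y' - P.steadyForce αs - mv (P.stiffness αs) (y' - αs))) +
        mv P.G₁ (P.deviationForce y ζ) := by
    have h0 : mv (0 : Matrix (Fin 2) (Fin 2) ℝ) (X - Xs) = 0 := by
      rw [← sub_self (1 : Matrix (Fin 2) (Fin 2) ℝ), mv_sub]; simp
    rw [h0]
    simp only [mv_add, mv_mul, add_apply]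
    rw [hdy]
    simp only [map_sub]
    abel
  rw [e1, e2]
  have hr1 := hr y hyk
  have hr2 := hr y' hyk'
  set r₁ := P.steadyForce y - P.steadyForce αs - mv (P.stiffness αs) (y - αs)
  set r₂ := P.steadyForce y' - P.steadyForce αs - mv (P.stiffness αs) (y' - αs)
  have hr3 : ‖r₁ - r₂‖ ≤ 2 * (η' * (k * ρ)) := (norm_sub_le _ _).trans (by linarith)
  have hη'' : 3 * ‖mv P.G₁‖ * k * η' ≤ η := by
    rw [hη', mul_div_assoc', div_le_iff₀ (by positivity)]
    nlinarith
  calc _ ≤ _ := norm_stack_le _ _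
    _ ≤ (‖mv P.G₁ r₁‖ + ‖mv P.G₁ (P.deviationForce y ζ)‖) +
        (‖mv P.G₁ (r₁ - r₂)‖ + ‖mv P.G₁ (P.deviationForce y ζ)‖) :=
      add_le_add (norm_add_le _ _) (norm_add_le _ _)
    _ ≤ (‖mv P.G₁‖ * (η' * (k * ρ)) + ‖mv P.G₁‖ * ((‖k₁‖ + b * ‖k₂‖) * ‖ζ‖)) +
        (‖mv P.G₁‖ * (2 * (η' * (k * ρ))) + ‖mv P.G₁‖ * ((‖k₁‖ + b * ‖k₂‖) * ‖ζ‖)) := by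
      gcongr
      · exact (mv P.G₁).le_opNorm_of_le hr1
      · exact (mv P.G₁).le_opNorm_of_le hf
      · exact (mv P.G₁).le_opNorm_of_le hr3
      · exact (mv P.G₁).le_opNorm_of_le hf
    _ = 3 * ‖mv P.G₁‖ * k * η' * ρ + 2 * (‖mv P.G₁‖ * (‖k₁‖ + b * ‖k₂‖)) * ‖ζ‖ := by ring
    _ ≤ _ := by gcongr

end SingleTrackModel

/-! ### Lyapunov function of the closed loop -/

namespace SingleTrackModel

variable (P : SingleTrackModel) {Q : ℝ → Matrix (Fin 2) (Fin 2) ℝ} {ω₀ : ℝ}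

/-- The slow deviation `(X - X⋆, X - X̂)`. -/
noncomputable def slowDev (Xs : E2) (u : State) : EuclideanSpace ℝ (Fin 2 ⊕ Fin 2) :=
  stack (u.1 - Xs, u.1 - u.2.2)

/-- The fast deviation `z - φ(·, α)`. -/
noncomputable def fastDev (Xs Us : E2) (F : Matrix (Fin 2) (Fin 2) ℝ) (u : State) : L2 :=
  u.2.1 - P.profileL2 (P.loopSlip Xs Us F u.1 u.2.2)

/-- The composite Lyapunov function. -/
noncomputable def lyapunov
    (p : EuclideanSpace ℝ (Fin 2 ⊕ Fin 2) →L[ℝ] EuclideanSpace ℝ (Fin 2 ⊕ Fin 2) →L[ℝ] ℝ)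
    (q : L2 →L[ℝ] L2 →L[ℝ] ℝ) (Xs Us : E2) (F : Matrix (Fin 2) (Fin 2) ℝ) (u : State) : ℝ :=
  p (slowDev Xs u) (slowDev Xs u) + q (P.fastDev Xs Us F u) (P.fastDev Xs Us F u)

/-- The velocity of the slip angles when `(X, z, X̂)` has velocity `N`. -/
noncomputable def slipRate (F : Matrix (Fin 2) (Fin 2) ℝ) (N : State) : E2 :=
  mv P.A₂ N.1 + mv P.G₂ (mv F N.2.2)

/-- `(1/ε) 𝒜` applied to the quasi-steady profile. -/
noncomputable def profileRate (ε : ℝ) (y : E2) : L2 :=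
  ε⁻¹ • -(P.sourceOp y (P.profileL2 y) + Lp.const 2 unitVol (P.h₂ y))

/-- An upper bound for the right derivative of the Lyapunov function. -/
noncomputable def lyapunovRate
    (p : EuclideanSpace ℝ (Fin 2 ⊕ Fin 2) →L[ℝ] EuclideanSpace ℝ (Fin 2 ⊕ Fin 2) →L[ℝ] ℝ)
    (q : L2 →L[ℝ] L2 →L[ℝ] ℝ) (κ ε M : ℝ) (Xs Us : E2) (F : Matrix (Fin 2) (Fin 2) ℝ)
    (u N : State) : ℝ :=
  2 * p (stack (N.1, N.1 - N.2.2)) (slowDev Xs u) +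
    (-(2 * κ) * q (P.fastDev Xs Us F u) (P.fastDev Xs Us F u) +
      2 * q (P.fastDev Xs Us F u)
        (N.2.1 + P.profileRate ε (P.loopSlip Xs Us F u.1 u.2.2)) +
      2 * (‖q‖ * ‖P.fastDev Xs Us F u‖ * (M * ‖P.slipRate F N‖)))

/-- `u` is a mild trajectory with nonlinearity `N` and semigroup `T` for the fast variable. -/
def IsTrajectory (T : ℝ → L2 →L[ℝ] L2) (N : State → State) (u₀ : State) (u : ℝ → State) : Prop :=
  ContinuousOn u (Ici 0) ∧ ∀ t, 0 ≤ t →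
    (u t).1 = u₀.1 + ∫ s in (0 : ℝ)..t, (N (u s)).1 ∧
    (u t).2.1 = T t u₀.2.1 + ∫ s in (0 : ℝ)..t, T (t - s) (N (u s)).2.1 ∧
    (u t).2.2 = u₀.2.2 + ∫ s in (0 : ℝ)..t, (N (u s)).2.2

lemma hasDerivWithinAt_of_eq_integral {E : Type*} [NormedAddCommGroup E] [NormedSpace ℝ E]
    [CompleteSpace E] {f g : ℝ → E} {a : E} (hg : ContinuousOn g (Ici 0))
    (hf : ∀ t, 0 ≤ t → f t = a + ∫ s in (0 : ℝ)..t, g s) {t : ℝ} (ht : 0 ≤ t) :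
    HasDerivWithinAt f (g t) (Ici t) t := by
  have hg' : Continuous fun s => g (max s 0) :=
    hg.comp_continuous (by fun_prop) fun _ => mem_Ici.2 (le_max_right _ _)
  have h1 : HasDerivAt (fun r => a + ∫ s in (0 : ℝ)..r, g (max s 0)) (g (max t 0)) t :=
    (hg'.integral_hasStrictDerivAt 0 t).hasDerivAt.const_add a
  rw [max_eq_left ht] at h1
  have h2 : ∀ r, 0 ≤ r → f r = a + ∫ s in (0 : ℝ)..r, g (max s 0) := by
    intro r hr
    rw [hf r hr]
    congr 1
    refine intervalIntegral.integral_congr fun s hs => ?_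
    rw [uIcc_of_le hr] at hs
    rw [max_eq_left hs.1]
  exact h1.hasDerivWithinAt.congr (fun r hr => h2 r (ht.trans hr)) (h2 t ht)

/-- Along mild trajectories the Lyapunov function grows at most at the rate `lyapunovRate`. -/
lemma lyapunov_dini (hd : P.StrictlyDissipative Q ω₀) (hs : P.SourceDissipative Q)
    {p : EuclideanSpace ℝ (Fin 2 ⊕ Fin 2) →L[ℝ] EuclideanSpace ℝ (Fin 2 ⊕ Fin 2) →L[ℝ] ℝ}
    {q : L2 →L[ℝ] L2 →L[ℝ] ℝ} {a c κ ε M : ℝ} (hp : IsEquivInner p a) (hq : IsEquivInner q c)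
    (hG : IsMDissipative q κ (P.fastOp ε)) {T : ℝ → L2 →L[ℝ] L2} (hT : IsStrongSemigroup T)
    (hTG : HasGenerator T (P.fastOp ε))
    (hM : ∀ y y', ‖P.profileL2 y - P.profileL2 y'‖ ≤ M * ‖y - y'‖)
    (Xs Us : E2) (F : Matrix (Fin 2) (Fin 2) ℝ) {N : State → State} (hN : Continuous N)
    {u₀ : State} {u : ℝ → State} (hu : IsTrajectory T N u₀ u) {t : ℝ} (ht : 0 ≤ t) {r : ℝ}
    (hr : P.lyapunovRate p q κ ε M Xs Us F (u t) (N (u t)) < r) :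
    ∃ᶠ s in 𝓝[>] t, slope (fun s => P.lyapunov p q Xs Us F (u s)) t s < r := by
  have hNu : ContinuousOn (fun s => N (u s)) (Ici 0) := hN.comp_continuousOn hu.1
  have hX : HasDerivWithinAt (fun s => (u s).1) (N (u t)).1 (Ici t) t :=
    hasDerivWithinAt_of_eq_integral (g := fun s => (N (u s)).1)
      (continuous_fst.comp_continuousOn hNu) (fun s hs => (hu.2 s hs).1) ht
  have hXh : HasDerivWithinAt (fun s => (u s).2.2) (N (u t)).2.2 (Ici t) t :=
    hasDerivWithinAt_of_eq_integral (g := fun s => (N (u s)).2.2)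
      (continuous_snd.comp_continuousOn (continuous_snd.comp_continuousOn hNu))
      (fun s hs => (hu.2 s hs).2.2) ht
  have hw : HasDerivWithinAt (fun s => slowDev Xs (u s)) (stack ((N (u t)).1,
      (N (u t)).1 - (N (u t)).2.2)) (Ici t) t :=
    stack.hasFDerivAt.comp_hasDerivWithinAt t ((hX.sub_const Xs).prodMk (hX.sub hXh))
  have hpw : HasDerivWithinAt (fun s => p (slowDev Xs (u s)) (slowDev Xs (u s)))
      (2 * p (stack ((N (u t)).1, (N (u t)).1 - (N (u t)).2.2)) (slowDev Xs (u t))) (Ici t) t := by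
    have h1 := (p.hasFDerivAt.comp_hasDerivWithinAt t hw).clm_apply hw
    refine h1.congr_deriv ?_
    rw [Function.comp_apply, hp.symm (slowDev Xs (u t))]
    ring
  have hα : HasDerivWithinAt (fun s => P.loopSlip Xs Us F (u s).1 (u s).2.2)
      (P.slipRate F (N (u t))) (Ici t) t := by
    have h1 := (mv P.A₂).hasFDerivAt.comp_hasDerivWithinAt t hX
    have h2 := (mv F).hasFDerivAt.comp_hasDerivWithinAt t (hXh.sub_const Xs)
    have h3 := (mv P.G₂).hasFDerivAt.comp_hasDerivWithinAt t (h2.const_add Us)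
    exact h1.add h3
  -- Steady profiles lie in the domain of 𝒜, as `energy_dini` requires of the moving reference.
  have hv : P.fastOp ε (P.profileL2 (P.loopSlip Xs Us F (u t).1 (u t).2.2))
      (P.profileRate ε (P.loopSlip Xs Us F (u t).1 (u t).2.2)) :=
    ⟨_, (P.isSteadyProfile_profile hd hs _).transportOp, rfl⟩
  obtain ⟨W, hW, hWs⟩ := energy_dini hG hq hT hTG (z := fun s => (u s).2.1)
    (π := fun s => P.profileL2 (P.loopSlip Xs Us F (u s).1 (u s).2.2))
    (g := fun s => (N (u s)).2.1)
    (continuous_fst.comp_continuousOn (continuous_snd.comp_continuousOn hNu))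
    (fun s hs => (hu.2 s hs).2.1) ht hv hα (fun s => hM _ _)
  rw [← hasDerivWithinAt_Ioi_iff_Ici, hasDerivWithinAt_iff_tendsto_slope' (by simp)] at hpw
  have h1 := (hpw.add hW).eventually_lt_const hr
  refine (((h1.and hWs).mono fun s hs => ?_)).frequently
  have e : slope (fun s => P.lyapunov p q Xs Us F (u s)) t s =
      slope (fun s => p (slowDev Xs (u s)) (slowDev Xs (u s))) t s +
      slope (fun s => q ((u s).2.1 - P.profileL2 (P.loopSlip Xs Us F (u s).1 (u s).2.2))
        ((u s).2.1 - P.profileL2 (P.loopSlip Xs Us F (u s).1 (u s).2.2))) t s := by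
    simp only [slope_def_field, lyapunov, fastDev]
    ring
  rw [e]
  linarith [hs.1, hs.2]

lemma norm_slipRate_le (F : Matrix (Fin 2) (Fin 2) ℝ) (N : State) :
    ‖P.slipRate F N‖ ≤ (‖mv P.A₂‖ + ‖mv P.G₂‖ * ‖mv F‖ * 2) * ‖stack (N.1, N.1 - N.2.2)‖ := by
  have h1 := norm_le_norm_stack_left N.1 (N.1 - N.2.2)
  have h2 := norm_le_norm_stack_right N.1 (N.1 - N.2.2)
  set ρ := ‖stack (N.1, N.1 - N.2.2)‖
  have h3 : ‖N.2.2‖ ≤ 2 * ρ := by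
    have : N.2.2 = N.1 - (N.1 - N.2.2) := by abel
    rw [this]
    exact (norm_sub_le _ _).trans (by linarith)
  calc _ ≤ ‖mv P.A₂ N.1‖ + ‖mv P.G₂ (mv F N.2.2)‖ := norm_add_le _ _
    _ ≤ ‖mv P.A₂‖ * ρ + ‖mv P.G₂‖ * (‖mv F‖ * (2 * ρ)) := by
      gcongr
      · exact (mv P.A₂).le_opNorm_of_le h1
      · exact (mv P.G₂).le_opNorm_of_le ((mv F).le_opNorm_of_le h3)
    _ = _ := by ring

/-- The Lyapunov function decreases exponentially near the equilibrium, if `ε` is small. -/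
lemma exists_lyapunovRate_le (hd : P.StrictlyDissipative Q ω₀) (hs : P.SourceDissipative Q)
    (hsm : P.SmoothSteadyState) {Xs Us : E2} (heq : P.IsEquilibrium Xs Us)
    {F : Matrix (Fin 2) (Fin 2) ℝ} {L : Matrix (Fin 2) (Fin 1) ℝ}
    {p : EuclideanSpace ℝ (Fin 2 ⊕ Fin 2) →L[ℝ] EuclideanSpace ℝ (Fin 2 ⊕ Fin 2) →L[ℝ] ℝ}
    {q : L2 →L[ℝ] L2 →L[ℝ] ℝ} {a c κ₀ M : ℝ} (ha : 0 < a) (hκ₀ : 0 < κ₀) (hM : 0 ≤ M)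
    (hpA : ∀ x, p (Matrix.toEuclideanCLM (𝕜 := ℝ)
      (P.closedLoopMatrix (P.slip Xs Us) F L) x) x ≤ -a * ‖x‖ ^ 2)
    (hq : IsEquivInner q c) (hqQ : Represents q Q) :
    ∃ εbar > 0, ∃ ρ₀ > 0, ∀ ε, 0 < ε → ε < εbar → ∀ u : State, ‖slowDev Xs u‖ ≤ ρ₀ →
      P.lyapunovRate p q (κ₀ / ε) ε M Xs Us F u (P.loopRHS ε Xs Us F L u) ≤
        -a * (‖slowDev Xs u‖ ^ 2 + ‖P.fastDev Xs Us F u‖ ^ 2) := by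
  obtain ⟨C, hC, hlin⟩ := P.exists_linearization hd hs hsm heq F L
  set A := Matrix.toEuclideanCLM (𝕜 := ℝ) (P.closedLoopMatrix (P.slip Xs Us) F L)
  -- Ensures 2‖p‖η ≤ a/2, a quarter of the slow decay 2a.
  set η := a / (4 * (‖p‖ + 1)) with hη
  have hη0 : 0 < η := by positivity
  obtain ⟨ρ₀, hρ₀, hlin⟩ := hlin η hη0
  set k := ‖mv P.A₂‖ + ‖mv P.G₂‖ * ‖mv F‖ * 2
  have hk0 : 0 ≤ k := by positivity
  -- `B` and `B'` bound the coefficients of ‖x‖‖ζ‖ and ‖ζ‖² coming from the coupling; neither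
  -- involves ε.
  set B := 2 * (‖p‖ * C) + 2 * (‖q‖ * (M * (k * (‖A‖ + η)))) with hB
  set B' := 2 * (‖q‖ * (M * (k * C))) with hB'
  have hB0 : 0 ≤ B := by positivity
  have hB0' : 0 ≤ B' := by positivity
  have hc := hq.pos
  -- Below this threshold 2(κ₀/ε)c ≥ B²/(2a) + B' + a. The fast gain then pays for the ‖ζ‖² part of
  -- Young's inequality, for B', and leaves a. On the slow side -2a + a/2 + a/2 = -a remains.
  refine ⟨2 * κ₀ * c / (B ^ 2 / (2 * a) + B' + a), by positivity, ρ₀, hρ₀,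
    fun ε hε hεb u hu => ?_⟩
  set N := P.loopRHS ε Xs Us F L u with hN
  set x := slowDev Xs u with hx
  set ζ := P.fastDev Xs Us F u with hζ
  set y := P.loopSlip Xs Us F u.1 u.2.2 with hy
  have hrem : ‖stack (N.1, N.1 - N.2.2) - A x‖ ≤ η * ‖x‖ + C * ‖ζ‖ := hlin u.1 u.2.2 u.2.1 hu
  set w := stack (N.1, N.1 - N.2.2) with hw
  have hwn : ‖w‖ ≤ (‖A‖ + η) * ‖x‖ + C * ‖ζ‖ := by
    have h1 := norm_add_le (w - A x) (A x)
    rw [sub_add_cancel] at h1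
    have h2 := A.le_opNorm x
    linarith
  have hα : ‖P.slipRate F N‖ ≤ k * ((‖A‖ + η) * ‖x‖ + C * ‖ζ‖) :=
    (P.norm_slipRate_le F N).trans (by gcongr)
  have hfast : q ζ (N.2.1 + P.profileRate ε y) ≤ 0 := by
    -- The term h₂ cancels between the source and the profile equation, leaving Σ(y) acting on the
    -- deviation alone.
    have e : N.2.1 + P.profileRate ε y = ε⁻¹ • P.sourceOp y ζ := by
      rw [hN, loopRHS, profileRate, pdeSource_eq, hζ, fastDev,
        show P.slip u.1 (feedback Xs Us F u.2.2) = y from rfl, ← hy, ← smul_add, map_sub]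
      congr 1
      abel
    rw [e, map_smul, smul_eq_mul, hq.symm]
    exact mul_nonpos_of_nonneg_of_nonpos (by positivity) (P.sourceOp_dissipative hd hs hqQ y ζ)
  have hslow : p w x ≤ -a * ‖x‖ ^ 2 + ‖p‖ * (η * ‖x‖ + C * ‖ζ‖) * ‖x‖ := by
    have h1 : p w x = p (A x) x + p (w - A x) x := by
      rw [map_sub, sub_apply]; ring
    have h2 := (abs_le.1 (apply_le_norm p (w - A x) x)).2
    have h3 : ‖p‖ * ‖w - A x‖ * ‖x‖ ≤ ‖p‖ * (η * ‖x‖ + C * ‖ζ‖) * ‖x‖ := by gcongr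
    linarith [hpA x]
  have hpη : ‖p‖ * η ≤ a / 4 := by
    rw [hη, mul_div_assoc', div_le_div_iff₀ (by positivity) (by positivity)]
    nlinarith [norm_nonneg p]
  have hcross : 2 * (‖q‖ * ‖ζ‖ * (M * ‖P.slipRate F N‖)) ≤
      2 * (‖q‖ * (M * (k * (‖A‖ + η)))) * ‖x‖ * ‖ζ‖ + B' * ‖ζ‖ ^ 2 := by
    calc _ ≤ 2 * (‖q‖ * ‖ζ‖ * (M * (k * ((‖A‖ + η) * ‖x‖ + C * ‖ζ‖)))) := by gcongr
      _ = _ := by rw [hB']; ring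
  have hyoung : B * ‖x‖ * ‖ζ‖ ≤ a / 2 * ‖x‖ ^ 2 + B ^ 2 / (2 * a) * ‖ζ‖ ^ 2 := by
    have h1 : a / 2 * ‖x‖ ^ 2 + B ^ 2 / (2 * a) * ‖ζ‖ ^ 2 - B * ‖x‖ * ‖ζ‖ =
        (a * ‖x‖ - B * ‖ζ‖) ^ 2 / (2 * a) := by
      field_simp; ring
    have h2 : 0 ≤ (a * ‖x‖ - B * ‖ζ‖) ^ 2 / (2 * a) := by positivity
    linarith
  have hgain : (B ^ 2 / (2 * a) + B' + a) * ‖ζ‖ ^ 2 ≤ 2 * (κ₀ / ε) * q ζ ζ := by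
    rw [lt_div_iff₀ (by positivity)] at hεb
    have h1 : B ^ 2 / (2 * a) + B' + a ≤ 2 * (κ₀ / ε) * c := by
      rw [show 2 * (κ₀ / ε) * c = 2 * κ₀ * c / ε by ring, le_div_iff₀ hε]
      linarith
    calc _ ≤ 2 * (κ₀ / ε) * c * ‖ζ‖ ^ 2 := by gcongr
      _ = 2 * (κ₀ / ε) * (c * ‖ζ‖ ^ 2) := by ring
      _ ≤ _ := by gcongr; exact hq.coercive ζ
  have hpη' : ‖p‖ * η * ‖x‖ ^ 2 ≤ a / 4 * ‖x‖ ^ 2 := by gcongr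
  rw [lyapunovRate, ← hw, ← hx, ← hζ, ← hy]
  have hBe : B * ‖x‖ * ‖ζ‖ = 2 * (‖p‖ * C) * ‖x‖ * ‖ζ‖ +
      2 * (‖q‖ * (M * (k * (‖A‖ + η)))) * ‖x‖ * ‖ζ‖ := by rw [hB]; ring
  have hse : ‖p‖ * (η * ‖x‖ + C * ‖ζ‖) * ‖x‖ = ‖p‖ * η * ‖x‖ ^ 2 + ‖p‖ * C * ‖x‖ * ‖ζ‖ := by ring
  rw [hse] at hslow
  clear_value A k w N x ζ y
  linarith [hslow, hcross, hyoung, hgain, hpη', hfast, hBe]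

end SingleTrackModel

/-! ### Exponential decay of small trajectories -/

namespace SingleTrackModel

variable (P : SingleTrackModel) {Q : ℝ → Matrix (Fin 2) (Fin 2) ℝ} {ω₀ : ℝ}

/-- The size of the deviation from the equilibrium and the quasi-steady profile. -/
noncomputable def devNorm (Xs Us : E2) (F : Matrix (Fin 2) (Fin 2) ℝ) (u : State) : ℝ :=
  Real.sqrt (‖slowDev Xs u‖ ^ 2 + ‖P.fastDev Xs Us F u‖ ^ 2)

lemma devNorm_sq (Xs Us : E2) (F : Matrix (Fin 2) (Fin 2) ℝ) (u : State) :
    P.devNorm Xs Us F u ^ 2 = ‖slowDev Xs u‖ ^ 2 + ‖P.fastDev Xs Us F u‖ ^ 2 :=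
  Real.sq_sqrt (by positivity)

lemma devNorm_nonneg (Xs Us : E2) (F : Matrix (Fin 2) (Fin 2) ℝ) (u : State) :
    0 ≤ P.devNorm Xs Us F u := Real.sqrt_nonneg _

lemma devNorm_eq_stateNorm (Xs Us : E2) (F : Matrix (Fin 2) (Fin 2) ℝ) (X : E2) (z : L2)
    (Xt : E2) : P.devNorm Xs Us F (X, z, X - Xt) =
      stateNorm (X - Xs) (P.deviation Xs Us F X z Xt) Xt := by
  rw [devNorm, slowDev, norm_stack_sq, stateNorm, sub_sub_cancel]
  congr 1
  rw [add_right_comm]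
  rfl

lemma exists_norm_le_of_dev (hd : P.StrictlyDissipative Q ω₀) (hs : P.SourceDissipative Q)
    (hsm : P.SmoothSteadyState) (Xs Us : E2) (F : Matrix (Fin 2) (Fin 2) ℝ) (ρ s : ℝ) :
    ∃ R > 0, ∀ u : State, ‖slowDev Xs u‖ ≤ ρ → ‖P.fastDev Xs Us F u‖ ≤ s → ‖u‖ ≤ R := by
  set k := ‖mv P.A₂‖ + ‖mv P.G₂‖ * ‖mv F‖ * 2
  obtain ⟨b, hb0, hb⟩ := (P.lipschitzOnBounded_profileL2 hd hs hsm).exists_bound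
    (‖P.slip Xs Us‖ + k * ρ)
  refine ⟨‖Xs‖ + 2 * |ρ| + |s| + b + 1, by positivity, fun u hu hζ => ?_⟩
  have h1 := norm_le_norm_stack_left (u.1 - Xs) (u.1 - u.2.2)
  have h2 := norm_le_norm_stack_right (u.1 - Xs) (u.1 - u.2.2)
  have h3 := P.norm_loopSlip_sub_le Xs Us F u.1 u.2.2
  change ‖u.1 - Xs‖ ≤ ‖slowDev Xs u‖ at h1
  change ‖u.1 - u.2.2‖ ≤ ‖slowDev Xs u‖ at h2
  change _ ≤ k * ‖slowDev Xs u‖ at h3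
  set y := P.loopSlip Xs Us F u.1 u.2.2 with hy
  have h4 : ‖y‖ ≤ ‖P.slip Xs Us‖ + k * ρ := by
    have h5 := norm_add_le (y - P.slip Xs Us) (P.slip Xs Us)
    rw [sub_add_cancel] at h5
    have h6 : k * ‖slowDev Xs u‖ ≤ k * ρ := by gcongr
    linarith
  have hz : ‖u.2.1‖ ≤ s + b := by
    have h5 := norm_add_le (P.fastDev Xs Us F u) (P.profileL2 y)
    rw [fastDev, ← hy, sub_add_cancel] at h5
    rw [fastDev, ← hy] at hζ
    linarith [hb y h4]
  have hX : ‖u.1‖ ≤ ‖Xs‖ + ρ := by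
    have h5 := norm_add_le (u.1 - Xs) Xs
    rw [sub_add_cancel] at h5
    linarith
  have hXh : ‖u.2.2‖ ≤ ‖Xs‖ + 2 * ρ := by
    have h5 := norm_sub_le u.1 (u.1 - u.2.2)
    rw [sub_sub_cancel] at h5
    linarith
  have hρ := le_abs_self ρ
  have hs' := le_abs_self s
  have hρ0 := abs_nonneg ρ
  have hs0 := abs_nonneg s
  have hXs := norm_nonneg Xs
  rw [Prod.norm_def, Prod.norm_def]
  refine max_le ?_ (max_le ?_ ?_) <;> linarith

lemma IsTrajectory.initial {T : ℝ → L2 →L[ℝ] L2} (hT : IsStrongSemigroup T) {N : State → State}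
    {u₀ : State} {u : ℝ → State} (hu : IsTrajectory T N u₀ u) : u 0 = u₀ := by
  obtain ⟨h1, h2, h3⟩ := hu.2 0 le_rfl
  rw [intervalIntegral.integral_same, add_zero] at h1 h2 h3
  rw [hT.zero] at h2
  exact Prod.ext h1 (Prod.ext h2 h3)

/-- Any `N` agreeing with the closed loop on the ball of radius R is allowed, so the estimate serves
both the truncated problem (existence) and the original one (uniqueness). All constants are chosen
before ε. -/
lemma exists_decay (hd : P.StrictlyDissipative Q ω₀) (hs : P.SourceDissipative Q)
    (hsm : P.SmoothSteadyState) {Xs Us : E2} (heq : P.IsEquilibrium Xs Us)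
    {F : Matrix (Fin 2) (Fin 2) ℝ} {L : Matrix (Fin 2) (Fin 1) ℝ}
    (hH : IsHurwitz (P.closedLoopMatrix (P.slip Xs Us) F L))
    {q : L2 →L[ℝ] L2 →L[ℝ] ℝ} {c : ℝ} (hq : IsEquivInner q c) (hqQ : Represents q Q) :
    ∃ εbar > 0, ∃ r > 0, ∃ β > 0, ∃ σ > 0, ∃ R > 0, ∀ ε, 0 < ε → ε < εbar →
      ∀ T : ℝ → L2 →L[ℝ] L2, IsStrongSemigroup T → HasGenerator T (P.fastOp ε) →
      ∀ N : State → State, Continuous N → (∀ v, ‖v‖ ≤ R → N v = P.loopRHS ε Xs Us F L v) →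
      ∀ (u₀ : State) (u : ℝ → State), IsTrajectory T N u₀ u → P.devNorm Xs Us F u₀ < r →
      ∀ t, 0 ≤ t → P.devNorm Xs Us F (u t) ≤ β * Real.exp (-σ * t) * P.devNorm Xs Us F u₀ ∧
        ‖u t‖ ≤ R := by
  obtain ⟨p, a, hp, ha, hpA⟩ := hH.exists_lyapunov
  obtain ⟨M, hM, hMπ, -⟩ := P.toL2_profile_lipschitz hd hs hsm
  have hc := hq.pos
  have hdiss := P.isMDissipative_transportOp hd hqQ
  obtain ⟨εbar, hεbar, ρ₀, hρ₀, hrate⟩ := P.exists_lyapunovRate_le hd hs hsm heq (F := F) (L := L)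
    ha hdiss.rate_pos hM hpA hq hqQ
  -- On V ≤ ρ₀² one has ‖x‖ ≤ ρ₀ and c‖ζ‖² ≤ ρ₀², and R bounds the whole state there.
  obtain ⟨R, hR, hRu⟩ := P.exists_norm_le_of_dev hd hs hsm Xs Us F ρ₀ (Real.sqrt (ρ₀ ^ 2 / c))
  set m := ‖p‖ + ‖q‖ + 1 with hm
  have hm1 : 1 ≤ m := by linarith [norm_nonneg p, norm_nonneg q]
  have hm0 : 0 < m := by linarith
  set c' := min 1 c with hc'
  have hc'0 : 0 < c' := lt_min one_pos hc
  have hup : ∀ u, P.lyapunov p q Xs Us F u ≤ m * P.devNorm Xs Us F u ^ 2 := by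
    intro u
    rw [devNorm_sq, lyapunov]
    have h1 := (abs_le.1 (apply_le_norm p (slowDev Xs u) (slowDev Xs u))).2
    have h2 := (abs_le.1 (apply_le_norm q (P.fastDev Xs Us F u) (P.fastDev Xs Us F u))).2
    nlinarith [mul_nonneg (norm_nonneg p) (sq_nonneg ‖P.fastDev Xs Us F u‖),
      mul_nonneg (norm_nonneg q) (sq_nonneg ‖slowDev Xs u‖), sq_nonneg ‖slowDev Xs u‖,
      sq_nonneg ‖P.fastDev Xs Us F u‖]
  have hlow' : ∀ u, ‖slowDev Xs u‖ ^ 2 + c * ‖P.fastDev Xs Us F u‖ ^ 2 ≤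
      P.lyapunov p q Xs Us F u := by
    intro u
    rw [lyapunov]
    linarith [hp.coercive (slowDev Xs u), hq.coercive (P.fastDev Xs Us F u)]
  have hlow : ∀ u, c' * P.devNorm Xs Us F u ^ 2 ≤ P.lyapunov p q Xs Us F u := by
    intro u
    refine le_trans ?_ (hlow' u)
    rw [devNorm_sq, mul_add]
    gcongr
    · exact mul_le_of_le_one_left (by positivity) (min_le_left _ _)
    · exact min_le_right _ _
  have hsmall : ∀ u, P.lyapunov p q Xs Us F u ≤ ρ₀ ^ 2 → ‖slowDev Xs u‖ ≤ ρ₀ ∧ ‖u‖ ≤ R := by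
    intro u hu
    have h0 := hlow' u
    have h1 : ‖slowDev Xs u‖ ≤ ρ₀ := abs_le_of_sq_le_sq' (by
      nlinarith [mul_nonneg hc.le (sq_nonneg ‖P.fastDev Xs Us F u‖)]) hρ₀.le |>.2
    refine ⟨h1, hRu u h1 (Real.le_sqrt_of_sq_le ?_)⟩
    rw [le_div_iff₀ hc]
    nlinarith [sq_nonneg ‖slowDev Xs u‖]
  -- Since m ≥ 1, deviation below ρ₀/m gives V(0) < ρ₀². The rate a/m of V is halved by the fencing
  -- lemma and once more by taking the square root.
  refine ⟨εbar, hεbar, ρ₀ / m, by positivity, Real.sqrt (m / c'), by positivity, a / m / 4,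
    by positivity, R, hR, ?_⟩
  intro ε hε hεb T hT hTG N hN hNR u₀ u hu hu₀ t ht
  have hinit := hu.initial hT
  have hn0 := P.devNorm_nonneg Xs Us F u₀
  have hV0 : P.lyapunov p q Xs Us F (u 0) < ρ₀ ^ 2 := by
    rw [hinit]
    refine (hup u₀).trans_lt ?_
    rw [lt_div_iff₀ hm0] at hu₀
    have h1 : m * P.devNorm Xs Us F u₀ ^ 2 ≤ (P.devNorm Xs Us F u₀ * m) ^ 2 := by
      nlinarith [mul_nonneg hm0.le (sq_nonneg (P.devNorm Xs Us F u₀))]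
    have h2 : (P.devNorm Xs Us F u₀ * m) ^ 2 < ρ₀ ^ 2 := by gcongr
    linarith
  have hVpos : ∀ s, 0 ≤ P.lyapunov p q Xs Us F (u s) := fun s =>
    le_trans (by positivity) (hlow (u s))
  have hlip := P.lipschitzOnBounded_profileL2 hd hs hsm
  have hVc : ContinuousOn (fun s => P.lyapunov p q Xs Us F (u s)) (Ici 0) := by
    have hc1 : Continuous fun v : State => slowDev Xs v := by
      unfold slowDev; fun_prop
    have hc2 : Continuous fun v : State => P.fastDev Xs Us F v := by
      have h1 : Continuous fun v : State => P.loopSlip Xs Us F v.1 v.2.2 := by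
        unfold loopSlip slip feedback; fun_prop
      exact (continuous_fst.comp continuous_snd).sub (hlip.continuous.comp h1)
    have hc3 : Continuous fun v : State => P.lyapunov p q Xs Us F v := by
      unfold lyapunov; fun_prop
    exact hc3.comp_continuousOn hu.1
  have hG := P.isMDissipative_fastOp hε hdiss
  have hdecay := fun s (hs0 : 0 ≤ s) => exp_decay_of_dini
    (V := fun s => P.lyapunov p q Xs Us F (u s))
    (D := fun s => P.lyapunovRate p q (ω₀ / (‖q‖ + 1) / ε) ε M Xs Us F (u s) (N (u s)))
    (v := ρ₀ ^ 2) (c := a / m) (by positivity) hVc (hVpos 0) hV0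
    (fun s hs0 r hr => P.lyapunov_dini hd hs hp hq hG hT hTG hMπ Xs Us F hN hu hs0 hr)
    (fun s _ hVs => by
      obtain ⟨h1, h2⟩ := hsmall _ hVs
      rw [hNR _ h2]
      refine (hrate ε hε hεb _ h1).trans ?_
      rw [← devNorm_sq]
      have h3 := hup (u s)
      have h4 : a / m * P.lyapunov p q Xs Us F (u s) ≤ a * P.devNorm Xs Us F (u s) ^ 2 := by
        rw [div_mul_eq_mul_div, div_le_iff₀ hm0]
        nlinarith
      linarith) hs0
  have hVt := hdecay t ht
  have hexp : Real.exp (-(a / m / 2) * t) = Real.exp (-(a / m / 4) * t) ^ 2 := by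
    rw [← Real.exp_nat_mul]; congr 1; push_cast; ring
  refine ⟨?_, (hsmall _ ?_).2⟩
  · refine abs_le_of_sq_le_sq' ?_ (by positivity) |>.2
    rw [mul_pow, mul_pow, Real.sq_sqrt (by positivity), ← hexp, div_mul_eq_mul_div,
      div_mul_eq_mul_div, le_div_iff₀ hc'0]
    have h1 := hlow (u t)
    have h2 := hup u₀
    rw [hinit] at hVt
    have h3 := mul_le_mul_of_nonneg_right h2 (Real.exp_pos (-(a / m / 2) * t)).le
    linarith
  · refine hVt.trans ((mul_le_of_le_one_right (hVpos 0) (Real.exp_le_one_iff.2 ?_)).trans hV0.le)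
    have : 0 ≤ a / m / 2 * t := by positivity
    linarith

end SingleTrackModel

/-! ### Well-posedness of the closed loop -/

namespace SingleTrackModel

variable (P : SingleTrackModel) {Q : ℝ → Matrix (Fin 2) (Fin 2) ℝ} {ω₀ : ℝ}

/-- The semigroup of the fast variable, extended trivially to the whole state. -/
noncomputable def stateSemigroup (T : ℝ → L2 →L[ℝ] L2) (t : ℝ) : State →L[ℝ] State :=
  (ContinuousLinearMap.id ℝ E2).prodMap ((T (max t 0)).prodMap (ContinuousLinearMap.id ℝ E2))

lemma stateSemigroup_apply (T : ℝ → L2 →L[ℝ] L2) (t : ℝ) (u : State) :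
    stateSemigroup T t u = (u.1, T (max t 0) u.2.1, u.2.2) := rfl

lemma continuous_stateSemigroup {T : ℝ → L2 →L[ℝ] L2} (hT : IsStrongSemigroup T) (u : State) :
    Continuous fun t => stateSemigroup T t u :=
  continuous_const.prodMk ((hT.continuous_extend u.2.1).prodMk continuous_const)

lemma norm_stateSemigroup_le {T : ℝ → L2 →L[ℝ] L2} {K : ℝ} (hK : ∀ t, 0 ≤ t → ‖T t‖ ≤ K)
    (t : ℝ) : ‖stateSemigroup T t‖ ≤ max 1 K := by
  refine ContinuousLinearMap.opNorm_le_bound _ (by positivity) fun u => ?_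
  have h1 : ‖u.1‖ ≤ ‖u‖ := norm_fst_le u
  have h2 : ‖u.2.1‖ ≤ ‖u‖ := (norm_fst_le u.2).trans (norm_snd_le u)
  have h3 : ‖u.2.2‖ ≤ ‖u‖ := (norm_snd_le u.2).trans (norm_snd_le u)
  have h4 : ‖u‖ ≤ max 1 K * ‖u‖ := le_mul_of_one_le_left (norm_nonneg u) (le_max_left 1 K)
  rw [stateSemigroup_apply, Prod.norm_def, Prod.norm_def]
  refine max_le (h1.trans h4) (max_le ?_ (h3.trans h4))
  refine (ContinuousLinearMap.le_opNorm _ _).trans ?_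
  gcongr
  exact (hK _ (le_max_right t 0)).trans (le_max_right 1 K)

lemma isTrajectory_iff {T : ℝ → L2 →L[ℝ] L2} (hT : IsStrongSemigroup T) {K : ℝ}
    (hK : ∀ t, 0 ≤ t → ‖T t‖ ≤ K) {N : State → State} (hN : Continuous N) {u₀ : State}
    {u : ℝ → State} (hu : ContinuousOn u (Ici 0)) :
    IsTrajectory T N u₀ u ↔ ∀ t, 0 ≤ t →
      u t = stateSemigroup T t u₀ + ∫ s in (0 : ℝ)..t, stateSemigroup T (t - s) (N (u s)) := by
  have hS := continuous_uncurry_of_strong (continuous_stateSemigroup hT)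
    (norm_stateSemigroup_le hK)
  rw [IsTrajectory, and_iff_right hu]
  refine forall₂_congr fun t ht => ?_
  have hint : IntervalIntegrable (fun s => stateSemigroup T (t - s) (N (u s))) volume 0 t := by
    refine ContinuousOn.intervalIntegrable ?_
    rw [uIcc_of_le ht]
    exact hS.comp_continuousOn (f := fun s => (t - s, N (u s)))
      ((by fun_prop : Continuous fun s => t - s).continuousOn.prodMk
        (hN.comp_continuousOn (hu.mono Icc_subset_Ici_self)))
  set I := ∫ s in (0 : ℝ)..t, stateSemigroup T (t - s) (N (u s)) with hI
  have h1 : I.1 = ∫ s in (0 : ℝ)..t, (N (u s)).1 :=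
    ((ContinuousLinearMap.fst ℝ E2 (L2 × E2)).intervalIntegral_comp_comm hint).symm
  have h2 : I.2.1 = ∫ s in (0 : ℝ)..t, T (t - s) (N (u s)).2.1 := by
    refine (((ContinuousLinearMap.fst ℝ L2 E2).comp
      (ContinuousLinearMap.snd ℝ E2 (L2 × E2))).intervalIntegral_comp_comm hint).symm.trans ?_
    refine intervalIntegral.integral_congr fun s hs => ?_
    rw [uIcc_of_le ht] at hs
    change T (max (t - s) 0) (N (u s)).2.1 = _
    rw [max_eq_left (by linarith [hs.2])]
  have h3 : I.2.2 = ∫ s in (0 : ℝ)..t, (N (u s)).2.2 :=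
    (((ContinuousLinearMap.snd ℝ L2 E2).comp
      (ContinuousLinearMap.snd ℝ E2 (L2 × E2))).intervalIntegral_comp_comm hint).symm
  rw [← h1, ← h2, ← h3, Prod.ext_iff, Prod.ext_iff, stateSemigroup_apply, max_eq_left ht]
  rfl

/-- Used to remove or insert the truncation, and to exchange two semigroups with the same generator.
-/
lemma isTrajectory_congr {T T' : ℝ → L2 →L[ℝ] L2} (hT : ∀ t, 0 ≤ t → T t = T' t)
    {N N' : State → State} {u₀ : State} {u : ℝ → State} (hu : IsTrajectory T N u₀ u)
    (hN : ∀ t, 0 ≤ t → N (u t) = N' (u t)) : IsTrajectory T' N' u₀ u := by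
  refine ⟨hu.1, fun t ht => ?_⟩
  obtain ⟨h1, h2, h3⟩ := hu.2 t ht
  have h0 : ∀ s ∈ uIcc 0 t, 0 ≤ s ∧ s ≤ t := fun s hs => by rwa [uIcc_of_le ht] at hs
  refine ⟨h1.trans ?_, h2.trans ?_, h3.trans ?_⟩
  · congr 1
    exact intervalIntegral.integral_congr fun s hs => congrArg Prod.fst (hN s (h0 s hs).1)
  · rw [hT t ht]
    congr 1
    refine intervalIntegral.integral_congr fun s hs => ?_
    rw [hN s (h0 s hs).1, hT (t - s) (by linarith [(h0 s hs).2])]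
  · congr 1
    exact intervalIntegral.integral_congr fun s hs =>
      congrArg (fun v => v.2.2) (hN s (h0 s hs).1)

lemma isMildSolution_of_isTrajectory {ε : ℝ} {Xs Us : E2} {F : Matrix (Fin 2) (Fin 2) ℝ}
    {L : Matrix (Fin 2) (Fin 1) ℝ} {X₀ : E2} {z₀ : L2} {Xt₀ : E2} {T : ℝ → L2 →L[ℝ] L2}
    (hT : IsStrongSemigroup T) (hTG : HasGenerator T (P.fastOp ε)) {u : ℝ → State}
    (hu : IsTrajectory T (P.loopRHS ε Xs Us F L) (X₀, z₀, X₀ - Xt₀) u) :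
    P.IsMildSolution ε Xs Us F L X₀ z₀ Xt₀ (fun t => (u t).1) (fun t => (u t).2.1)
      fun t => (u t).1 - (u t).2.2 := by
  have h1 : ContinuousOn (fun t => (u t).1) (Ici 0) := continuous_fst.comp_continuousOn hu.1
  have h2 : ContinuousOn (fun t => (u t).2) (Ici 0) := continuous_snd.comp_continuousOn hu.1
  refine ⟨h1, continuous_fst.comp_continuousOn h2,
    h1.sub (continuous_snd.comp_continuousOn h2), T, ⟨hT.zero, hT.add, hT.strongCont⟩, hTG, ?_⟩
  simp only [sub_sub_cancel]
  exact hu.2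

lemma IsMildSolution.exists_isTrajectory {P : SingleTrackModel} {ε : ℝ} {Xs Us : E2}
    {F : Matrix (Fin 2) (Fin 2) ℝ} {L : Matrix (Fin 2) (Fin 1) ℝ} {X₀ : E2} {z₀ : L2} {Xt₀ : E2}
    {X : ℝ → E2} {z : ℝ → L2} {Xt : ℝ → E2}
    (h : P.IsMildSolution ε Xs Us F L X₀ z₀ Xt₀ X z Xt) :
    ∃ T, IsStrongSemigroup T ∧ HasGenerator T (P.fastOp ε) ∧
      IsTrajectory T (P.loopRHS ε Xs Us F L) (X₀, z₀, X₀ - Xt₀)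
        fun t => (X t, z t, X t - Xt t) := by
  obtain ⟨hX, hz, hXt, T, hT, hTG, hsol⟩ := h
  exact ⟨T, ⟨hT.zero, hT.add, hT.strongCont⟩, hTG, hX.prodMk (hz.prodMk (hX.sub hXt)), hsol⟩

end SingleTrackModel

theorem mainTheorem3 (P : SingleTrackModel)
    (Q : ℝ → Matrix (Fin 2) (Fin 2) ℝ) (ω₀ : ℝ)
    (hdiss : P.StrictlyDissipative Q ω₀)
    (hsource : P.SourceDissipative Q)
    (hsmooth : P.SmoothSteadyState)
    (Xs Us : E2) (heq : P.IsEquilibrium Xs Us)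
    (hstab : IsStabilizable (P.Atilde (P.slip Xs Us)) (P.Gtilde (P.slip Xs Us)))
    (hdet : IsDetectable (P.Atilde (P.slip Xs Us)) yawRateOutput)
    (F : Matrix (Fin 2) (Fin 2) ℝ) (L : Matrix (Fin 2) (Fin 1) ℝ)
    (hHurwitz : IsHurwitz (P.closedLoopMatrix (P.slip Xs Us) F L)) :
    ∃ εbar > (0 : ℝ), ∃ rbar > (0 : ℝ), ∃ β > (0 : ℝ), ∃ σ > (0 : ℝ),
      ∀ ε ∈ Ioo (0 : ℝ) εbar, ∀ (X₀ : E2) (z₀ : L2) (Xt₀ : E2),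
        stateNorm (X₀ - Xs) (P.deviation Xs Us F X₀ z₀ Xt₀) Xt₀ < rbar →
        ∃ (X : ℝ → E2) (z : ℝ → L2) (Xt : ℝ → E2),
          P.IsMildSolution ε Xs Us F L X₀ z₀ Xt₀ X z Xt ∧
          (∀ t : ℝ, 0 ≤ t →
            stateNorm (X t - Xs) (P.deviation Xs Us F (X t) (z t) (Xt t)) (Xt t) ≤
              β * Real.exp (-σ * t) *
                stateNorm (X₀ - Xs) (P.deviation Xs Us F X₀ z₀ Xt₀) Xt₀) ∧
          ∀ (X' : ℝ → E2) (z' : ℝ → L2) (Xt' : ℝ → E2),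
            P.IsMildSolution ε Xs Us F L X₀ z₀ Xt₀ X' z' Xt' →
            EqOn X' X (Ici 0) ∧ EqOn z' z (Ici 0) ∧ EqOn Xt' Xt (Ici 0) := by
  obtain ⟨q, c, hq, hqQ⟩ := exists_weighted_inner hdiss.Q_cont hdiss.Q_diag hdiss.Q_posDef
  obtain ⟨εbar, hεbar, r, hr, β, hβ, σ, hσ, R, hR, hdecay⟩ :=
    P.exists_decay hdiss hsource hsmooth heq hHurwitz hq hqQ
  refine ⟨εbar, hεbar, r, hr, β, hβ, σ, hσ, fun ε hε X₀ z₀ Xt₀ hinit => ?_⟩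
  have hG := P.isMDissipative_fastOp hε.1 (P.isMDissipative_transportOp hdiss hqQ)
  obtain ⟨T, hT, hTG⟩ := hG.exists_semigroup hq
  have hK : ∀ t, 0 ≤ t → ‖T t‖ ≤ _ := fun t ht => hG.semigroup_norm_le hq hT hTG ht
  have hloc := P.lipschitzOnBounded_loopRHS hdiss hsource hsmooth ε Xs Us F L
  obtain ⟨⟨Lip, hLip⟩, b, hb⟩ := hloc.comp_radial hR
  set N := P.loopRHS ε Xs Us F L
  -- The truncated nonlinearity is bounded and globally Lipschitz; the decay estimate later shows
  -- that its solution never leaves the ball of radius R.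
  set NR : SingleTrackModel.State → SingleTrackModel.State := fun v => N (radial R v) with hNR
  have hNRc : Continuous NR := (LipschitzWith.of_dist_le_mul (K := Lip.toNNReal) fun x y => by
    rw [dist_eq_norm, dist_eq_norm]
    exact (hLip x y).trans (by gcongr; exact Real.le_coe_toNNReal Lip)).continuous
  have hNRe : ∀ v, ‖v‖ ≤ R → NR v = N v := fun v hv => by
    rw [hNR]; exact congrArg N (radial_of_norm_le hR hv)
  have hS := SingleTrackModel.continuous_stateSemigroup hT
  have hSK := SingleTrackModel.norm_stateSemigroup_le hK
  set u₀ : SingleTrackModel.State := (X₀, z₀, X₀ - Xt₀) with hu₀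
  have hdev : P.devNorm Xs Us F u₀ < r := by
    rw [hu₀, P.devNorm_eq_stateNorm]; exact hinit
  obtain ⟨u, huc, hue⟩ := exists_mild hS hSK hLip hb u₀
  have hutraj : SingleTrackModel.IsTrajectory T NR u₀ u :=
    (SingleTrackModel.isTrajectory_iff hT hK hNRc huc.continuousOn).2 hue
  have hud := hdecay ε hε.1 hε.2 T hT hTG NR hNRc hNRe u₀ u hutraj hdev
  have husol := SingleTrackModel.isTrajectory_congr (fun _ _ => rfl) hutraj
    fun t ht => hNRe _ (hud t ht).2
  refine ⟨_, _, _, P.isMildSolution_of_isTrajectory hT hTG husol, fun t ht => ?_, ?_⟩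
  · have h1 := (hud t ht).1
    have h2 : u t = ((u t).1, (u t).2.1, (u t).1 - ((u t).1 - (u t).2.2)) := by
      rw [sub_sub_cancel]
    rw [h2, hu₀, P.devNorm_eq_stateNorm, P.devNorm_eq_stateNorm] at h1
    exact h1
  · intro X' z' Xt' h'
    obtain ⟨T', hT', hTG', htraj'⟩ := h'.exists_isTrajectory
    -- The a priori estimate applied to an arbitrary mild solution, without truncation: it stays in
    -- the ball, so it also solves the truncated problem.
    have hu'd := hdecay ε hε.1 hε.2 T' hT' hTG' N hloc.continuous (fun _ _ => rfl) u₀ _ htraj' hdev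
    have htraj'' := SingleTrackModel.isTrajectory_congr
      -- A mild solution carries its own semigroup; having the same generator, it coincides with `T`
      -- for t ≥ 0.
      (fun t ht => hG.semigroup_unique hq hT' hTG' hT hTG ht) htraj'
      fun t ht => (hNRe _ (hu'd t ht).2).symm
    have heqOn := mild_unique hS hSK hLip htraj''.1 huc.continuousOn
      ((SingleTrackModel.isTrajectory_iff hT hK hNRc htraj''.1).1 htraj'') hue
    refine ⟨fun t ht => congrArg Prod.fst (heqOn ht), fun t ht =>
      congrArg (fun v => v.2.1) (heqOn ht), fun t ht => ?_⟩
    have h1 : X' t - (X' t - Xt' t) = (u t).1 - (u t).2.2 :=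
      congrArg (fun v => v.1 - v.2.2) (heqOn ht)
    rwa [sub_sub_cancel] at h1
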